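/- **Setting.** Let $R,T_0>0$, $a<b$, and let $D=\{x\in\mathbb R^3: r<R,\ a<x_3<b\}$, where $r=\sqrt{x_1^2+x_2^2}$; put $e_r=(x_1/r,x_2/r,0)$, $e_\theta=(-x_2/r,x_1/r,0)$, $e_3=(0,0,1)$. Let $(v,p)$ be a solution of the Euler equations $\partial_t v+v\cdot\nabla v+\nabla p=0$, $\nabla\cdot v=0$ on $D\times[0,T_0)$, with $v$ smooth up to the side and axially symmetric, $v=v^r(r,x_3,t)e_r+v^\theta(r,x_3,t)e_\theta+v^{3}(r,x_3,t)e_3$, with $v\cdot e_r=0$ on the side $r=R$ and $v$ periodic in $x_3$ with period $b-a$. We regard $v$ as a periodic field, and $(v,p)$ as a solution, on $\mathcal D\times[0,T_0)$, $\mathcal D=\{r\le R\}$; only $v$, not $p$, is required to be periodic. **Blow-up sequences.** Fix $\alpha\in(0,1)$. *Blow-up points off the axis* are $(x_k,t_k)\in\mathcal D\times[0,T_0)$ with $x_k\to x_*$, $t_k\to T_0$, $|v(x_k,t_k)|\to\infty$ and $r(x_k)>d$ for a fixed $d>0$. Given $Q_k>0$ with $c^{-1}|v(x_k,t_k)|\le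 Q_k\le c|v(x_k,t_k)|$ for a fixed $c\ge1$, put $x=Q_k^{-(1-\alpha)/\alpha}\tilde x+x_k$, $t=Q_k^{-1/\alpha}\tilde t+t_k$ and $$\tilde v_k(\tilde x,\tilde t)=Q_k^{-1}v(x,t),\qquad \tilde p_k(\tilde x,\tilde t)=Q_k^{-2}p(x,t),$$ for $\tilde t\le0$ and $(x,t)\in\mathcal D\times[0,T_0)$; let $D_k$ be the set of $\tilde x$ with $x\in\mathcal D$. The points are *anchor points* if there are $c'>0$ and a continuous increasing $\lambda:[0,\infty)\to[1,\infty)$ with $|\tilde v_k(\tilde x,\tilde t)|\le\lambda(|\tilde x|^2+|\tilde t|)\,|\tilde v_k(0,0)|$ whenever $|\tilde x|^2+|\tilde t|\le c'k$; they are *near maximal* if $|v(x_k,t_k)|\ge c''\sup_{s\in[0,t_k],\,y}|v(y,s)|$ for a fixed $c''>0$. **Function spaces and limits.** $C^\gamma_{x,t}$ is the Hölder space (with bounded functions) for the distance $|x-y|+\sqrt{|t-s|}$, and $f\in C^{2,1,\gamma}_{x,t}$ means $f,\nabla f,\nabla^2f,\partial_tf\in C^\gamma_{x,t}$. The sequence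 has *locally bounded* $C^{2,1,\gamma}_{x,t}$ norms if, for each compact $K\subset\mathbb R^3\times\mathbb R$, the $C^{2,1,\gamma}_{x,t}$ norms of $\tilde v_k$ on the part of $K$ in its domain are bounded uniformly in $k$. A pair $(w,q)$ on $X\times(-\infty,0]$, with $w$ differentiable in $x$ and in $t$ and $q$ differentiable in $x$, is a *local $C^\gamma_{x,t}$ limit* if along a subsequence $D_k\to X$ in the sense of Kuratowski, and $\tilde v_k,\nabla\tilde v_k,\partial_t\tilde v_k,\nabla\tilde p_k$ converge to $w,\nabla w,\partial_tw,\nabla q$, which are locally $C^\gamma_{x,t}$ on $X\times(-\infty,0]$, in $C^\gamma_{x,t}$ norm on the part of each compact set where both are defined. We call $(w,q)$ a *two-dimensional nontrivial ancient Euler solution* if, with $\zeta=e_r(x_*)$, there is $c\ge0$ such that $X=\mathbb R^3$ and $Y=\mathbb R^2$, or $X=\{x\cdot\zeta\le c\}$ and $Y=\mathbb R^2_+=\{y_1\ge0\}$, and, with $y=(c-x\cdot\zeta,x_3)$, $$w(x,t)=-u_1(y,t)\,\zeta+u_2(y,t)\,e_3,\qquad q(x,t)=P(y,t),$$ where $(u,P)$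 is a classical solution of the two-dimensional Euler equations on $Y\times(-\infty,0]$, not identically zero, with $u_1=0$ on $\{y_1=0\}$ in the half-plane case. **Theorem.** (a) Let $\alpha,\gamma\in(0,1)$ and let $\{\tilde v_k\}$ be a blow-up sequence with locally bounded $C^{2,1,\gamma}_{x,t}$ norms, centred at anchor points off the axis. Then any local $C^\gamma_{x,t}$ limit is a two-dimensional nontrivial ancient Euler solution; if the points are near maximal, the limit is also bounded. (b) Let $\alpha,\gamma\in(0,1)$, suppose $0\in\overline D$, and suppose that $v$ is asymptotically self-similar, $$v(x,t)=\frac1{(T_0-t)^\alpha}V\!\left(\frac{x}{(T_0-t)^{1-\alpha}}\right)+\frac{\varepsilon(t)}{(T_0-t)^\alpha}W(x,t),\quad (x,t)\in D\times[0,T_0),$$ with $V\in C^{2,\gamma}(\mathbb R^3)$, $\varepsilon(t)=o(T_0-t)$ as $t\uparrow T_0$, $W$ bounded, and error $\varepsilon W\in C^{2,1,\gamma}_{x,t}(D\times[0,T_0))$. Suppose also that $|y||\nabla V(y)|$ and $|y|^2|\nabla^2V(y)|$ are $C^\gamma(\mathbb R^3)$ functions (all Hölder spaces consist of bounded functions).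 Then for every $\gamma^-\in(0,\gamma)$, every blow-up sequence at near maximal points off the axis has a local $C^{\gamma^-}_{x,t}$ limit $(w,q)$ (along a subsequence) that is a two-dimensional nontrivial ancient Euler solution, with $w$ bounded, $w$ a function of $t$ only, and $w(t)\to0$ as $t\to-\infty$. -/

import Mathlib

open Set Filter Topology

noncomputable section

namespace AxiEuler

/-- Euclidean space `ℝⁿ`. -/
abbrev E (n : ℕ) := EuclideanSpace ℝ (Fin n)

/-! ### Derivatives in a space-time domain `X × I`

Space-time fields are functions `f x t`; all derivatives are taken within the domain, so that they
are one-sided (up to the boundary) at boundary points. -/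

section Calculus

variable {n : ℕ} {F : Type*} [NormedAddCommGroup F] [NormedSpace ℝ F]

/-- The spatial derivative `∇f(x,t)`. -/
def dx (X : Set (E n)) (f : E n → ℝ → F) : E n → ℝ → (E n →L[ℝ] F) :=
  fun x t => fderivWithin ℝ (fun y => f y t) X x

/-- The time derivative `∂ₜf(x,t)`. -/
def dt (I : Set ℝ) (f : E n → ℝ → F) : E n → ℝ → F :=
  fun x t => derivWithin (fun s => f x s) I t

/-- The spatial gradient of a scalar function. -/
def grad (X : Set (E n)) (p : E n → ℝ → ℝ) : E n → ℝ → E n :=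
  fun x t => gradientWithin (fun y => p y t) X x

/-- The spatial divergence of a vector field. -/
def divergence (X : Set (E n)) (v : E n → ℝ → E n) (x : E n) (t : ℝ) : ℝ :=
  ∑ i : Fin n, (dx X v x t (EuclideanSpace.single i 1)) i

/-- The `C^γ` norm of `f` on `S`, with respect to the parabolic distance `|x - y| + √|t - s|`, is
controlled by `C`: both the supremum and the Hölder seminorm are at most `C`. -/
def ParabolicHolderLE (γ : ℝ) (S : Set (E n × ℝ)) (f : E n → ℝ → F) (C : ℝ) : Prop :=
  (∀ z ∈ S, ‖f z.1 z.2‖ ≤ C) ∧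
  ∀ z ∈ S, ∀ w ∈ S, ‖f z.1 z.2 - f w.1 w.2‖ ≤ C * (‖z.1 - w.1‖ + √|z.2 - w.2|) ^ γ

/-- The `C^{2,1,γ}_{x,t}` norm on `S ⊆ X × I` is controlled by `C`: the fields
`f, ∇f, ∇²f, ∂ₜf` have `C^γ` norm at most `C`. -/
def C21HolderLE (γ : ℝ) (X : Set (E n)) (I : Set ℝ) (S : Set (E n × ℝ)) (f : E n → ℝ → F)
    (C : ℝ) : Prop :=
  ParabolicHolderLE γ S f C ∧ ParabolicHolderLE γ S (dx X f) C ∧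
  ParabolicHolderLE γ S (dx X (dx X f)) C ∧ ParabolicHolderLE γ S (dt I f) C

/-- Membership in `C^{2,1,γ}_{x,t}(X × I)` (finite norm on all of `X × I`). -/
def MemC21Holder (γ : ℝ) (X : Set (E n)) (I : Set ℝ) (f : E n → ℝ → F) : Prop :=
  (∀ t ∈ I, ContDiffOn ℝ 2 (fun x => f x t) X) ∧
  (∀ x ∈ X, DifferentiableOn ℝ (fun t => f x t) I) ∧
  ∃ C, C21HolderLE γ X I (X ×ˢ I) f C

/-- Membership of a function on `ℝⁿ` in the Hölder space `C^γ(ℝⁿ)` (bounded, finite seminorm). -/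
def MemCHolder (γ : ℝ) (f : E n → F) : Prop :=
  ∃ C, (∀ x, ‖f x‖ ≤ C) ∧ ∀ x y, ‖f x - f y‖ ≤ C * ‖x - y‖ ^ γ

/-- Membership of a function on `ℝⁿ` in `C^{2,γ}(ℝⁿ)`. -/
def MemC2Holder (γ : ℝ) (f : E n → F) : Prop :=
  ContDiff ℝ 2 f ∧ MemCHolder γ f ∧ MemCHolder γ (fderiv ℝ f) ∧
  MemCHolder γ (fderiv ℝ (fderiv ℝ f))

/-- `f k`, defined on `S k`, converges to `g`, defined on `T`, in `C^γ_{x,t}` on compact sets: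
`g` is locally `C^γ`, and on every compact `K` the `C^γ` norm of `f k - g` on the part of `K` where
both are defined tends to `0`. -/
def HolderConverges (γ : ℝ) (S : ℕ → Set (E n × ℝ)) (T : Set (E n × ℝ)) (f : ℕ → E n → ℝ → F)
    (g : E n → ℝ → F) : Prop :=
  (∀ K : Set (E n × ℝ), IsCompact K → ∃ C, ParabolicHolderLE γ (K ∩ T) g C) ∧
  ∀ K : Set (E n × ℝ), IsCompact K → ∀ ε > 0, ∀ᶠ k in atTop,
    ParabolicHolderLE γ (K ∩ S k ∩ T) (fun x t => f k x t - g x t) ε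

end Calculus

/-! ### The Euler equations -/

/-- `(v, p)` is a classical solution of the incompressible Euler equations
`∂ₜv + v·∇v + ∇p = 0`, `div v = 0` in `X × I` (with `v, ∇v, ∂ₜv` continuous on `X × I`). -/
structure IsEulerSolution {n : ℕ} (X : Set (E n)) (I : Set ℝ) (v : E n → ℝ → E n)
    (p : E n → ℝ → ℝ) : Prop where
  differentiable_space : ∀ t ∈ I, DifferentiableOn ℝ (fun x => v x t) X
  differentiable_time : ∀ x ∈ X, DifferentiableOn ℝ (fun t => v x t) I
  continuous : ContinuousOn (fun z : E n × ℝ => v z.1 z.2) (X ×ˢ I)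
  continuous_dx : ContinuousOn (fun z : E n × ℝ => dx X v z.1 z.2) (X ×ˢ I)
  continuous_dt : ContinuousOn (fun z : E n × ℝ => dt I v z.1 z.2) (X ×ˢ I)
  differentiable_pressure : ∀ t ∈ I, DifferentiableOn ℝ (fun x => p x t) X
  momentum : ∀ x ∈ X, ∀ t ∈ I, dt I v x t + dx X v x t (v x t) + grad X p x t = 0
  incompressible : ∀ x ∈ X, ∀ t ∈ I, divergence X v x t = 0

/-! ### Cylinders and axially symmetric solutions -/

/-- `r = |x'|`, the distance to the `x₃`-axis. -/
def radius (x : E 3) : ℝ := √(x 0 ^ 2 + x 1 ^ 2)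

/-- The radial unit vector (meaningful off the axis). -/
def eR (x : E 3) : E 3 := !₂[x 0 / radius x, x 1 / radius x, 0]

/-- The angular unit vector (meaningful off the axis). -/
def eTheta (x : E 3) : E 3 := !₂[-(x 1) / radius x, x 0 / radius x, 0]

/-- The vertical unit vector. -/
def e3 : E 3 := !₂[0, 0, 1]

/-- The finite open cylinder `D` around the `x₃`-axis, of radius `R`, between `x₃ = a` and
`x₃ = b`. -/
def cylinder (R a b : ℝ) : Set (E 3) := {x | radius x < R ∧ a < x 2 ∧ x 2 < b}

/-- The side-closed infinite cylinder of radius `R`. Fields on the finite cylinder with the periodic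
condition on top and bottom are regarded as periodic fields on this set. -/
def pipe (R : ℝ) : Set (E 3) := {x | radius x ≤ R}

/-- The basic assumptions: `(v, p)` is a smooth axially symmetric solution of the Euler equations in
the cylinder of radius `R` between `x₃ = a` and `x₃ = b`, for times in `[0, T₀)`, with `v` tangential
on the side and periodic in `x₃`. -/
structure IsASESolution (R a b T₀ : ℝ) (v : E 3 → ℝ → E 3) (p : E 3 → ℝ → ℝ) : Prop where
  smooth : ContDiffOn ℝ (⊤ : ℕ∞) (fun z : E 3 × ℝ => v z.1 z.2) (pipe R ×ˢ Ico 0 T₀)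
  euler : IsEulerSolution (pipe R) (Ico 0 T₀) v p
  axisymmetric : ∃ vr vθ vz : ℝ → ℝ → ℝ → ℝ, ∀ x ∈ pipe R, radius x ≠ 0 → ∀ t ∈ Ico 0 T₀,
    v x t = vr (radius x) (x 2) t • eR x + vθ (radius x) (x 2) t • eTheta x
      + vz (radius x) (x 2) t • e3
  no_penetration : ∀ x, radius x = R → ∀ t ∈ Ico 0 T₀, inner ℝ (v x t) (eR x) = 0
  periodic : ∀ x ∈ pipe R, ∀ t ∈ Ico 0 T₀, v (x + (b - a) • e3) t = v x t

/-! ### Blow-up sequences -/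

/-- `(xₖ, tₖ)` are blow-up points off the axis, converging to `(x⋆, T₀)`, and `Qₖ` is comparable to
`|v(xₖ, tₖ)|`. -/
structure IsBlowUpSequence (R T₀ : ℝ) (v : E 3 → ℝ → E 3) (xs : E 3) (x : ℕ → E 3) (t : ℕ → ℝ)
    (Q : ℕ → ℝ) : Prop where
  mem_space : ∀ k, x k ∈ pipe R
  mem_time : ∀ k, t k ∈ Ico 0 T₀
  tendsto_space : Tendsto x atTop (𝓝 xs)
  tendsto_time : Tendsto t atTop (𝓝 T₀)
  blowUp : Tendsto (fun k => ‖v (x k) (t k)‖) atTop atTop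
  off_axis : ∃ d > 0, ∀ k, d < radius (x k)
  pos : ∀ k, 0 < Q k
  comparable : ∃ c ≥ 1, ∀ k, c⁻¹ * ‖v (x k) (t k)‖ ≤ Q k ∧ Q k ≤ c * ‖v (x k) (t k)‖

/-- The unscaled spatial variable `Q^{-(1-α)/α} x̃ + x₀`. -/
def unscaleX (α Q : ℝ) (x₀ : E 3) (x : E 3) : E 3 := Q ^ (-(1 - α) / α) • x + x₀

/-- The unscaled time variable `Q^{-1/α} t̃ + t₀`. -/
def unscaleT (α Q t₀ t : ℝ) : ℝ := Q ^ (-1 / α) * t + t₀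

/-- The rescaled velocity. -/
def scaledV (α Q : ℝ) (x₀ : E 3) (t₀ : ℝ) (v : E 3 → ℝ → E 3) : E 3 → ℝ → E 3 :=
  fun x t => Q⁻¹ • v (unscaleX α Q x₀ x) (unscaleT α Q t₀ t)

/-- The rescaled pressure. -/
def scaledP (α Q : ℝ) (x₀ : E 3) (t₀ : ℝ) (p : E 3 → ℝ → ℝ) : E 3 → ℝ → ℝ :=
  fun x t => (Q ^ 2)⁻¹ * p (unscaleX α Q x₀ x) (unscaleT α Q t₀ t)

/-- The spatial domain of the rescaled solution. -/
def scaledX (R α Q : ℝ) (x₀ : E 3) : Set (E 3) := {x | unscaleX α Q x₀ x ∈ pipe R}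

/-- The time domain `t̃ ≤ 0` of the rescaled solution. -/
def scaledI (α Q t₀ : ℝ) : Set ℝ := {t | t ≤ 0 ∧ 0 ≤ unscaleT α Q t₀ t}

/-- Anchor points: after rescaling, `|ṽₖ(x̃,t̃)| ≤ λ(|x̃|² + |t̃|) |ṽₖ(0,0)|` for
`|x̃|² + |t̃| ≤ c k`, with one continuous increasing function `λ : [0,∞) → [1,∞)`. -/
def IsAnchor (R α : ℝ) (v : E 3 → ℝ → E 3) (x : ℕ → E 3) (t : ℕ → ℝ) (Q : ℕ → ℝ) : Prop :=
  ∃ lam : ℝ → ℝ, ContinuousOn lam (Ici 0) ∧ MonotoneOn lam (Ici 0) ∧ (∀ s ≥ 0, 1 ≤ lam s) ∧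
    ∃ c > 0, ∀ k : ℕ, ∀ y ∈ scaledX R α (Q k) (x k), ∀ s ∈ scaledI α (Q k) (t k),
      ‖y‖ ^ 2 + |s| ≤ c * k →
        ‖scaledV α (Q k) (x k) (t k) v y s‖
          ≤ lam (‖y‖ ^ 2 + |s|) * ‖scaledV α (Q k) (x k) (t k) v 0 0‖

/-- Near maximal points: `|v(xₖ,tₖ)| ≥ c sup_{s ∈ [0,tₖ], y} |v(y,s)|`. -/
def IsNearMaximal (R : ℝ) (v : E 3 → ℝ → E 3) (x : ℕ → E 3) (t : ℕ → ℝ) : Prop :=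
  ∃ c > 0, ∀ k, ∀ y ∈ pipe R, ∀ s ∈ Icc 0 (t k), c * ‖v y s‖ ≤ ‖v (x k) (t k)‖

/-- The rescaled velocities have locally bounded `C^{2,1,γ}_{x,t}` norms, uniformly in `k`. -/
def LocallyBoundedC21 (R α γ : ℝ) (v : E 3 → ℝ → E 3) (x : ℕ → E 3) (t : ℕ → ℝ)
    (Q : ℕ → ℝ) : Prop :=
  ∀ K : Set (E 3 × ℝ), IsCompact K → ∃ C, ∀ k,
    C21HolderLE γ (scaledX R α (Q k) (x k)) (scaledI α (Q k) (t k))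
      (K ∩ scaledX R α (Q k) (x k) ×ˢ scaledI α (Q k) (t k))
      (scaledV α (Q k) (x k) (t k) v) C

/-- The sets `A k` converge to `B` (in the sense of Kuratowski): `B` is the set of limits of
sequences of points of the `A k`, and also the set of their cluster points. -/
def SetsConverge (A : ℕ → Set (E 3)) (B : Set (E 3)) : Prop :=
  ∀ x, (x ∈ B ↔ ∀ ε > 0, ∀ᶠ k in atTop, (A k ∩ Metric.ball x ε).Nonempty) ∧
    (x ∈ B ↔ ∀ ε > 0, ∃ᶠ k in atTop, (A k ∩ Metric.ball x ε).Nonempty)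

/-- `(w, q)`, defined on `X × (-∞, 0]`, is a local `C^γ_{x,t}` limit of the blow-up sequence: along a
subsequence the rescaled domains converge to `X`, and the rescaled fields `ṽ, ∇ṽ, ∂ₜṽ, ∇p̃` converge
in `C^γ_{x,t}` on compact sets to `w, ∇w, ∂ₜw, ∇q`. -/
def IsLocalLimit (R α γ : ℝ) (v : E 3 → ℝ → E 3) (p : E 3 → ℝ → ℝ) (x : ℕ → E 3) (t : ℕ → ℝ)
    (Q : ℕ → ℝ) (X : Set (E 3)) (w : E 3 → ℝ → E 3) (q : E 3 → ℝ → ℝ) : Prop :=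
  (∀ s ≤ 0, DifferentiableOn ℝ (fun y => w y s) X) ∧
  (∀ y ∈ X, DifferentiableOn ℝ (fun s => w y s) (Iic 0)) ∧
  (∀ s ≤ 0, DifferentiableOn ℝ (fun y => q y s) X) ∧
  ∃ φ : ℕ → ℕ, StrictMono φ ∧
    let Xk := fun k => scaledX R α (Q (φ k)) (x (φ k))
    let Ik := fun k => scaledI α (Q (φ k)) (t (φ k))
    let vk := fun k => scaledV α (Q (φ k)) (x (φ k)) (t (φ k)) v
    let pk := fun k => scaledP α (Q (φ k)) (x (φ k)) (t (φ k)) p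
    let Sk := fun k => Xk k ×ˢ Ik k
    let S := X ×ˢ Iic (0 : ℝ)
    SetsConverge Xk X ∧
    HolderConverges γ Sk S vk w ∧
    HolderConverges γ Sk S (fun k => dx (Xk k) (vk k)) (dx X w) ∧
    HolderConverges γ Sk S (fun k => dt (Ik k) (vk k)) (dt (Iic 0) w) ∧
    HolderConverges γ Sk S (fun k => grad (Xk k) (pk k)) (grad X q)

/-! ### Two-dimensional ancient solutions -/

/-- The closed half plane. -/
def halfPlane : Set (E 2) := {y | 0 ≤ y 0}

/-- The ambient field `(w, q)` on `X × (-∞, 0]` is a nontrivial two-dimensional ancient solution of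
the Euler equations, in the plane or in the half plane, written in the plane spanned by the unit
vectors `ζ` and `e₃`. That is: `X` is either `ℝ³` or a half space `{x·ζ ≤ c}`, the fields depend only
on `y = (c - x·ζ, x₃)` and `t`, the velocity has only components along `-ζ` and `e₃`, and these
components and the pressure, as functions of `(y, t)`, form a nontrivial classical solution on
`ℝ² × (-∞, 0]`, or on `ℝ²₊ × (-∞, 0]` with no penetration through the boundary. -/
def IsPlanarAncientSolution (ζ : E 3) (X : Set (E 3)) (w : E 3 → ℝ → E 3)
    (q : E 3 → ℝ → ℝ) : Prop :=
  ∃ (c : ℝ) (Y : Set (E 2)) (u : E 2 → ℝ → E 2) (P : E 2 → ℝ → ℝ),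
    0 ≤ c ∧
    ((X = univ ∧ Y = univ) ∨
      (X = {x | inner ℝ x ζ ≤ c} ∧ Y = halfPlane ∧
        ∀ y : E 2, y 0 = 0 → ∀ t ≤ 0, u y t 0 = 0)) ∧
    (∀ x ∈ X, ∀ t ≤ 0,
      w x t = (u !₂[c - inner ℝ x ζ, x 2] t 0) • (-ζ) + (u !₂[c - inner ℝ x ζ, x 2] t 1) • e3 ∧
      q x t = P !₂[c - inner ℝ x ζ, x 2] t) ∧
    IsEulerSolution Y (Iic 0) u P ∧
    ∃ y ∈ Y, ∃ t ≤ 0, u y t ≠ 0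

/-- `w` is bounded on `X × (-∞, 0]`. -/
def IsBoundedField (X : Set (E 3)) (w : E 3 → ℝ → E 3) : Prop :=
  ∃ M : ℝ, ∀ x ∈ X, ∀ t ≤ 0, ‖w x t‖ ≤ M

/-! ### Asymptotically self-similar solutions -/

/-- `v` is asymptotically self-similar in `D × [0, T₀)` with profile `V` and error `W`: for some
scalar `ε(t) = o(T₀ - t)` as `t ↑ T₀`,
`v(x,t) = (T₀-t)^{-α} V(x / (T₀-t)^{1-α}) + ε(t) (T₀-t)^{-α} W(x,t)`. Here `W` is bounded, `V` is in
`C^{2,γ}(ℝ³)` and the error `ε W` is in `C^{2,1,γ}_{x,t}(D × [0, T₀))`. -/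
def IsAsymptoticallySelfSimilar (D : Set (E 3)) (T₀ α γ : ℝ) (v : E 3 → ℝ → E 3) (V : E 3 → E 3)
    (W : E 3 → ℝ → E 3) : Prop :=
  MemC2Holder γ V ∧
  (∃ M : ℝ, ∀ x ∈ D, ∀ t ∈ Ico 0 T₀, ‖W x t‖ ≤ M) ∧
  ∃ ε : ℝ → ℝ, ε =o[𝓝[<] T₀] (fun t => T₀ - t) ∧
    MemC21Holder γ D (Ico 0 T₀) (fun x t => ε t • W x t) ∧
    ∀ x ∈ D, ∀ t ∈ Ico 0 T₀,
      v x t = (1 / (T₀ - t) ^ α) • V ((1 / (T₀ - t) ^ (1 - α)) • x)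
        + (ε t / (T₀ - t) ^ α) • W x t

end AxiEuler

end

open AxiEuler

/-!
# Limits of blow-up sequences of axially symmetric Euler flows

**Two-dimensionality.** The angular momentum `r v^θ` of an axially symmetric flow is transported by
the flow, so it stays bounded up to the blow-up time (`IsASESolution.swirl_bounded`). The pressure
is not assumed to be axially symmetric; the maximum principle is therefore applied at a point of the
circle of maxima at which the pressure, too, is maximal along the circle. At points off the axis the
rescaled angular velocity is then of the order `1 / Q k` and vanishes in the limit, and by axial
symmetry the angular derivative of the rescaled velocity is of the order of the length scale and
vanishes as well (`IsFieldLimit.inner_rotGen_eq_zero`, `IsFieldLimit.dx_rotGen_eq_zero`). The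
rescaled cylinders converge to the whole space or to a half-space, according to whether the rescaled
distance from the centre to the side tends to infinity (`IsLimitDomain.setsConverge`). Because the
Euler equations are invariant under the rescaling, the limit is an Euler flow in the plane spanned
by the radial and the vertical direction (`isPlanarAncientSolution_of_invariant`). The boundary
condition passes to the limit although the rescaled sides need not lie in the limit domain, by
uniform Hölder bounds (`IsFieldLimit.no_penetration`); nontriviality comes from the centre, where
the rescaled velocities are bounded below. These facts are collected in `IsFieldLimit.isPlanar`.

**Self-similar blow-up.** At near maximal points `Q k` is at least of the order of
`(T₀ - t k)^(-α)`, for the profile is nonzero at a point seen by the cylinder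
(`SelfSimilarWithError.exists_timeScale_le`). So the time scale of the blow-up sequence is at most
comparable to the time to blow-up. Off the axis the self-similar variable tends to infinity, where
the profile, its gradient and the profile of the time derivative vary slowly: their gradients decay
like the inverse distance. Hence the rescaled velocities and their time derivatives become constant
in space, at a rate given by the length scale, with uniform Hölder bounds in time
(`SelfSimilarWithError.exists_uniformEstimates`). The estimates are derived in the open finite
cylinder, where the self-similar form holds, and carried over to the periodic pipe by gluing across
the horizontal faces (`norm_sub_le_on_pipe`). The Arzelà–Ascoli theorem, applied to the time
derivatives at the centre only, gives a limit `W` that depends on time alone (`exists_timeLimit`),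
with pressure `-⟪W', x⟫`. Interpolation between uniform convergence and bounds in `C^γ` yields
convergence in `C^γ'` for `γ' < γ` (`BoundedHolder.tendsToZero`), and the convergence of the
pressure gradients follows from the momentum equation. The rate `|v| ≤ C (T₀ - t)^(-α)` turns into the
decay `|W s| ≤ C |s|^(-α)`.
-/

noncomputable section

namespace AxiEuler

/-! ### Geometry of the cylinder -/

/-- Horizontal projection; `radius` is its norm. -/
def horiz : E 3 →L[ℝ] E 2 :=
  LinearMap.toContinuousLinearMap
    { toFun := fun x => !₂[x 0, x 1]
      map_add' := fun x y => by ext i; fin_cases i <;> simp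
      map_smul' := fun c x => by ext i; fin_cases i <;> simp }

/-- The generator `x ↦ (-x₁, x₀, 0)` of the rotations around the axis. -/
def rotGen : E 3 →L[ℝ] E 3 :=
  LinearMap.toContinuousLinearMap
    { toFun := fun x => !₂[-(x 1), x 0, 0]
      map_add' := fun x y => by ext i; fin_cases i <;> simp [add_comm]
      map_smul' := fun c x => by ext i; fin_cases i <;> simp }

@[simp] lemma rotGen_zero (x : E 3) : rotGen x 0 = -(x 1) := rfl
@[simp] lemma rotGen_one (x : E 3) : rotGen x 1 = x 0 := rfl
@[simp] lemma rotGen_two (x : E 3) : rotGen x 2 = 0 := rfl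
@[simp] lemma e3_zero : e3 0 = 0 := rfl
@[simp] lemma e3_one : e3 1 = 0 := rfl
@[simp] lemma e3_two : e3 2 = 1 := rfl
@[simp] lemma eR_zero (x : E 3) : eR x 0 = x 0 / radius x := rfl
@[simp] lemma eR_one (x : E 3) : eR x 1 = x 1 / radius x := rfl
@[simp] lemma eR_two (x : E 3) : eR x 2 = 0 := rfl
@[simp] lemma eTheta_zero (x : E 3) : eTheta x 0 = -(x 1) / radius x := rfl
@[simp] lemma eTheta_one (x : E 3) : eTheta x 1 = x 0 / radius x := rfl
@[simp] lemma eTheta_two (x : E 3) : eTheta x 2 = 0 := rfl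
@[simp] lemma horiz_zero (x : E 3) : horiz x 0 = x 0 := rfl
@[simp] lemma horiz_one (x : E 3) : horiz x 1 = x 1 := rfl

/-- The coordinate functionals. -/
def coordL {n : ℕ} (i : Fin n) : E n →L[ℝ] ℝ := EuclideanSpace.proj i

@[simp] lemma coordL_apply {n : ℕ} (i : Fin n) (x : E n) : coordL i x = x i := rfl

lemma E3_ext {x y : E 3} (h0 : x 0 = y 0) (h1 : x 1 = y 1) (h2 : x 2 = y 2) : x = y := by
  ext i; fin_cases i <;> assumption

lemma inner_E3 (x y : E 3) : inner ℝ x y = x 0 * y 0 + x 1 * y 1 + x 2 * y 2 := by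
  simp [PiLp.inner_apply, Fin.sum_univ_three, mul_comm]

lemma inner_E2 (x y : E 2) : inner ℝ x y = x 0 * y 0 + x 1 * y 1 := by
  simp [PiLp.inner_apply, Fin.sum_univ_two, mul_comm]

lemma radius_eq_norm (x : E 3) : radius x = ‖horiz x‖ := by
  simp [radius, EuclideanSpace.norm_eq, Fin.sum_univ_two]

lemma radius_nonneg (x : E 3) : 0 ≤ radius x := Real.sqrt_nonneg _

lemma radius_sq (x : E 3) : radius x ^ 2 = x 0 ^ 2 + x 1 ^ 2 := Real.sq_sqrt (by positivity)

lemma continuous_radius : Continuous radius := by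
  have : radius = fun x => ‖horiz x‖ := funext radius_eq_norm
  rw [this]; fun_prop

lemma norm_sq_E3 (x : E 3) : ‖x‖ ^ 2 = x 0 ^ 2 + x 1 ^ 2 + x 2 ^ 2 := by
  rw [← real_inner_self_eq_norm_sq, inner_E3]; ring

lemma radius_le_norm (x : E 3) : radius x ≤ ‖x‖ := by
  refine abs_le_of_sq_le_sq' ?_ (norm_nonneg _) |>.2
  rw [radius_sq, norm_sq_E3]; nlinarith [sq_nonneg (x 2)]

lemma radius_add_le (x y : E 3) : radius (x + y) ≤ radius x + radius y := by
  simp only [radius_eq_norm, map_add]; exact norm_add_le _ _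

lemma radius_smul (c : ℝ) (x : E 3) : radius (c • x) = |c| * radius x := by
  simp only [radius_eq_norm, map_smul, norm_smul, Real.norm_eq_abs]

lemma abs_radius_sub_le (x y : E 3) : |radius x - radius y| ≤ ‖x - y‖ := by
  refine le_trans ?_ (radius_le_norm _)
  simp only [radius_eq_norm, map_sub]; exact abs_norm_sub_norm_le _ _

lemma pipe_eq_preimage (R : ℝ) : pipe R = horiz ⁻¹' Metric.closedBall 0 R := by
  ext x; simp [pipe, radius_eq_norm]

lemma convex_pipe (R : ℝ) : Convex ℝ (pipe R) := by
  rw [pipe_eq_preimage]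
  exact (convex_closedBall (0 : E 2) R).linear_preimage horiz.toLinearMap

lemma isClosed_pipe (R : ℝ) : IsClosed (pipe R) :=
  isClosed_le continuous_radius continuous_const

lemma mem_interior_pipe {R : ℝ} {x : E 3} (h : radius x < R) : x ∈ interior (pipe R) :=
  mem_interior.2 ⟨{y | radius y < R}, fun y (hy : radius y < R) => hy.le,
    isOpen_lt continuous_radius continuous_const, h⟩

lemma radius_zero : radius 0 = 0 := by simp [radius]

lemma uniqueDiffOn_pipe {R : ℝ} (hR : 0 < R) : UniqueDiffOn ℝ (pipe R) :=
  uniqueDiffOn_convex (convex_pipe R) ⟨0, mem_interior_pipe (by rwa [radius_zero])⟩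

lemma radius_add_smul_e3 (x : E 3) (s : ℝ) : radius (x + s • e3) = radius x := by
  simp [radius]

/-- Rotation by the angle `φ` around the axis. -/
def rot (φ : ℝ) (x : E 3) : E 3 :=
  Real.cos φ • (x - x 2 • e3) + Real.sin φ • rotGen x + x 2 • e3

lemma rot_zero_coord (φ : ℝ) (x : E 3) :
    rot φ x 0 = Real.cos φ * x 0 - Real.sin φ * x 1 := by simp [rot]; ring
lemma rot_one_coord (φ : ℝ) (x : E 3) :
    rot φ x 1 = Real.cos φ * x 1 + Real.sin φ * x 0 := by simp [rot]
lemma rot_two_coord (φ : ℝ) (x : E 3) : rot φ x 2 = x 2 := by simp [rot]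

lemma rot_angle_zero (x : E 3) : rot 0 x = x := by
  simp [rot]

lemma radius_rot (φ : ℝ) (x : E 3) : radius (rot φ x) = radius x := by
  unfold radius
  congr 1
  rw [rot_zero_coord, rot_one_coord]
  linear_combination (x 0 ^ 2 + x 1 ^ 2) * Real.sin_sq_add_cos_sq φ

lemma hasDerivAt_rot (x : E 3) : HasDerivAt (fun φ => rot φ x) (rotGen x) 0 := by
  have h1 := (Real.hasDerivAt_cos 0).smul_const (x - x 2 • e3)
  have h2 := (Real.hasDerivAt_sin 0).smul_const (rotGen x)
  have h3 := (h1.add h2).add_const (x 2 • e3)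
  simpa [rot, Pi.add_def] using h3

/-! ### Consequences of axial symmetry -/

variable {R a b T₀ : ℝ} {v : E 3 → ℝ → E 3} {p : E 3 → ℝ → ℝ}

/-- Axial symmetry as equivariance under rotations. -/
lemma IsASESolution.map_rot (hv : IsASESolution R a b T₀ v p) {x : E 3} (hx : x ∈ pipe R)
    (hr : radius x ≠ 0) {t : ℝ} (ht : t ∈ Ico 0 T₀) (φ : ℝ) :
    v (rot φ x) t = rot φ (v x t) := by
  obtain ⟨vr, vθ, vz, h⟩ := hv.axisymmetric
  have hx' : rot φ x ∈ pipe R := by simpa [pipe, radius_rot] using hx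
  rw [h x hx hr t ht, h _ hx' (by rwa [radius_rot]) t ht, radius_rot, rot_two_coord]
  apply E3_ext
  · rw [rot_zero_coord]; simp [radius_rot, rot_zero_coord, rot_one_coord]; ring
  · rw [rot_one_coord]; simp [radius_rot, rot_zero_coord, rot_one_coord]; ring
  · rw [rot_two_coord]; simp

lemma IsASESolution.hasFDerivWithinAt (hv : IsASESolution R a b T₀ v p) {x : E 3}
    (hx : x ∈ pipe R) {t : ℝ} (ht : t ∈ Ico 0 T₀) :
    HasFDerivWithinAt (fun y => v y t) (dx (pipe R) v x t) (pipe R) x :=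
  (hv.euler.differentiable_space t ht x hx).hasFDerivWithinAt

/-- Rotating the base point rotates an axially symmetric field. -/
lemma IsASESolution.dx_rotGen (hv : IsASESolution R a b T₀ v p) {x : E 3} (hx : x ∈ pipe R)
    (hr : radius x ≠ 0) {t : ℝ} (ht : t ∈ Ico 0 T₀) :
    dx (pipe R) v x t (rotGen x) = rotGen (v x t) := by
  have h1 : HasDerivAt (fun φ => v (rot φ x) t) (dx (pipe R) v x t (rotGen x)) 0 := by
    refine HasFDerivWithinAt.comp_hasDerivAt_of_eq (t := pipe R) (0 : ℝ)
      (hv.hasFDerivWithinAt hx ht) (hasDerivAt_rot x) ?_ (rot_angle_zero x).symm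
    exact Eventually.of_forall fun φ => by simpa [pipe, radius_rot] using hx
  have h2 : HasDerivAt (fun φ => v (rot φ x) t) (rotGen (v x t)) 0 := by
    simpa only [hv.map_rot hx hr ht] using hasDerivAt_rot (v x t)
  exact h1.unique h2

/-- `r v^θ`, the angular momentum density of the flow. -/
def swirl (v : E 3 → ℝ → E 3) (x : E 3) (t : ℝ) : ℝ := x 0 * v x t 1 - x 1 * v x t 0

lemma inner_rotGen (v : E 3 → ℝ → E 3) (x : E 3) (t : ℝ) :
    inner ℝ (v x t) (rotGen x) = swirl v x t := by
  rw [inner_E3]; simp [swirl]; ring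

lemma IsASESolution.swirl_eq_of_radius_eq (hv : IsASESolution R a b T₀ v p) {x z : E 3}
    (hx : x ∈ pipe R) (hr : radius z = radius x) (h2 : z 2 = x 2) {t : ℝ} (ht : t ∈ Ico 0 T₀) :
    swirl v z t = swirl v x t := by
  obtain ⟨vr, vθ, vz, h⟩ := hv.axisymmetric
  have key : ∀ y ∈ pipe R, swirl v y t = radius y * (if radius y = 0 then 0 else
      vθ (radius y) (y 2) t) := by
    intro y hy
    by_cases hy0 : radius y = 0
    · have := radius_sq y
      rw [hy0] at this
      have h0 : y 0 = 0 := by nlinarith [sq_nonneg (y 0), sq_nonneg (y 1)]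
      have h1 : y 1 = 0 := by nlinarith [sq_nonneg (y 0), sq_nonneg (y 1)]
      simp [swirl, h0, h1, hy0]
    · rw [if_neg hy0]
      unfold swirl
      rw [h y hy hy0 t ht]
      simp
      field_simp
      rw [radius_sq]; ring
  rw [key x hx, key z (by simpa [pipe, hr] using hx), hr, h2]

lemma IsASESolution.periodic_int (hv : IsASESolution R a b T₀ v p) {x : E 3} (hx : x ∈ pipe R)
    {t : ℝ} (ht : t ∈ Ico 0 T₀) (n : ℤ) : v (x + ((n : ℝ) * (b - a)) • e3) t = v x t := by
  have hpipe : ∀ s : ℝ, x + s • e3 ∈ pipe R := fun s => by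
    simpa [pipe, radius_add_smul_e3] using hx
  have step : ∀ m : ℤ, v (x + (((m + 1 : ℤ) : ℝ) * (b - a)) • e3) t
      = v (x + ((m : ℝ) * (b - a)) • e3) t := by
    intro m
    rw [← hv.periodic _ (hpipe ((m : ℝ) * (b - a))) t ht, add_assoc, ← add_smul]
    push_cast
    congr 3; ring
  induction n using Int.induction_on with
  | zero => simp
  | succ i ih => rw [step, ih]
  | pred i ih => rw [← ih, ← step]; simp

lemma exists_shift (hab : a < b) (x : E 3) :
    ∃ n : ℤ, x 2 + (n : ℝ) * (b - a) ∈ Ico a b := by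
  obtain ⟨n, hn, -⟩ := existsUnique_add_zsmul_mem_Ico (sub_pos.2 hab) (x 2) a
  refine ⟨n, ?_⟩
  simpa using hn

lemma swirl_add_e3 (hv : IsASESolution R a b T₀ v p) {x : E 3} (hx : x ∈ pipe R)
    {t : ℝ} (ht : t ∈ Ico 0 T₀) (n : ℤ) :
    swirl v (x + ((n : ℝ) * (b - a)) • e3) t = swirl v x t := by
  unfold swirl; rw [hv.periodic_int hx ht]; simp

lemma isCompact_cell (R a b : ℝ) : IsCompact {x : E 3 | x ∈ pipe R ∧ a ≤ x 2 ∧ x 2 ≤ b} := by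
  refine Metric.isCompact_of_isClosed_isBounded ?_ ?_
  · have h : Continuous fun x : E 3 => x 2 := by fun_prop
    exact (isClosed_pipe R).inter ((isClosed_le continuous_const h).inter
      (isClosed_le h continuous_const))
  · refine (Metric.isBounded_closedBall (x := (0 : E 3)) (r := R + (|a| + |b|))).subset ?_
    rintro x ⟨hx, h1, h2⟩
    have hx : radius x ≤ R := hx
    simp only [mem_closedBall_zero_iff]
    have hr := radius_nonneg x
    have h3 : |x 2| ≤ |a| + |b| :=
      abs_le.2 ⟨by linarith [neg_abs_le a, abs_nonneg b], by linarith [le_abs_self b, abs_nonneg a]⟩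
    have hR : 0 ≤ R := hr.trans hx
    refine abs_le_of_sq_le_sq' ?_ (by positivity) |>.2
    rw [norm_sq_E3, ← radius_sq, ← sq_abs (x 2)]
    nlinarith [abs_nonneg (x 2), abs_nonneg a, abs_nonneg b]

lemma IsASESolution.continuousOn_swirl (hv : IsASESolution R a b T₀ v p) :
    ContinuousOn (fun z : E 3 × ℝ => swirl v z.1 z.2) (pipe R ×ˢ Ico 0 T₀) := by
  have h := hv.euler.continuous
  have hc : ∀ i : Fin 3, ContinuousOn (fun z : E 3 × ℝ => v z.1 z.2 i) (pipe R ×ˢ Ico 0 T₀) :=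
    fun i => (coordL i).continuous.comp_continuousOn h
  unfold swirl
  refine ContinuousOn.sub (ContinuousOn.mul ?_ (hc 1)) (ContinuousOn.mul ?_ (hc 0)) <;> fun_prop

lemma deriv_nonneg_of_left_max {f : ℝ → ℝ} {D t : ℝ} (h : HasDerivAt f D t)
    (hm : ∀ᶠ s in 𝓝[<] t, f s ≤ f t) : 0 ≤ D := by
  have h1 := (hasDerivAt_iff_tendsto_slope_left_right.1 h).1
  refine ge_of_tendsto h1 ?_
  filter_upwards [hm, self_mem_nhdsWithin] with s hs hst
  rw [slope_def_field]
  exact div_nonneg_of_nonpos (by linarith) (by have : s < t := hst; linarith)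

/-- The derivative of a field on `X` vanishes along a curve at whose start the field, restricted to
the curve, is maximal. -/
lemma fderiv_eq_zero_of_curve_max {X : Set (E 3)} {g : E 3 → ℝ} {g' : E 3 →L[ℝ] ℝ} {z d : E 3}
    (hg : HasFDerivWithinAt g g' X z) {c : ℝ → E 3} (hc : HasDerivAt c d 0) (hc0 : c 0 = z)
    (hcX : ∀ s, c s ∈ X) (hmax : ∀ s, g (c s) ≤ g z) : g' d = 0 := by
  have h1 : HasDerivAt (fun s => g (c s)) (g' d) 0 :=
    HasFDerivWithinAt.comp_hasDerivAt_of_eq (t := X) (0 : ℝ) hg hc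
      (Eventually.of_forall hcX) hc0.symm
  refine IsLocalMax.hasDerivAt_eq_zero (Eventually.of_forall fun s => ?_) h1
  simpa [hc0] using hmax s

lemma hasFDerivWithinAt_swirl (hv : IsASESolution R a b T₀ v p) {x : E 3} (hx : x ∈ pipe R)
    {t : ℝ} (ht : t ∈ Ico 0 T₀) :
    ∃ G : E 3 →L[ℝ] ℝ, HasFDerivWithinAt (fun y => swirl v y t) G (pipe R) x ∧
      ∀ h, G h = h 0 * v x t 1 + x 0 * dx (pipe R) v x t h 1
        - (h 1 * v x t 0 + x 1 * dx (pipe R) v x t h 0) := by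
  have hd := hv.hasFDerivWithinAt hx ht
  have hc : ∀ i : Fin 3, HasFDerivWithinAt (fun y => v y t i)
      ((coordL i).comp (dx (pipe R) v x t)) (pipe R) x :=
    fun i => (coordL i).hasFDerivAt.comp_hasFDerivWithinAt x hd
  have hp : ∀ i : Fin 3, HasFDerivWithinAt (fun y : E 3 => y i)
      (coordL i) (pipe R) x :=
    fun i => (coordL i).hasFDerivWithinAt
  refine ⟨_, ((hp 0).mul (hc 1)).sub ((hp 1).mul (hc 0)), fun h => ?_⟩
  simp
  ring

lemma IsEulerSolution.hasDerivAt_time {n : ℕ} {X : Set (E n)} {u : E n → ℝ → E n}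
    {P : E n → ℝ → ℝ} {T : ℝ} (h : IsEulerSolution X (Ico 0 T) u P) {x : E n} (hx : x ∈ X) {t : ℝ}
    (h0 : 0 < t) (hT : t < T) : HasDerivAt (fun s => u x s) (dt (Ico 0 T) u x t) t :=
  ((h.differentiable_time x hx t ⟨h0.le, hT⟩).hasDerivWithinAt).hasDerivAt
    (Ico_mem_nhds h0 hT)

/-- The transport equation for the swirl, at a spatial maximum of the swirl: the transport term
vanishes because the velocity is tangential on the side. -/
lemma IsASESolution.deriv_swirl_eq_zero (hR : 0 < R) (hv : IsASESolution R a b T₀ v p) {z : E 3}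
    (hz : z ∈ pipe R) {t : ℝ} (h0 : 0 < t) (hT : t < T₀) (σ : ℝ) (hσ : σ ≠ 0)
    (hmax : ∀ y ∈ pipe R, σ * swirl v y t ≤ σ * swirl v z t)
    (hp : ∀ φ, p (rot φ z) t ≤ p z t) :
    HasDerivAt (fun s => swirl v z s) 0 t := by
  have ht : t ∈ Ico 0 T₀ := ⟨h0.le, hT⟩
  obtain ⟨G, hG, hGf⟩ := hasFDerivWithinAt_swirl hv hz ht
  have hG' := hG.const_mul σ
  have hrotmem : ∀ φ, rot φ z ∈ pipe R := fun φ => by simpa [pipe, radius_rot] using hz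
  -- the angular derivative of the pressure vanishes at `z`
  have hgp : inner ℝ (grad (pipe R) p z t) (rotGen z) = 0 := by
    have h1 := (hv.euler.differentiable_pressure t ht z hz).hasFDerivWithinAt
    have h2 := fderiv_eq_zero_of_curve_max h1 (hasDerivAt_rot z) (rot_angle_zero z) hrotmem
      (fun s => hp s)
    rwa [← inner_gradientWithin_left] at h2
  -- the transport term vanishes at `z`
  have hGv : G (v z t) = 0 := by
    have hz' : radius z ≤ R := hz
    rcases hz'.lt_or_eq with hlt | heq
    · have hn : pipe R ∈ 𝓝 z := mem_interior_iff_mem_nhds.1 (mem_interior_pipe hlt)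
      have h1 : IsLocalMax (fun y => σ * swirl v y t) z := by
        filter_upwards [hn] with y hy using hmax y hy
      have h2 := h1.hasFDerivAt_eq_zero (hG'.hasFDerivAt hn)
      have h3 := congrArg (fun L : E 3 →L[ℝ] ℝ => L (v z t)) h2
      simpa [hσ] using h3
    · have h1 : G (rotGen z) = 0 := by
        have := fderiv_eq_zero_of_curve_max hG' (hasDerivAt_rot z) (rot_angle_zero z) hrotmem
          (fun s => hmax _ (hrotmem s))
        simpa [hσ] using this
      have h2 : G e3 = 0 := by
        have hc : HasDerivAt (fun s : ℝ => z + s • e3) e3 0 := by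
          simpa using ((hasDerivAt_id (0 : ℝ)).smul_const e3).const_add z
        have hm : ∀ s : ℝ, z + s • e3 ∈ pipe R := fun s => by
          simpa [pipe, radius_add_smul_e3] using hz
        have := fderiv_eq_zero_of_curve_max hG' hc (by simp) hm (fun s => hmax _ (hm s))
        simpa [hσ] using this
      have hpen := hv.no_penetration z heq t ht
      have hrsq := radius_sq z
      rw [heq] at hrsq
      have hpen' : v z t 0 * z 0 + v z t 1 * z 1 = 0 := by
        rw [inner_E3] at hpen
        simp [heq] at hpen
        field_simp at hpen
        linarith
      -- on the side the velocity is tangential, and the swirl is stationary in the two tangential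
      -- directions
      have hdec : v z t = (swirl v z t / R ^ 2) • rotGen z + (v z t 2) • e3 := by
        have hR2 : R ^ 2 ≠ 0 := by positivity
        apply E3_ext
        · simp [swirl]; field_simp; rw [hrsq]; linear_combination z 0 * hpen'
        · simp [swirl]; field_simp; rw [hrsq]; linear_combination z 1 * hpen'
        · simp
      rw [hdec, map_add, map_smul, map_smul, h1, h2]; simp
  -- what remains of the momentum equation in the angular direction
  have hmom := hv.euler.momentum z hz t ht
  have hm0 := congrArg (fun u : E 3 => u 0) hmom
  have hm1 := congrArg (fun u : E 3 => u 1) hmom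
  simp only [PiLp.add_apply, PiLp.zero_apply] at hm0 hm1
  have hd := hv.euler.hasDerivAt_time hz h0 hT
  have hc : ∀ i : Fin 3, HasDerivAt (fun s => v z s i) (dt (Ico 0 T₀) v z t i) t :=
    fun i => (coordL i).hasFDerivAt.comp_hasDerivAt t hd
  have h3 := ((hc 1).const_mul (z 0)).sub ((hc 0).const_mul (z 1))
  have h4 : z 0 * dt (Ico 0 T₀) v z t 1 - z 1 * dt (Ico 0 T₀) v z t 0 = 0 := by
    rw [inner_E3] at hgp
    simp only [rotGen_zero, rotGen_one, rotGen_two] at hgp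
    rw [hGf] at hGv
    linear_combination z 0 * hm1 - z 1 * hm0 - hGv - hgp
  rw [h4] at h3
  exact h3

/-- Maximum principle for multiples of `r v^θ`, obtained from a space-time maximum of the swirl
minus `ε t`. Since `p` is not assumed to be axially symmetric, its angular derivative is removed by
the choice of the point on the circle of maxima. -/
lemma IsASESolution.swirl_le (hR : 0 < R) (hab : a < b) (hv : IsASESolution R a b T₀ v p)
    (σ : ℝ) (hσ : σ ≠ 0) (C : ℝ) (h0 : ∀ x ∈ pipe R, σ * swirl v x 0 ≤ C) {x : E 3}
    (hx : x ∈ pipe R) {t : ℝ} (ht : t ∈ Ico 0 T₀) : σ * swirl v x t ≤ C := by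
  by_contra! hcon
  have htpos : 0 < t := by
    rcases ht.1.lt_or_eq with h | h
    · exact h
    · subst h; exact absurd (h0 x hx) (not_le.2 hcon)
  -- small enough for the maximum of `σ * swirl - ε t` to exceed `C`
  set ε : ℝ := (σ * swirl v x t - C) / (2 * t) with hε
  have hεpos : 0 < ε := div_pos (by linarith) (by linarith)
  have hεt : ε * t = (σ * swirl v x t - C) / 2 := by rw [hε]; field_simp
  set K : Set (E 3) := {x : E 3 | x ∈ pipe R ∧ a ≤ x 2 ∧ x 2 ≤ b} with hK
  have hcont : ContinuousOn (fun z : E 3 × ℝ => σ * swirl v z.1 z.2 - ε * z.2)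
      (K ×ˢ Icc 0 t) := by
    refine ContinuousOn.sub (ContinuousOn.mul continuousOn_const
      (hv.continuousOn_swirl.mono ?_)) (by fun_prop)
    rintro ⟨y, s⟩ ⟨hy, hs⟩
    exact ⟨hy.1, hs.1, hs.2.trans_lt ht.2⟩
  have hshift : ∀ y ∈ pipe R, ∃ n : ℤ, y + ((n : ℝ) * (b - a)) • e3 ∈ K := by
    intro y hy
    obtain ⟨n, hn⟩ := exists_shift hab y
    refine ⟨n, by simpa [pipe, radius_add_smul_e3] using hy, ?_, ?_⟩
    · simpa using hn.1
    · simpa using hn.2.le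
  obtain ⟨n, hn⟩ := hshift x hx
  obtain ⟨⟨x', t'⟩, ⟨hx', ht'⟩, hmax⟩ := ((isCompact_cell R a b).prod isCompact_Icc).exists_isMaxOn
    ⟨(_, t), hn, ⟨htpos.le, le_rfl⟩⟩ hcont
  have hmax' : ∀ y ∈ pipe R, ∀ s ∈ Icc 0 t,
      σ * swirl v y s - ε * s ≤ σ * swirl v x' t' - ε * t' := by
    intro y hy s hs
    obtain ⟨m, hm⟩ := hshift y hy
    have := isMaxOn_iff.1 hmax _ (show (_, s) ∈ K ×ˢ Icc 0 t from ⟨hm, hs⟩)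
    simp only at this
    rwa [swirl_add_e3 hv hy ⟨hs.1, hs.2.trans_lt ht.2⟩] at this
  have ht'T : t' < T₀ := ht'.2.trans_lt ht.2
  have hbig : C < σ * swirl v x' t' - ε * t' := by
    have := hmax' x hx t ⟨htpos.le, le_rfl⟩
    linarith
  have ht'0 : 0 < t' := by
    rcases ht'.1.lt_or_eq with h | h
    · exact h
    · have h : 0 = t' := h
      rw [← h] at hbig; have := h0 x' hx'.1; simp at hbig; linarith
  have ht'I : t' ∈ Ico 0 T₀ := ⟨ht'0.le, ht'T⟩
  -- on the circle through `x'`, take a point where the pressure is maximal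
  set S : Set (E 3) := {y | radius y = radius x' ∧ y 2 = x' 2} with hS
  have hSK : S ⊆ K := by
    rintro y ⟨h1, h2⟩
    refine ⟨?_, ?_, ?_⟩
    · have := hx'.1; simpa [pipe, h1] using this
    · rw [h2]; exact hx'.2.1
    · rw [h2]; exact hx'.2.2
  have hScl : IsClosed S :=
    (isClosed_eq continuous_radius continuous_const).inter
      (isClosed_eq (by fun_prop) continuous_const)
  have hScomp : IsCompact S := (isCompact_cell R a b).of_isClosed_subset hScl hSK
  obtain ⟨z, hzS, hzmax⟩ := hScomp.exists_isMaxOn ⟨x', rfl, rfl⟩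
    (((hv.euler.differentiable_pressure t' ht'I).continuousOn).mono fun y hy => (hSK hy).1)
  have hzp : z ∈ pipe R := (hSK hzS).1
  have hsw : ∀ s ∈ Ico 0 T₀, swirl v z s = swirl v x' s := fun s hs =>
    hv.swirl_eq_of_radius_eq hx'.1 hzS.1 hzS.2 hs
  have hd := hv.deriv_swirl_eq_zero hR hzp ht'0 ht'T σ hσ
    (fun y hy => by have := hmax' y hy t' ht'; rw [hsw t' ht'I]; linarith)
    (fun φ => hzmax ⟨by rw [radius_rot]; exact hzS.1, by rw [rot_two_coord]; exact hzS.2⟩)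
  have hd2 := (hd.const_mul σ).sub ((hasDerivAt_id t').const_mul ε)
  -- at the maximum the time derivative would have to be nonnegative, but it equals `-ε`
  have hge := deriv_nonneg_of_left_max hd2 (by
    filter_upwards [Ioo_mem_nhdsLT ht'0] with s hs
    have h1 := hmax' z hzp s ⟨hs.1.le, hs.2.le.trans ht'.2⟩
    have h2 := hsw t' ht'I
    simp only [Pi.sub_apply, id]
    rw [h2]; exact h1)
  simp at hge
  linarith

/-- The swirl is bounded up to the blow-up time, in contrast to the velocity. -/
theorem IsASESolution.swirl_bounded (hR : 0 < R) (hab : a < b) (hT : 0 < T₀)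
    (hv : IsASESolution R a b T₀ v p) :
    ∃ C, ∀ x ∈ pipe R, ∀ t ∈ Ico 0 T₀, |swirl v x t| ≤ C := by
  have hcont : ContinuousOn (fun x => swirl v x 0) {x : E 3 | x ∈ pipe R ∧ a ≤ x 2 ∧ x 2 ≤ b} := by
    have : ContinuousOn (fun x : E 3 => (x, (0 : ℝ)))
        {x : E 3 | x ∈ pipe R ∧ a ≤ x 2 ∧ x 2 ≤ b} := by
      fun_prop
    exact hv.continuousOn_swirl.comp this fun x hx => ⟨hx.1, le_rfl, hT⟩
  obtain ⟨C, hC⟩ := (isCompact_cell R a b).exists_bound_of_continuousOn hcont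
  have h0 : ∀ x ∈ pipe R, |swirl v x 0| ≤ C := by
    intro x hx
    obtain ⟨n, hn⟩ := exists_shift hab x
    have := hC (x + ((n : ℝ) * (b - a)) • e3) ⟨by simpa [pipe, radius_add_smul_e3] using hx,
      by simpa using hn.1, by simpa using hn.2.le⟩
    rwa [swirl_add_e3 hv hx ⟨le_rfl, hT⟩] at this
  refine ⟨C, fun x hx t ht => abs_le'.2 ⟨?_, ?_⟩⟩
  · simpa using hv.swirl_le hR hab 1 one_ne_zero C
      (fun y hy => by simpa using (le_abs_self _).trans (h0 y hy)) hx ht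
  · simpa using hv.swirl_le hR hab (-1) (by norm_num) C
      (fun y hy => by simpa using (neg_le_abs _).trans (h0 y hy)) hx ht

/-! ### The rescaled fields -/

/-- The length scale `Q^{-(1-α)/α}`. -/
def lenScale (α Q : ℝ) : ℝ := Q ^ (-(1 - α) / α)

/-- The time scale `Q^{-1/α}`. -/
def timeScale (α Q : ℝ) : ℝ := Q ^ (-1 / α)

lemma unscaleX_eq (α Q : ℝ) (x₀ y : E 3) : unscaleX α Q x₀ y = lenScale α Q • y + x₀ := rfl
lemma unscaleT_eq (α Q t₀ s : ℝ) : unscaleT α Q t₀ s = timeScale α Q * s + t₀ := rfl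

section Scaling

variable {R a b T₀ α Q t₀ : ℝ} {x₀ : E 3} {v : E 3 → ℝ → E 3} {p : E 3 → ℝ → ℝ}

lemma lenScale_pos (hQ : 0 < Q) : 0 < lenScale α Q := Real.rpow_pos_of_pos hQ _
lemma timeScale_pos (hQ : 0 < Q) : 0 < timeScale α Q := Real.rpow_pos_of_pos hQ _

lemma lenScale_eq (hα : α ≠ 0) (hQ : 0 < Q) : lenScale α Q = Q * timeScale α Q := by
  unfold lenScale timeScale
  have : -(1 - α) / α = 1 + -1 / α := by field_simp; ring
  rw [this, Real.rpow_add hQ, Real.rpow_one]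

lemma convex_scaledX : Convex ℝ (scaledX R α Q x₀) := by
  intro y hy z hz c d hc hd hcd
  have h := convex_pipe R hy hz hc hd hcd
  have h2 : unscaleX α Q x₀ (c • y + d • z)
      = c • unscaleX α Q x₀ y + d • unscaleX α Q x₀ z := by
    simp only [unscaleX_eq]
    have : x₀ = c • x₀ + d • x₀ := by rw [← add_smul, hcd, one_smul]
    nth_rewrite 1 [this]
    module
  show unscaleX α Q x₀ (c • y + d • z) ∈ pipe R
  rw [h2]; exact h

lemma uniqueDiffOn_scaledX (hR : 0 < R) (hQ : 0 < Q) :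
    UniqueDiffOn ℝ (scaledX R α Q x₀) := by
  refine uniqueDiffOn_convex convex_scaledX ⟨-(lenScale α Q)⁻¹ • x₀, ?_⟩
  have hc : Continuous (unscaleX α Q x₀) := by
    unfold unscaleX; fun_prop
  have := preimage_interior_subset_interior_preimage (t := pipe R) hc
  refine this ?_
  have h0 : unscaleX α Q x₀ (-(lenScale α Q)⁻¹ • x₀) = 0 := by
    rw [unscaleX_eq, smul_smul]
    have := (lenScale_pos (α := α) hQ).ne'
    field_simp; simp
  rw [mem_preimage, h0]
  exact mem_interior_pipe (by rwa [radius_zero])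

lemma scaledI_eq (hQ : 0 < Q) : scaledI α Q t₀ = Icc (-(t₀ / timeScale α Q)) 0 := by
  ext s
  have := timeScale_pos (α := α) hQ
  simp only [scaledI, unscaleT_eq, mem_Icc, ← neg_div]
  rw [div_le_iff₀ this]
  constructor
  · rintro ⟨h1, h2⟩; exact ⟨by linarith, h1⟩
  · rintro ⟨h1, h2⟩; exact ⟨h2, by linarith⟩

lemma unscaleT_mem (hQ : 0 < Q) (hT : t₀ < T₀) {s : ℝ} (hs : s ∈ scaledI α Q t₀) :
    unscaleT α Q t₀ s ∈ Icc 0 t₀ ∧ unscaleT α Q t₀ s ∈ Ico 0 T₀ := by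
  have := timeScale_pos (α := α) hQ
  have h : unscaleT α Q t₀ s ≤ t₀ := by
    rw [unscaleT_eq]; nlinarith [hs.1]
  exact ⟨⟨hs.2, h⟩, hs.2, h.trans_lt hT⟩

lemma hasFDerivAt_unscaleX (y : E 3) :
    HasFDerivAt (unscaleX α Q x₀) (lenScale α Q • ContinuousLinearMap.id ℝ (E 3)) y := by
  exact ((hasFDerivAt_id y).const_smul (lenScale α Q)).add_const x₀

lemma hasDerivAt_unscaleT (s : ℝ) : HasDerivAt (unscaleT α Q t₀) (timeScale α Q) s := by
  have := ((hasDerivAt_id s).const_mul (timeScale α Q)).add_const t₀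
  rw [mul_one] at this
  exact this

lemma dx_scaledV (hR : 0 < R) (hα : α ≠ 0) (hQ : 0 < Q) (hv : IsASESolution R a b T₀ v p)
    {y : E 3} (hy : y ∈ scaledX R α Q x₀) {s : ℝ} (hs : unscaleT α Q t₀ s ∈ Ico 0 T₀) :
    dx (scaledX R α Q x₀) (scaledV α Q x₀ t₀ v) y s =
      timeScale α Q • dx (pipe R) v (unscaleX α Q x₀ y) (unscaleT α Q t₀ s) := by
  have h1 := hv.hasFDerivWithinAt hy hs
  have h2 := (h1.comp y (hasFDerivAt_unscaleX y).hasFDerivWithinAt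
    (fun z hz => hz : MapsTo _ (scaledX R α Q x₀) (pipe R))).const_smul Q⁻¹
  have h3 := h2.fderivWithin (uniqueDiffOn_scaledX hR hQ y hy)
  refine Eq.trans h3 ?_
  ext1 d
  simp [lenScale_eq hα hQ, smul_smul]
  congr 1; field_simp

lemma dt_scaledV (hQ : 0 < Q) (h0 : 0 < t₀) (hT : t₀ < T₀)
    (hv : IsASESolution R a b T₀ v p)
    {y : E 3} (hy : y ∈ scaledX R α Q x₀) {s : ℝ} (hs : s ∈ scaledI α Q t₀) :
    dt (scaledI α Q t₀) (scaledV α Q x₀ t₀ v) y s =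
      (Q⁻¹ * timeScale α Q) • dt (Ico 0 T₀) v (unscaleX α Q x₀ y) (unscaleT α Q t₀ s) := by
  have h1 := (hv.euler.differentiable_time _ hy _ (unscaleT_mem hQ hT hs).2).hasDerivWithinAt
  have h2 := (h1.scomp s (hasDerivAt_unscaleT s).hasDerivWithinAt
    (fun z hz => (unscaleT_mem hQ hT hz).2 : MapsTo _ (scaledI α Q t₀) (Ico 0 T₀))).const_smul Q⁻¹
  have hu : UniqueDiffWithinAt ℝ (scaledI α Q t₀) s := by
    rw [scaledI_eq hQ] at hs ⊢
    exact uniqueDiffOn_Icc (by have := div_pos h0 (timeScale_pos (α := α) hQ); linarith) s hs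
  have h3 := h2.derivWithin hu
  refine Eq.trans h3 ?_
  rw [smul_smul]; rfl

lemma grad_scaledP (hR : 0 < R) (hα : α ≠ 0) (hQ : 0 < Q) (hv : IsASESolution R a b T₀ v p)
    {y : E 3} (hy : y ∈ scaledX R α Q x₀) {s : ℝ} (hs : unscaleT α Q t₀ s ∈ Ico 0 T₀) :
    grad (scaledX R α Q x₀) (scaledP α Q x₀ t₀ p) y s =
      (Q⁻¹ * timeScale α Q) • grad (pipe R) p (unscaleX α Q x₀ y) (unscaleT α Q t₀ s) := by
  have h1 := (hv.euler.differentiable_pressure _ hs _ hy).hasFDerivWithinAt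
  have h2 := (h1.comp y (hasFDerivAt_unscaleX y).hasFDerivWithinAt
    (fun z hz => hz : MapsTo _ (scaledX R α Q x₀) (pipe R))).const_smul (Q ^ 2)⁻¹
  have h3 := h2.fderivWithin (uniqueDiffOn_scaledX hR hQ y hy)
  refine ext_inner_right ℝ fun d => ?_
  rw [grad, inner_gradientWithin_left]
  refine Eq.trans (congrArg (fun L : E 3 →L[ℝ] ℝ => L d) h3) ?_
  rw [inner_smul_left, grad, inner_gradientWithin_left]
  simp [lenScale_eq hα hQ]
  field_simp

/-- The Euler equations are invariant under the rescaling. -/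
lemma scaled_momentum (hR : 0 < R) (hα : α ≠ 0) (hQ : 0 < Q) (h0 : 0 < t₀) (hT : t₀ < T₀)
    (hv : IsASESolution R a b T₀ v p)
    {y : E 3} (hy : y ∈ scaledX R α Q x₀) {s : ℝ} (hs : s ∈ scaledI α Q t₀) :
    dt (scaledI α Q t₀) (scaledV α Q x₀ t₀ v) y s
      + dx (scaledX R α Q x₀) (scaledV α Q x₀ t₀ v) y s (scaledV α Q x₀ t₀ v y s)
      + grad (scaledX R α Q x₀) (scaledP α Q x₀ t₀ p) y s = 0 := by
  have hs' := (unscaleT_mem hQ hT hs).2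
  have h := hv.euler.momentum _ hy _ hs'
  rw [dt_scaledV hQ h0 hT hv hy hs, dx_scaledV hR hα hQ hv hy hs', grad_scaledP hR hα hQ hv hy hs']
  have h2 : (timeScale α Q • dx (pipe R) v (unscaleX α Q x₀ y) (unscaleT α Q t₀ s))
      (scaledV α Q x₀ t₀ v y s) = (Q⁻¹ * timeScale α Q) •
        dx (pipe R) v (unscaleX α Q x₀ y) (unscaleT α Q t₀ s)
          (v (unscaleX α Q x₀ y) (unscaleT α Q t₀ s)) := by
    simp [scaledV, smul_smul, mul_comm]
  rw [h2, ← smul_add, ← smul_add, h, smul_zero]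

lemma scaled_divergence (hR : 0 < R) (hα : α ≠ 0) (hQ : 0 < Q)
    (hv : IsASESolution R a b T₀ v p)
    {y : E 3} (hy : y ∈ scaledX R α Q x₀) {s : ℝ} (hs : unscaleT α Q t₀ s ∈ Ico 0 T₀) :
    divergence (scaledX R α Q x₀) (scaledV α Q x₀ t₀ v) y s = 0 := by
  have h := hv.euler.incompressible _ hy _ hs
  unfold divergence at h ⊢
  rw [dx_scaledV hR hα hQ hv hy hs]
  simp only [_root_.smul_apply, PiLp.smul_apply, smul_eq_mul]
  rw [← Finset.mul_sum, h, mul_zero]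

/-- The rescaled form of axial symmetry. The factor `lenScale α Q` tends to zero along a blow-up
sequence. -/
lemma dx_scaledV_rotGen (hR : 0 < R) (hα : α ≠ 0) (hQ : 0 < Q)
    (hv : IsASESolution R a b T₀ v p) {y : E 3} (hy : y ∈ scaledX R α Q x₀)
    (hr : radius (unscaleX α Q x₀ y) ≠ 0) {s : ℝ} (hs : unscaleT α Q t₀ s ∈ Ico 0 T₀) :
    dx (scaledX R α Q x₀) (scaledV α Q x₀ t₀ v) y s (rotGen (unscaleX α Q x₀ y)) =
      lenScale α Q • rotGen (scaledV α Q x₀ t₀ v y s) := by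
  rw [dx_scaledV hR hα hQ hv hy hs, _root_.smul_apply, hv.dx_rotGen hy hr hs,
    lenScale_eq hα hQ, scaledV, map_smul, smul_smul]
  congr 1; field_simp

end Scaling

/-! ### Blow-up sequences -/

section BlowUp

variable {R a b T₀ α : ℝ} {v : E 3 → ℝ → E 3} {p : E 3 → ℝ → ℝ} {xs : E 3} {x : ℕ → E 3}
  {t Q : ℕ → ℝ}

lemma IsBlowUpSequence.comp (h : IsBlowUpSequence R T₀ v xs x t Q) {φ : ℕ → ℕ}
    (hφ : StrictMono φ) : IsBlowUpSequence R T₀ v xs (x ∘ φ) (t ∘ φ) (Q ∘ φ) where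
  mem_space _ := h.mem_space _
  mem_time _ := h.mem_time _
  tendsto_space := h.tendsto_space.comp hφ.tendsto_atTop
  tendsto_time := h.tendsto_time.comp hφ.tendsto_atTop
  blowUp := h.blowUp.comp hφ.tendsto_atTop
  off_axis := let ⟨d, hd, hk⟩ := h.off_axis; ⟨d, hd, fun _ => hk _⟩
  pos _ := h.pos _
  comparable := let ⟨d, hd, hk⟩ := h.comparable; ⟨d, hd, fun _ => hk _⟩

lemma IsNearMaximal.comp (h : IsNearMaximal R v x t) (φ : ℕ → ℕ) :
    IsNearMaximal R v (x ∘ φ) (t ∘ φ) :=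
  let ⟨d, hd, hk⟩ := h; ⟨d, hd, fun _ => hk _⟩

lemma IsBlowUpSequence.tendsto_Q (h : IsBlowUpSequence R T₀ v xs x t Q) :
    Tendsto Q atTop atTop := by
  obtain ⟨c, hc, hk⟩ := h.comparable
  exact tendsto_atTop_mono (fun k => (hk k).1)
    (h.blowUp.const_mul_atTop (inv_pos.2 (by linarith)))

lemma IsBlowUpSequence.tendsto_lenScale (h : IsBlowUpSequence R T₀ v xs x t Q) (h0 : 0 < α)
    (h1 : α < 1) : Tendsto (fun k => lenScale α (Q k)) atTop (𝓝 0) := by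
  have : 0 < (1 - α) / α := div_pos (by linarith) h0
  have h2 := (tendsto_rpow_neg_atTop this).comp h.tendsto_Q
  refine h2.congr fun k => ?_
  simp only [lenScale, neg_div, Function.comp]

lemma IsBlowUpSequence.tendsto_timeScale (h : IsBlowUpSequence R T₀ v xs x t Q) (h0 : 0 < α) :
    Tendsto (fun k => timeScale α (Q k)) atTop (𝓝 0) := by
  have h2 := (tendsto_rpow_neg_atTop (one_div_pos.2 h0)).comp h.tendsto_Q
  refine h2.congr fun k => ?_
  simp only [timeScale, neg_div, Function.comp]

lemma IsBlowUpSequence.radius_pos (h : IsBlowUpSequence R T₀ v xs x t Q) : 0 < radius xs := by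
  obtain ⟨d, hd, hk⟩ := h.off_axis
  exact hd.trans_le (ge_of_tendsto' (continuous_radius.continuousAt.tendsto.comp h.tendsto_space)
    fun k => (hk k).le)

lemma IsBlowUpSequence.tendsto_unscaleX (h : IsBlowUpSequence R T₀ v xs x t Q) (h0 : 0 < α)
    (h1 : α < 1) {y : ℕ → E 3} {y₀ : E 3} (hy : Tendsto y atTop (𝓝 y₀)) :
    Tendsto (fun k => unscaleX α (Q k) (x k) (y k)) atTop (𝓝 xs) := by
  have := ((h.tendsto_lenScale h0 h1).smul hy).add h.tendsto_space
  rw [zero_smul, zero_add] at this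
  exact this

lemma IsBlowUpSequence.eventually_mem_scaledI (h : IsBlowUpSequence R T₀ v xs x t Q) (h0 : 0 < α)
    (hT : 0 < T₀) {s : ℝ} (hs : s ≤ 0) : ∀ᶠ k in atTop, s ∈ scaledI α (Q k) (t k) := by
  have h2 : Tendsto (fun k => unscaleT α (Q k) (t k) s) atTop (𝓝 T₀) := by
    have := ((h.tendsto_timeScale h0).mul_const s).add h.tendsto_time
    simpa [unscaleT_eq] using this
  filter_upwards [h2.eventually (lt_mem_nhds hT)] with k hk
  exact ⟨hs, hk.le⟩

lemma IsBlowUpSequence.eventually_time_pos (h : IsBlowUpSequence R T₀ v xs x t Q)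
    (hT : 0 < T₀) : ∀ᶠ k in atTop, 0 < t k :=
  h.tendsto_time.eventually (lt_mem_nhds hT)

end BlowUp

/-! ### Limits of the rescaled cylinders -/

section Domains

lemma SetsConverge.comp {A : ℕ → Set (E 3)} {B : Set (E 3)} (h : SetsConverge A B) {ψ : ℕ → ℕ}
    (hψ : StrictMono ψ) : SetsConverge (A ∘ ψ) B := by
  intro x
  have key : (∀ ε > 0, ∃ᶠ k in atTop, ((A ∘ ψ) k ∩ Metric.ball x ε).Nonempty) → x ∈ B := by
    intro H
    refine (h x).2.2 fun ε hε => ?_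
    exact hψ.tendsto_atTop.frequently (H ε hε)
  have key2 : x ∈ B → ∀ ε > 0, ∀ᶠ k in atTop, ((A ∘ ψ) k ∩ Metric.ball x ε).Nonempty :=
    fun hx ε hε => hψ.tendsto_atTop.eventually ((h x).1.1 hx ε hε)
  exact ⟨⟨key2, fun H => key fun ε hε => (H ε hε).frequently⟩,
    ⟨fun hx ε hε => (key2 hx ε hε).frequently, key⟩⟩

lemma SetsConverge.unique {A : ℕ → Set (E 3)} {B B' : Set (E 3)} (h : SetsConverge A B)
    (h' : SetsConverge A B') : B = B' := by
  ext x; rw [(h x).1, (h' x).1]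

/-- A sequence of nonnegative numbers has a subsequence that tends to infinity or converges. -/
lemma exists_subseq_tendsto_or_atTop (d : ℕ → ℝ) (hd : ∀ k, 0 ≤ d k) :
    ∃ ψ : ℕ → ℕ, StrictMono ψ ∧
      (Tendsto (d ∘ ψ) atTop atTop ∨ ∃ c, 0 ≤ c ∧ Tendsto (d ∘ ψ) atTop (𝓝 c)) := by
  obtain ⟨l, ψ, hψ, hl⟩ := CompactSpace.tendsto_subseq (fun k => ENNReal.ofReal (d k))
  refine ⟨ψ, hψ, ?_⟩
  by_cases h : l = ⊤
  · left
    rw [h] at hl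
    exact ENNReal.tendsto_ofReal_nhds_top.1 hl
  · right
    refine ⟨l.toReal, ENNReal.toReal_nonneg, ?_⟩
    refine ((ENNReal.tendsto_toReal h).comp hl).congr fun k => ?_
    simp [ENNReal.toReal_ofReal (hd _)]

/-- The rescaled distance to the side converges, locally uniformly, to an affine function. -/
lemma tendsto_gap {R c : ℝ} {x : ℕ → E 3} {ε : ℕ → ℝ} {xs : E 3}
    (hx : Tendsto x atTop (𝓝 xs)) (hε : ∀ k, 0 < ε k) (hε0 : Tendsto ε atTop (𝓝 0))
    (hr : 0 < radius xs)
    (hc : Tendsto (fun k => (R - radius (x k)) / ε k) atTop (𝓝 c)) (y : E 3) :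
    Tendsto (fun z : ℕ × E 3 => (R - radius (ε z.1 • z.2 + x z.1)) / ε z.1) (atTop ×ˢ 𝓝 y)
      (𝓝 (c - inner ℝ y (eR xs))) := by
  have hx' : Tendsto (fun z : ℕ × E 3 => x z.1) (atTop ×ˢ 𝓝 y) (𝓝 xs) := hx.comp tendsto_fst
  have hε' : Tendsto (fun z : ℕ × E 3 => ε z.1) (atTop ×ˢ 𝓝 y) (𝓝 0) := hε0.comp tendsto_fst
  have hy' : Tendsto (fun z : ℕ × E 3 => z.2) (atTop ×ˢ 𝓝 y) (𝓝 y) := tendsto_snd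
  have hc' := hc.comp (tendsto_fst (f := (atTop : Filter ℕ)) (g := 𝓝 y))
  have hz' : Tendsto (fun z : ℕ × E 3 => ε z.1 • z.2 + x z.1) (atTop ×ˢ 𝓝 y) (𝓝 xs) := by
    simpa using (hε'.smul hy').add hx'
  have hrad : ∀ {f : ℕ × E 3 → E 3} {l : E 3}, Tendsto f (atTop ×ˢ 𝓝 y) (𝓝 l) →
      Tendsto (fun z => radius (f z)) (atTop ×ˢ 𝓝 y) (𝓝 (radius l)) := fun h =>
    continuous_radius.continuousAt.tendsto.comp h
  have hco : ∀ {f : ℕ × E 3 → E 3} {l : E 3} (i : Fin 3), Tendsto f (atTop ×ˢ 𝓝 y) (𝓝 l) →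
      Tendsto (fun z => f z i) (atTop ×ˢ 𝓝 y) (𝓝 (l i)) := fun i h =>
    (coordL i).continuous.continuousAt.tendsto.comp h
  -- `radius (ε y + x) - radius x` is the difference of the squares divided by the sum
  have hden : Tendsto (fun z : ℕ × E 3 => radius (ε z.1 • z.2 + x z.1) + radius (x z.1))
      (atTop ×ˢ 𝓝 y) (𝓝 (radius xs + radius xs)) := (hrad hz').add (hrad hx')
  have hnum : Tendsto (fun z : ℕ × E 3 => 2 * (x z.1 0 * z.2 0 + x z.1 1 * z.2 1)
      + ε z.1 * radius z.2 ^ 2) (atTop ×ˢ 𝓝 y)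
      (𝓝 (2 * (xs 0 * y 0 + xs 1 * y 1) + 0 * radius y ^ 2)) :=
    ((((hco 0 hx').mul (hco 0 hy')).add ((hco 1 hx').mul (hco 1 hy'))).const_mul 2).add
      (hε'.mul ((hrad hy').pow 2))
  have hlim := hc'.sub (hnum.div hden (by linarith))
  have hval : c - (2 * (xs 0 * y 0 + xs 1 * y 1) + 0 * radius y ^ 2) / (radius xs + radius xs)
      = c - inner ℝ y (eR xs) := by
    rw [inner_E3]; simp; field_simp; ring
  rw [hval] at hlim
  refine hlim.congr' ?_
  filter_upwards [hden.eventually (lt_mem_nhds (by linarith : (0 : ℝ) < radius xs + radius xs))]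
    with z hz
  have hsq := radius_sq (ε z.1 • z.2 + x z.1)
  have hsq2 := radius_sq (x z.1)
  have hsq3 := radius_sq z.2
  simp only [PiLp.add_apply, PiLp.smul_apply, smul_eq_mul] at hsq
  have hεz := (hε z.1).ne'
  simp only [Function.comp, Pi.div_apply]
  have hz' := hz.ne'
  field_simp
  rw [hsq3]
  linear_combination hsq - hsq2

/-- The two possible limits of the rescaled cylinders, depending on the limit of the rescaled
distance `d k` from the centre to the side. -/
def IsLimitDomain (d : ℕ → ℝ) (ζ : E 3) (X : Set (E 3)) : Prop :=
  (Tendsto d atTop atTop ∧ X = univ) ∨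
    ∃ c, 0 ≤ c ∧ Tendsto d atTop (𝓝 c) ∧ X = {x | inner ℝ x ζ ≤ c}

lemma inner_eR_self {x : E 3} (h : radius x ≠ 0) : inner ℝ (eR x) (eR x) = (1 : ℝ) := by
  rw [inner_E3]; simp
  field_simp
  rw [radius_sq]

lemma norm_eR {x : E 3} (h : radius x ≠ 0) : ‖eR x‖ = 1 := by
  have := inner_eR_self h
  rw [real_inner_self_eq_norm_sq] at this
  nlinarith [norm_nonneg (eR x)]

section

variable {R : ℝ} {x : ℕ → E 3} {ε : ℕ → ℝ} {xs : E 3} {X : Set (E 3)}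

/-- Points in the interior of the limit domain eventually lie in the rescaled cylinders. -/
lemma IsLimitDomain.eventually_mem (hx : Tendsto x atTop (𝓝 xs)) (hε : ∀ k, 0 < ε k)
    (hε0 : Tendsto ε atTop (𝓝 0)) (hr : 0 < radius xs)
    (hX : IsLimitDomain (fun k => (R - radius (x k)) / ε k) (eR xs) X) {y : E 3} (hy : y ∈ X)
    {δ : ℝ} (hδ : 0 < δ) :
    y - δ • eR xs ∈ X ∧ ∀ᶠ k in atTop, ε k • (y - δ • eR xs) + x k ∈ pipe R := by
  rcases hX with ⟨hd, rfl⟩ | ⟨c, hc, hd, rfl⟩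
  · refine ⟨mem_univ _, ?_⟩
    filter_upwards [hd.eventually_ge_atTop ‖y - δ • eR xs‖] with k hk
    rw [le_div_iff₀ (hε k)] at hk
    have h1 := radius_add_le (ε k • (y - δ • eR xs)) (x k)
    rw [radius_smul, abs_of_pos (hε k)] at h1
    have h2 := mul_le_mul_of_nonneg_left (radius_le_norm (y - δ • eR xs)) (hε k).le
    show radius _ ≤ R
    linarith
  · have hin : inner ℝ (y - δ • eR xs) (eR xs) = inner ℝ y (eR xs) - δ := by
      rw [inner_sub_left, inner_smul_left, inner_eR_self hr.ne']; simp
    have hy : inner ℝ y (eR xs) ≤ c := hy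
    refine ⟨show inner ℝ (y - δ • eR xs) (eR xs) ≤ c by rw [hin]; linarith, ?_⟩
    have h1 := tendsto_gap hx hε hε0 hr hd (y - δ • eR xs)
    have h2 := h1.comp (tendsto_id.prodMk (tendsto_const_nhds (x := y - δ • eR xs)))
    filter_upwards [h2.eventually (lt_mem_nhds (by rw [hin]; linarith : (0 : ℝ) < _))] with k hk
    simp only [Function.comp, id] at hk
    have := (div_pos_iff_of_pos_right (hε k)).1 hk
    show radius _ ≤ R
    linarith

lemma IsLimitDomain.subset_closure (hx : Tendsto x atTop (𝓝 xs)) (hε : ∀ k, 0 < ε k)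
    (hε0 : Tendsto ε atTop (𝓝 0)) (hr : 0 < radius xs)
    (hX : IsLimitDomain (fun k => (R - radius (x k)) / ε k) (eR xs) X) :
    X ⊆ closure {y | y ∈ X ∧ ∀ᶠ k in atTop, ε k • y + x k ∈ pipe R} := by
  intro y hy
  rw [Metric.mem_closure_iff]
  intro δ hδ
  refine ⟨y - (δ / 2) • eR xs, hX.eventually_mem hx hε hε0 hr hy (half_pos hδ), ?_⟩
  rw [dist_eq_norm, sub_sub_cancel, norm_smul, norm_eR hr.ne', Real.norm_eq_abs,
    abs_of_pos (half_pos hδ)]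
  linarith

/-- The rescaled cylinders converge to their limit domain in the sense of Kuratowski. -/
lemma IsLimitDomain.setsConverge (hx : Tendsto x atTop (𝓝 xs)) (hε : ∀ k, 0 < ε k)
    (hε0 : Tendsto ε atTop (𝓝 0)) (hr : 0 < radius xs)
    (hX : IsLimitDomain (fun k => (R - radius (x k)) / ε k) (eR xs) X) :
    SetsConverge (fun k => {y | ε k • y + x k ∈ pipe R}) X := by
  have h1 : ∀ y ∈ X, ∀ δ > 0,
      ∀ᶠ k in atTop, ({y | ε k • y + x k ∈ pipe R} ∩ Metric.ball y δ).Nonempty := by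
    intro y hy δ hδ
    filter_upwards [(hX.eventually_mem hx hε hε0 hr hy (half_pos hδ)).2] with k hk
    refine ⟨_, hk, ?_⟩
    rw [mem_ball_iff_norm, sub_sub_cancel_left, norm_neg, norm_smul, norm_eR hr.ne',
      Real.norm_eq_abs, abs_of_pos (half_pos hδ)]
    linarith
  have h2 : ∀ y, (∀ δ > 0,
      ∃ᶠ k in atTop, ({y | ε k • y + x k ∈ pipe R} ∩ Metric.ball y δ).Nonempty) → y ∈ X := by
    intro y hy
    rcases hX with ⟨hd, rfl⟩ | ⟨c, hc, hd, rfl⟩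
    · exact mem_univ _
    · by_contra hcon
      have hcon : c < inner ℝ y (eR xs) := not_le.1 hcon
      have h3 := (tendsto_gap hx hε hε0 hr hd y).eventually
        (gt_mem_nhds (by linarith : c - inner ℝ y (eR xs) < 0))
      obtain ⟨pa, hpa, pb, hpb, hab⟩ := eventually_prod_iff.1 h3
      obtain ⟨δ, hδ, hball⟩ := Metric.eventually_nhds_iff_ball.1 hpb
      obtain ⟨k, ⟨z, hz1, hz2⟩, hk⟩ := ((hy δ hδ).and_eventually hpa).exists
      have h4 := hab hk (hball z hz2)
      have hz1 : radius (ε k • z + x k) ≤ R := hz1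
      have := div_nonneg (sub_nonneg.2 hz1) (hε k).le
      simp only at h4
      linarith
  intro y
  exact ⟨⟨h1 y, fun H => h2 y fun δ hδ => (H δ hδ).frequently⟩,
    ⟨fun hy δ hδ => (h1 y hy δ hδ).frequently, h2 y⟩⟩

lemma IsLimitDomain.convex {d : ℕ → ℝ} {ζ : E 3} (hX : IsLimitDomain d ζ X) : Convex ℝ X := by
  rcases hX with ⟨-, rfl⟩ | ⟨c, -, -, rfl⟩
  · exact convex_univ
  · have : {x : E 3 | inner ℝ x ζ ≤ c} = {x | inner ℝ ζ x ≤ c} := by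
      ext x; simp only [mem_ofPred_eq, real_inner_comm]
    rw [this]
    exact convex_halfSpace_le (innerSL ℝ ζ).isLinear c

lemma IsLimitDomain.zero_mem {d : ℕ → ℝ} {ζ : E 3} (hX : IsLimitDomain d ζ X) : 0 ∈ X := by
  rcases hX with ⟨-, rfl⟩ | ⟨c, hc, -, rfl⟩
  · exact mem_univ _
  · show inner ℝ 0 ζ ≤ c
    simpa using hc

lemma IsLimitDomain.uniqueDiffOn {d : ℕ → ℝ} {ζ : E 3} (hζ : ζ ≠ 0) (hX : IsLimitDomain d ζ X) :
    UniqueDiffOn ℝ X := by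
  refine uniqueDiffOn_convex hX.convex ?_
  rcases hX with ⟨-, rfl⟩ | ⟨c, hc, -, rfl⟩
  · simp
  · refine ⟨-ζ, mem_interior.2 ⟨{x | inner ℝ x ζ < c}, fun x (hx : inner ℝ x ζ < c) => hx.le,
      isOpen_lt (by fun_prop) continuous_const, ?_⟩⟩
    show inner ℝ (-ζ) ζ < c
    rw [inner_neg_left, real_inner_self_eq_norm_sq]
    have := norm_pos_iff.2 hζ
    nlinarith

end

end Domains

/-! ### Reduction to the plane -/

section Planar

/-- The embedding `y ↦ -y₀ ζ + y₁ e₃` of the plane. -/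
def planeEmb (ζ : E 3) : E 2 →L[ℝ] E 3 :=
  (-(coordL 0)).smulRight ζ + (coordL 1).smulRight e3

/-- The adjoint of `planeEmb`: the components along `-ζ` and `e₃`. -/
def planeProj (ζ : E 3) : E 3 →L[ℝ] E 2 :=
  (-(innerSL ℝ ζ)).smulRight (EuclideanSpace.single 0 1)
    + (coordL 2).smulRight (EuclideanSpace.single 1 1)

variable {ζ : E 3}

lemma planeEmb_apply (y : E 2) : planeEmb ζ y = -(y 0) • ζ + y 1 • e3 := by
  simp [planeEmb]

@[simp] lemma planeProj_zero (h : E 3) : planeProj ζ h 0 = -inner ℝ h ζ := by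
  simp [planeProj, real_inner_comm]

@[simp] lemma planeProj_one (h : E 3) : planeProj ζ h 1 = h 2 := by
  simp [planeProj]

lemma inner_planeEmb (y : E 2) (h : E 3) :
    inner ℝ (planeEmb ζ y) h = inner ℝ y (planeProj ζ h) := by
  rw [inner_E2, planeEmb_apply, inner_add_left, inner_smul_left, inner_smul_left, planeProj_zero,
    planeProj_one, real_inner_comm h ζ, inner_E3 e3]
  simp

lemma inner_self_dir (hζ2 : ζ 2 = 0) (hζ : ζ 0 ^ 2 + ζ 1 ^ 2 = 1) : inner ℝ ζ ζ = (1 : ℝ) := by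
  rw [inner_E3, hζ2]; linarith

lemma decomp_dir (hζ2 : ζ 2 = 0) (hζ : ζ 0 ^ 2 + ζ 1 ^ 2 = 1)
    (h : E 3) :
    h = inner ℝ h ζ • ζ + inner ℝ h (rotGen ζ) • rotGen ζ + h 2 • e3 := by
  simp only [inner_E3]
  apply E3_ext
  · simp [hζ2]; linear_combination -(h 0) * hζ
  · simp [hζ2]; linear_combination -(h 1) * hζ
  · simp [hζ2]

lemma planeEmb_planeProj (hζ2 : ζ 2 = 0) (hζ : ζ 0 ^ 2 + ζ 1 ^ 2 = 1)
    {h : E 3} (hh : inner ℝ h (rotGen ζ) = 0) :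
    planeEmb ζ (planeProj ζ h) = h := by
  conv_rhs => rw [decomp_dir hζ2 hζ h, hh]
  rw [planeEmb_apply]; simp

/-- The divergence does not see a direction in which the derivative vanishes. -/
lemma trace_eq (hζ2 : ζ 2 = 0) (hζ : ζ 0 ^ 2 + ζ 1 ^ 2 = 1)
    (D : E 3 →L[ℝ] E 3) (hD : D (rotGen ζ) = 0) :
    ∑ i : Fin 2, planeProj ζ (D (planeEmb ζ (EuclideanSpace.single i 1))) i =
      ∑ i : Fin 3, (D (EuclideanSpace.single i 1)) i := by
  have h0 : (EuclideanSpace.single 0 1 : E 3) = ζ 0 • ζ - ζ 1 • rotGen ζ := by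
    apply E3_ext
    · simp; linarith
    · simp; ring
    · simp [hζ2]
  have h1 : (EuclideanSpace.single 1 1 : E 3) = ζ 1 • ζ + ζ 0 • rotGen ζ := by
    apply E3_ext
    · simp; ring
    · simp; linarith
    · simp [hζ2]
  have h2 : (EuclideanSpace.single 2 1 : E 3) = e3 := by
    apply E3_ext <;> simp
  rw [Fin.sum_univ_two, Fin.sum_univ_three, h0, h1, h2, map_sub, map_add]
  simp only [map_smul, hD, planeProj_zero, planeProj_one, planeEmb_apply]
  simp [inner_E3, hζ2]
  ring

end Planar

lemma dx_apply_inner_eq_zero {X : Set (E 3)} {w : E 3 → ℝ → E 3} (hXu : UniqueDiffOn ℝ X)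
    {η : E 3} {t : ℝ} (hd : DifferentiableOn ℝ (fun y => w y t) X)
    (hw : ∀ x ∈ X, inner ℝ (w x t) η = 0) {x : E 3} (hx : x ∈ X) (d : E 3) :
    inner ℝ (dx X w x t d) η = 0 := by
  have h1 : HasFDerivWithinAt (fun y => w y t) (dx X w x t) X x := (hd x hx).hasFDerivWithinAt
  have h2 := (innerSL ℝ η).hasFDerivAt.comp_hasFDerivWithinAt x h1
  have h3 : HasFDerivWithinAt (fun y => innerSL ℝ η (w y t)) (0 : E 3 →L[ℝ] ℝ) X x := by
    refine (hasFDerivWithinAt_const (0 : ℝ) x X).congr (fun y hy => ?_) ?_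
    · simpa [real_inner_comm] using hw y hy
    · simpa [real_inner_comm] using hw x hx
  have h4 := congrArg (fun L : E 3 →L[ℝ] ℝ => L d) ((hXu x hx).eq h2 h3)
  simpa [real_inner_comm] using h4

lemma dt_inner_eq_zero {w : E 3 → ℝ → E 3} {η x : E 3}
    (hd : DifferentiableOn ℝ (fun s => w x s) (Iic 0))
    (hw : ∀ t ≤ 0, inner ℝ (w x t) η = 0) {t : ℝ} (ht : t ≤ 0) :
    inner ℝ (dt (Iic 0) w x t) η = 0 := by
  have h1 : HasDerivWithinAt (fun s => w x s) (dt (Iic 0) w x t) (Iic 0) t :=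
    (hd t ht).hasDerivWithinAt
  have h2 := (innerSL ℝ η).hasFDerivAt.comp_hasDerivWithinAt t h1
  have h3 : HasDerivWithinAt (fun s => innerSL ℝ η (w x s)) (0 : ℝ) (Iic 0) t := by
    refine (hasDerivWithinAt_const t (Iic 0) (0 : ℝ)).congr (fun y hy => ?_) ?_
    · simpa [real_inner_comm] using hw y hy
    · simpa [real_inner_comm] using hw t ht
  have h4 := (uniqueDiffOn_Iic (0 : ℝ) t ht).eq_deriv _ h2 h3
  simpa [real_inner_comm] using h4

/-- A field with vanishing derivative in a direction that leaves its domain invariant is constant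
in that direction. -/
lemma eq_add_smul_of_fderivWithin_eq_zero {F : Type*} [NormedAddCommGroup F] [NormedSpace ℝ F]
    {X : Set (E 3)} {f : E 3 → F} (hf : DifferentiableOn ℝ f X) {η : E 3}
    (hX : ∀ x ∈ X, ∀ s : ℝ, x + s • η ∈ X) (hD : ∀ x ∈ X, fderivWithin ℝ f X x η = 0)
    {x : E 3} (hx : x ∈ X) (s : ℝ) : f (x + s • η) = f x := by
  have h1 : ∀ s : ℝ, HasDerivAt (fun s : ℝ => f (x + s • η)) 0 s := by
    intro s
    rw [← hD _ (hX x hx s)]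
    refine HasFDerivWithinAt.comp_hasDerivAt (t := X) s (hf _ (hX x hx s)).hasFDerivWithinAt ?_
      (Eventually.of_forall fun s => hX x hx s)
    simpa using ((hasDerivAt_id s).smul_const η).const_add x
  have h2 := is_const_of_deriv_eq_zero (fun s => (h1 s).differentiableAt)
    (fun s => (h1 s).deriv) s 0
  simpa using h2

lemma uniqueDiffOn_halfPlane : UniqueDiffOn ℝ halfPlane := by
  have h : halfPlane = {y : E 2 | 0 ≤ coordL 0 y} := rfl
  refine uniqueDiffOn_convex (h ▸ convex_halfSpace_ge (coordL 0).isLinear 0) ?_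
  refine ⟨EuclideanSpace.single 0 1, mem_interior.2 ⟨{y : E 2 | 0 < y 0},
    fun y (hy : 0 < y 0) => hy.le, isOpen_lt continuous_const (by fun_prop), ?_⟩⟩
  show (0 : ℝ) < (EuclideanSpace.single 0 1 : E 2) 0
  simp

section

variable {X : Set (E 3)} {Y : Set (E 2)} {w : E 3 → ℝ → E 3} {q : E 3 → ℝ → ℝ} {ζ : E 3} {c : ℝ}

lemma hasFDerivAt_planeMap (y : E 2) :
    HasFDerivAt (fun y => c • ζ + planeEmb ζ y) (planeEmb ζ) y :=
  (planeEmb ζ).hasFDerivAt.const_add _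

lemma dx_planar (hYu : UniqueDiffOn ℝ Y) (hYX : ∀ y ∈ Y, c • ζ + planeEmb ζ y ∈ X) {t : ℝ}
    (hd : DifferentiableOn ℝ (fun y => w y t) X) {y : E 2} (hy : y ∈ Y) :
    HasFDerivWithinAt (fun y => planeProj ζ (w (c • ζ + planeEmb ζ y) t))
      ((planeProj ζ).comp ((dx X w (c • ζ + planeEmb ζ y) t).comp (planeEmb ζ))) Y y ∧
    dx Y (fun y t => planeProj ζ (w (c • ζ + planeEmb ζ y) t)) y t =
      (planeProj ζ).comp ((dx X w (c • ζ + planeEmb ζ y) t).comp (planeEmb ζ)) := by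
  have h1 : HasFDerivWithinAt (fun y => w y t) (dx X w (c • ζ + planeEmb ζ y) t) X
    (c • ζ + planeEmb ζ y) := (hd _ (hYX y hy)).hasFDerivWithinAt
  have h2 := (planeProj ζ).hasFDerivAt.comp_hasFDerivWithinAt y
    (h1.comp y (hasFDerivAt_planeMap y).hasFDerivWithinAt hYX)
  exact ⟨h2, h2.fderivWithin (hYu y hy)⟩

/-- Euler equations for a field that is invariant in, and orthogonal to, the direction
`rotGen ζ` reduce to the two-dimensional Euler equations in the plane of `ζ` and `e₃`. -/
lemma isEulerSolution_planar (hζ2 : ζ 2 = 0) (hζ : ζ 0 ^ 2 + ζ 1 ^ 2 = 1)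
    (hYu : UniqueDiffOn ℝ Y) (hYX : ∀ y ∈ Y, c • ζ + planeEmb ζ y ∈ X)
    (hE : IsEulerSolution X (Iic 0) w q)
    (hw : ∀ x ∈ X, ∀ t ≤ 0, inner ℝ (w x t) (rotGen ζ) = 0)
    (hD : ∀ x ∈ X, ∀ t ≤ 0, dx X w x t (rotGen ζ) = 0) :
    IsEulerSolution Y (Iic 0) (fun y t => planeProj ζ (w (c • ζ + planeEmb ζ y) t))
      (fun y t => q (c • ζ + planeEmb ζ y) t) := by
  have hdt : ∀ y ∈ Y, ∀ t ∈ Iic (0 : ℝ),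
      HasDerivWithinAt (fun t => planeProj ζ (w (c • ζ + planeEmb ζ y) t))
        (planeProj ζ (dt (Iic 0) w (c • ζ + planeEmb ζ y) t)) (Iic 0) t := fun y hy t ht => by
    have h1 : HasDerivWithinAt (fun s => w (c • ζ + planeEmb ζ y) s)
      (dt (Iic 0) w (c • ζ + planeEmb ζ y) t) (Iic 0) t :=
      (hE.differentiable_time _ (hYX y hy) t ht).hasDerivWithinAt
    exact (planeProj ζ).hasFDerivAt.comp_hasDerivWithinAt t h1
  have hdt' : ∀ y ∈ Y, ∀ t ∈ Iic (0 : ℝ),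
      dt (Iic 0) (fun y t => planeProj ζ (w (c • ζ + planeEmb ζ y) t)) y t =
        planeProj ζ (dt (Iic 0) w (c • ζ + planeEmb ζ y) t) := fun y hy t ht =>
    (hdt y hy t ht).derivWithin (uniqueDiffOn_Iic (0 : ℝ) t ht)
  have hmap : ContinuousOn (fun z : E 2 × ℝ => (c • ζ + planeEmb ζ z.1, z.2)) (Y ×ˢ Iic 0) := by
    fun_prop
  have hmapsto : MapsTo (fun z : E 2 × ℝ => (c • ζ + planeEmb ζ z.1, z.2)) (Y ×ˢ Iic 0)
      (X ×ˢ Iic 0) := fun z hz => ⟨hYX _ hz.1, hz.2⟩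
  have hq : ∀ y ∈ Y, ∀ t ∈ Iic (0 : ℝ), HasFDerivWithinAt (fun y => q (c • ζ + planeEmb ζ y) t)
      ((fderivWithin ℝ (fun y => q y t) X (c • ζ + planeEmb ζ y)).comp (planeEmb ζ)) Y y := by
    intro y hy t ht
    have h1 := (hE.differentiable_pressure t ht _ (hYX y hy)).hasFDerivWithinAt
    exact h1.comp y (hasFDerivAt_planeMap y).hasFDerivWithinAt hYX
  have hgrad : ∀ y ∈ Y, ∀ t ∈ Iic (0 : ℝ), grad Y (fun y t => q (c • ζ + planeEmb ζ y) t) y t =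
      planeProj ζ (grad X q (c • ζ + planeEmb ζ y) t) := by
    intro y hy t ht
    refine ext_inner_left ℝ fun d => ?_
    rw [← inner_planeEmb, real_inner_comm, grad, inner_gradientWithin_left,
      (hq y hy t ht).fderivWithin (hYu y hy), real_inner_comm, grad, inner_gradientWithin_left]
    rfl
  refine ⟨fun t ht y hy => ?_, fun y hy t ht => (hdt y hy t ht).differentiableWithinAt,
    ?_, ?_, ?_, fun t ht y hy => (hq y hy t ht).differentiableWithinAt, fun y hy t ht => ?_,
    fun y hy t ht => ?_⟩
  · exact (dx_planar hYu hYX (hE.differentiable_space t ht) hy).1.differentiableWithinAt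
  · exact (planeProj ζ).continuous.comp_continuousOn (hE.continuous.comp hmap hmapsto)
  · have h1 := hE.continuous_dx.comp hmap hmapsto
    have h2 : ContinuousOn (fun z : E 2 × ℝ => (planeProj ζ).comp
        ((dx X w (c • ζ + planeEmb ζ z.1) z.2).comp (planeEmb ζ))) (Y ×ˢ Iic 0) :=
      continuousOn_const.clm_comp (h1.clm_comp continuousOn_const)
    exact h2.congr fun z hz =>
      (dx_planar hYu hYX (hE.differentiable_space z.2 hz.2) hz.1).2
  · have h1 := (planeProj ζ).continuous.comp_continuousOn (hE.continuous_dt.comp hmap hmapsto)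
    exact h1.congr fun z hz => hdt' z.1 hz.1 z.2 hz.2
  · have hX := hYX y hy
    have h1 := hE.momentum _ hX t ht
    rw [hdt' y hy t ht, hgrad y hy t ht,
      (dx_planar hYu hYX (hE.differentiable_space t ht) hy).2]
    simp only [ContinuousLinearMap.comp_apply]
    rw [planeEmb_planeProj hζ2 hζ (hw _ hX t ht), ← map_add, ← map_add, h1, map_zero]
  · have hX := hYX y hy
    unfold divergence
    rw [(dx_planar hYu hYX (hE.differentiable_space t ht) hy).2]
    simp only [ContinuousLinearMap.comp_apply]
    rw [trace_eq hζ2 hζ _ (hD _ hX t ht)]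
    exact hE.incompressible _ hX t ht

/-- An ancient solution on a half-space or on the whole space that has no component and no
derivative in the horizontal direction orthogonal to `ζ` is two-dimensional. -/
lemma isPlanarAncientSolution_of_invariant (hζ2 : ζ 2 = 0) (hζ : ζ 0 ^ 2 + ζ 1 ^ 2 = 1)
    (hXu : UniqueDiffOn ℝ X) (hc : 0 ≤ c)
    (hX : (X = univ ∧ Y = univ) ∨ (X = {x | inner ℝ x ζ ≤ c} ∧ Y = halfPlane ∧
      ∀ x : E 3, inner ℝ x ζ = c → ∀ t ≤ 0, inner ℝ (w x t) ζ = 0))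
    (hE : IsEulerSolution X (Iic 0) w q)
    (hw : ∀ x ∈ X, ∀ t ≤ 0, inner ℝ (w x t) (rotGen ζ) = 0)
    (hD : ∀ x ∈ X, ∀ t ≤ 0, dx X w x t (rotGen ζ) = 0)
    (hne : ∃ x ∈ X, ∃ t ≤ 0, w x t ≠ 0) :
    IsPlanarAncientSolution ζ X w q := by
  have hin : ∀ y : E 2, inner ℝ (c • ζ + planeEmb ζ y) ζ = c - y 0 := by
    intro y
    rw [inner_add_left, inner_smul_left, inner_planeEmb, inner_self_dir hζ2 hζ, inner_E2,
      planeProj_zero, planeProj_one, inner_self_dir hζ2 hζ, hζ2]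
    simp; ring
  have hYX : ∀ y ∈ Y, c • ζ + planeEmb ζ y ∈ X := by
    rcases hX with ⟨rfl, rfl⟩ | ⟨rfl, rfl, -⟩
    · exact fun _ _ => mem_univ _
    · intro y (hy : 0 ≤ y 0)
      show inner ℝ _ ζ ≤ c
      rw [hin]; linarith
  have hYu : UniqueDiffOn ℝ Y := by
    rcases hX with ⟨-, rfl⟩ | ⟨-, rfl, -⟩
    · exact uniqueDiffOn_univ
    · exact uniqueDiffOn_halfPlane
  have hXY : ∀ x ∈ X, !₂[c - inner ℝ x ζ, x 2] ∈ Y := by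
    rcases hX with ⟨rfl, rfl⟩ | ⟨rfl, rfl, -⟩
    · exact fun _ _ => mem_univ _
    · intro x (hx : inner ℝ x ζ ≤ c)
      show 0 ≤ c - inner ℝ x ζ
      linarith
  have hperp : inner ℝ (rotGen ζ) ζ = (0 : ℝ) := by rw [inner_E3]; simp [hζ2]; ring
  have hXinv : ∀ x ∈ X, ∀ s : ℝ, x + s • rotGen ζ ∈ X := by
    rcases hX with ⟨rfl, rfl⟩ | ⟨rfl, rfl, -⟩
    · exact fun _ _ _ => mem_univ _
    · intro x (hx : inner ℝ x ζ ≤ c) s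
      show inner ℝ _ ζ ≤ c
      rw [inner_add_left, inner_smul_left, hperp]; simpa using hx
  have hdec : ∀ x : E 3, c • ζ + planeEmb ζ !₂[c - inner ℝ x ζ, x 2]
      + inner ℝ x (rotGen ζ) • rotGen ζ = x := by
    intro x
    conv_rhs => rw [decomp_dir hζ2 hζ x]
    rw [planeEmb_apply]
    simp only [Matrix.cons_val_zero, Matrix.cons_val_one]
    module
  -- the pressure inherits the invariance from the momentum equation
  have hqη : ∀ x ∈ X, ∀ t ≤ 0, fderivWithin ℝ (fun y => q y t) X x (rotGen ζ) = 0 := by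
    intro x hx t ht
    have h1 := congrArg (fun h => inner ℝ h (rotGen ζ)) (hE.momentum x hx t ht)
    simp only [inner_add_left, inner_zero_left] at h1
    rw [dt_inner_eq_zero (hE.differentiable_time x hx) (hw x hx) ht,
      dx_apply_inner_eq_zero hXu (hE.differentiable_space t ht) (fun y hy => hw y hy t ht) hx,
      grad, inner_gradientWithin_left] at h1
    simpa using h1
  have hwA : ∀ x ∈ X, ∀ t ≤ 0,
      w x t = w (c • ζ + planeEmb ζ !₂[c - inner ℝ x ζ, x 2]) t := by
    intro x hx t ht
    have h := eq_add_smul_of_fderivWithin_eq_zero (hE.differentiable_space t ht) hXinv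
      (fun y hy => hD y hy t ht) (hYX _ (hXY x hx)) (inner ℝ x (rotGen ζ))
    rwa [hdec x] at h
  have hqA : ∀ x ∈ X, ∀ t ≤ 0,
      q x t = q (c • ζ + planeEmb ζ !₂[c - inner ℝ x ζ, x 2]) t := by
    intro x hx t ht
    have h := eq_add_smul_of_fderivWithin_eq_zero (hE.differentiable_pressure t ht) hXinv
      (fun y hy => hqη y hy t ht) (hYX _ (hXY x hx)) (inner ℝ x (rotGen ζ))
    rwa [hdec x] at h
  refine ⟨c, Y, fun y t => planeProj ζ (w (c • ζ + planeEmb ζ y) t),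
    fun y t => q (c • ζ + planeEmb ζ y) t, hc, ?_, fun x hx t ht => ⟨?_, hqA x hx t ht⟩,
    isEulerSolution_planar hζ2 hζ hYu hYX hE hw hD, ?_⟩
  · rcases hX with h | ⟨h1, h2, h3⟩
    · exact Or.inl h
    · refine Or.inr ⟨h1, h2, fun y hy t ht => ?_⟩
      rw [planeProj_zero, h3 _ (by rw [hin, hy, sub_zero]) t ht, neg_zero]
  · simp only
    rw [← hwA x hx t ht]
    conv_lhs => rw [← planeEmb_planeProj hζ2 hζ (hw x hx t ht), planeEmb_apply]
    rw [smul_neg, neg_smul]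
  · obtain ⟨x, hx, t, ht, hxt⟩ := hne
    refine ⟨_, hXY x hx, t, ht, fun h0 => hxt ?_⟩
    simp only at h0
    rw [← planeEmb_planeProj hζ2 hζ (hw x hx t ht), hwA x hx t ht, h0, map_zero]

end

/-! ### Passage to the limit -/

section HolderConvergence

variable {n : ℕ} {F : Type*} [NormedAddCommGroup F] {γ : ℝ}
  {S : ℕ → Set (E n × ℝ)} {T : Set (E n × ℝ)} {f : ℕ → E n → ℝ → F} {g : E n → ℝ → F}

/-- Convergence of continuous linear maps and of their arguments gives convergence of the values. -/
lemma tendsto_clm_apply {G H : Type*} [NormedAddCommGroup G] [NormedSpace ℝ G]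
    [NormedAddCommGroup H] [NormedSpace ℝ H] {ι : Type*} {l : Filter ι} {L : ι → G →L[ℝ] H}
    {L₀ : G →L[ℝ] H} {u : ι → G} {u₀ : G} (hL : Tendsto L l (𝓝 L₀)) (hu : Tendsto u l (𝓝 u₀)) :
    Tendsto (fun k => L k (u k)) l (𝓝 (L₀ u₀)) := by
  have hc : Continuous fun z : (G →L[ℝ] H) × G => z.1 z.2 := by fun_prop
  exact (hc.tendsto (L₀, u₀)).comp (hL.prodMk_nhds hu)

lemma HolderConverges.tendsto (h : HolderConverges γ S T f g) {z : E n × ℝ} (hz : z ∈ T)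
    (hS : ∀ᶠ k in atTop, z ∈ S k) :
    Tendsto (fun k => f k z.1 z.2) atTop (𝓝 (g z.1 z.2)) := by
  rw [Metric.tendsto_nhds]
  intro ε hε
  filter_upwards [h.2 {z} isCompact_singleton (ε / 2) (half_pos hε), hS] with k hk hSk
  have := hk.1 z ⟨⟨rfl, hSk⟩, hz⟩
  rw [dist_eq_norm]; linarith

lemma ParabolicHolderLE.continuousOn {U : Set (E n × ℝ)} {C : ℝ} (hγ : 0 < γ)
    (h : ParabolicHolderLE γ U g C) : ContinuousOn (fun z : E n × ℝ => g z.1 z.2) U := by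
  intro z hz
  have h1 : Tendsto (fun w : E n × ℝ => C * (‖w.1 - z.1‖ + √|w.2 - z.2|) ^ γ) (𝓝[U] z) (𝓝 0) := by
    have hc : Continuous fun w : E n × ℝ => C * (‖w.1 - z.1‖ + √|w.2 - z.2|) ^ γ := by
      refine continuous_const.mul (Continuous.rpow_const (by fun_prop) fun w => Or.inr hγ.le)
    have := hc.tendsto z
    simp [Real.zero_rpow hγ.ne'] at this
    exact this.mono_left nhdsWithin_le_nhds
  rw [ContinuousWithinAt, tendsto_iff_norm_sub_tendsto_zero]
  refine squeeze_zero' (Eventually.of_forall fun w => norm_nonneg _) ?_ h1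
  filter_upwards [self_mem_nhdsWithin] with w hw using h.2 w hw z hz

lemma HolderConverges.continuousOn (h : HolderConverges γ S T f g) (hγ : 0 < γ) :
    ContinuousOn (fun z : E n × ℝ => g z.1 z.2) T := by
  intro z hz
  obtain ⟨C, hC⟩ := h.1 (Metric.closedBall z 1) (isCompact_closedBall z 1)
  have h1 := hC.continuousOn hγ z ⟨Metric.mem_closedBall_self zero_le_one, hz⟩
  exact h1.mono_of_mem_nhdsWithin
    (inter_mem (mem_nhdsWithin_of_mem_nhds (Metric.closedBall_mem_nhds z one_pos))
      self_mem_nhdsWithin)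

lemma HolderConverges.comp (h : HolderConverges γ S T f g) {φ : ℕ → ℕ} (hφ : StrictMono φ) :
    HolderConverges γ (S ∘ φ) T (f ∘ φ) g :=
  ⟨h.1, fun K hK ε hε => hφ.tendsto_atTop.eventually (h.2 K hK ε hε)⟩

end HolderConvergence

/-- The convergence of the rescaled fields in `IsLocalLimit`, along the whole sequence and without
the convergence of the domains. -/
structure IsFieldLimit (R α γ : ℝ) (v : E 3 → ℝ → E 3) (p : E 3 → ℝ → ℝ) (x : ℕ → E 3)
    (t Q : ℕ → ℝ) (X : Set (E 3)) (w : E 3 → ℝ → E 3) (q : E 3 → ℝ → ℝ) : Prop where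
  diff_space : ∀ s ≤ 0, DifferentiableOn ℝ (fun y => w y s) X
  diff_time : ∀ y ∈ X, DifferentiableOn ℝ (fun s => w y s) (Iic 0)
  diff_pressure : ∀ s ≤ 0, DifferentiableOn ℝ (fun y => q y s) X
  conv : HolderConverges γ (fun k => scaledX R α (Q k) (x k) ×ˢ scaledI α (Q k) (t k)) (X ×ˢ Iic 0)
    (fun k => scaledV α (Q k) (x k) (t k) v) w
  conv_dx : HolderConverges γ (fun k => scaledX R α (Q k) (x k) ×ˢ scaledI α (Q k) (t k))
    (X ×ˢ Iic 0)
    (fun k => dx (scaledX R α (Q k) (x k)) (scaledV α (Q k) (x k) (t k) v)) (dx X w)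
  conv_dt : HolderConverges γ (fun k => scaledX R α (Q k) (x k) ×ˢ scaledI α (Q k) (t k))
    (X ×ˢ Iic 0)
    (fun k => dt (scaledI α (Q k) (t k)) (scaledV α (Q k) (x k) (t k) v)) (dt (Iic 0) w)
  conv_grad : HolderConverges γ (fun k => scaledX R α (Q k) (x k) ×ˢ scaledI α (Q k) (t k))
    (X ×ˢ Iic 0)
    (fun k => grad (scaledX R α (Q k) (x k)) (scaledP α (Q k) (x k) (t k) p)) (grad X q)

/-- The Hölder norms of the rescaled velocities are eventually bounded on each compact set. -/
def EventuallyHolder (R α γ : ℝ) (v : E 3 → ℝ → E 3) (x : ℕ → E 3) (t Q : ℕ → ℝ) : Prop :=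
  ∀ K : Set (E 3 × ℝ), IsCompact K → ∃ C, ∀ᶠ k in atTop, ParabolicHolderLE γ
    (K ∩ scaledX R α (Q k) (x k) ×ˢ scaledI α (Q k) (t k)) (scaledV α (Q k) (x k) (t k) v) C

section Limit

variable {R a b T₀ α γ : ℝ} {v : E 3 → ℝ → E 3} {p : E 3 → ℝ → ℝ} {xs : E 3} {x : ℕ → E 3}
  {t Q : ℕ → ℝ} {X : Set (E 3)} {w : E 3 → ℝ → E 3} {q : E 3 → ℝ → ℝ}

lemma IsFieldLimit.comp (h : IsFieldLimit R α γ v p x t Q X w q) {φ : ℕ → ℕ} (hφ : StrictMono φ) :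
    IsFieldLimit R α γ v p (x ∘ φ) (t ∘ φ) (Q ∘ φ) X w q where
  diff_space := h.diff_space
  diff_time := h.diff_time
  diff_pressure := h.diff_pressure
  conv := h.conv.comp hφ
  conv_dx := h.conv_dx.comp hφ
  conv_dt := h.conv_dt.comp hφ
  conv_grad := h.conv_grad.comp hφ

/-- The rescaled distance from the centre to the side. -/
def sideDist (R α : ℝ) (x : ℕ → E 3) (Q : ℕ → ℝ) (k : ℕ) : ℝ :=
  (R - radius (x k)) / lenScale α (Q k)

lemma eventually_mem_domain (hT : 0 < T₀) (h0 : 0 < α) (hB : IsBlowUpSequence R T₀ v xs x t Q)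
    {y : E 3} (hy : ∀ᶠ k in atTop, y ∈ scaledX R α (Q k) (x k)) {s : ℝ} (hs : s ≤ 0) :
    ∀ᶠ k in atTop, (y, s) ∈ scaledX R α (Q k) (x k) ×ˢ scaledI α (Q k) (t k) := by
  filter_upwards [hy, hB.eventually_mem_scaledI h0 hT hs] with k h1 h2 using ⟨h1, h2⟩

/-- A relation between continuous fields on the limit domain has to be checked only at points that
eventually lie in the rescaled cylinders. -/
lemma eq_zero_on_limitDomain {F : Type*} [NormedAddCommGroup F]
    (h0 : 0 < α) (h1 : α < 1) (hB : IsBlowUpSequence R T₀ v xs x t Q)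
    (hX : IsLimitDomain (sideDist R α x Q) (eR xs) X) {f : E 3 × ℝ → F}
    (hf : ContinuousOn f (X ×ˢ Iic 0))
    (hzero : ∀ y ∈ X, (∀ᶠ k in atTop, y ∈ scaledX R α (Q k) (x k)) → ∀ s ≤ 0, f (y, s) = 0)
    {y : E 3} (hy : y ∈ X) {s : ℝ} (hs : s ≤ 0) : f (y, s) = 0 := by
  have hsub := hX.subset_closure hB.tendsto_space (fun k => lenScale_pos (hB.pos k))
    (hB.tendsto_lenScale h0 h1) hB.radius_pos
  have h2 : EqOn f 0 ({y | y ∈ X ∧ ∀ᶠ k in atTop, lenScale α (Q k) • y + x k ∈ pipe R} ×ˢ Iic 0) :=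
    fun z hz => hzero z.1 hz.1.1 hz.1.2 z.2 hz.2
  refine h2.of_subset_closure hf continuousOn_const (prod_mono (fun y hy => hy.1) subset_rfl) ?_
    (show (y, s) ∈ X ×ˢ Iic 0 from ⟨hy, hs⟩)
  rw [closure_prod_eq]
  exact prod_mono hsub subset_closure

/-- The Euler equations are invariant under the rescaling, hence hold in the limit. -/
lemma IsFieldLimit.isEulerSolution (hR : 0 < R) (hT : 0 < T₀) (hv : IsASESolution R a b T₀ v p)
    (h0 : 0 < α) (h1 : α < 1) (hγ : 0 < γ) (hB : IsBlowUpSequence R T₀ v xs x t Q)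
    (hX : IsLimitDomain (sideDist R α x Q) (eR xs) X)
    (h : IsFieldLimit R α γ v p x t Q X w q) : IsEulerSolution X (Iic 0) w q := by
  have cv := h.conv.continuousOn hγ
  have cdx := h.conv_dx.continuousOn hγ
  have cdt := h.conv_dt.continuousOn hγ
  have cg := h.conv_grad.continuousOn hγ
  refine ⟨h.diff_space, h.diff_time, cv, cdx, cdt, h.diff_pressure, fun y hy s hs => ?_,
    fun y hy s hs => ?_⟩
  · refine eq_zero_on_limitDomain h0 h1 hB hX
      (f := fun z => dt (Iic 0) w z.1 z.2 + dx X w z.1 z.2 (w z.1 z.2) + grad X q z.1 z.2)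
      ((cdt.add (cdx.clm_apply cv)).add cg) (fun y hy hyk s hs => ?_) hy hs
    have hS := eventually_mem_domain hT h0 hB hyk hs
    have hz : (y, s) ∈ X ×ˢ Iic (0 : ℝ) := ⟨hy, hs⟩
    have hlim := ((h.conv_dt.tendsto hz hS).add
      (tendsto_clm_apply (h.conv_dx.tendsto hz hS) (h.conv.tendsto hz hS))).add
        (h.conv_grad.tendsto hz hS)
    refine tendsto_nhds_unique hlim (tendsto_const_nhds.congr' ?_)
    filter_upwards [hS, hB.eventually_time_pos hT] with k hk htk
    exact (scaled_momentum hR h0.ne' (hB.pos k) htk (hB.mem_time k).2 hv hk.1 hk.2).symm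
  · have happ : ∀ i : Fin 3, Continuous fun L : E 3 →L[ℝ] E 3 => L (EuclideanSpace.single i 1) i :=
      fun i => by
        have : Continuous fun L : E 3 →L[ℝ] E 3 => L (EuclideanSpace.single i 1) := by fun_prop
        exact (coordL i).continuous.comp this
    refine eq_zero_on_limitDomain h0 h1 hB hX (f := fun z => divergence X w z.1 z.2)
      (continuousOn_finsetSum _ fun i _ => (happ i).comp_continuousOn cdx)
      (fun y hy hyk s hs => ?_) hy hs
    have hS := eventually_mem_domain hT h0 hB hyk hs
    have hz : (y, s) ∈ X ×ˢ Iic (0 : ℝ) := ⟨hy, hs⟩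
    have hlim := tendsto_finsetSum (Finset.univ : Finset (Fin 3)) fun i _ =>
      ((happ i).tendsto _).comp (h.conv_dx.tendsto hz hS)
    refine tendsto_nhds_unique hlim (tendsto_const_nhds.congr' ?_)
    filter_upwards [hS] with k hk
    exact (scaled_divergence hR h0.ne' (hB.pos k) hv hk.1
      (unscaleT_mem (hB.pos k) (hB.mem_time k).2 hk.2).2).symm

/-- The swirl is bounded, hence negligible after rescaling. -/
lemma IsFieldLimit.inner_rotGen_eq_zero (hR : 0 < R) (hab : a < b) (hT : 0 < T₀)
    (hv : IsASESolution R a b T₀ v p)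
    (h0 : 0 < α) (h1 : α < 1) (hγ : 0 < γ) (hB : IsBlowUpSequence R T₀ v xs x t Q)
    (hX : IsLimitDomain (sideDist R α x Q) (eR xs) X)
    (h : IsFieldLimit R α γ v p x t Q X w q) {y : E 3} (hy : y ∈ X) {s : ℝ} (hs : s ≤ 0) :
    inner ℝ (w y s) (rotGen xs) = 0 := by
  obtain ⟨C, hC⟩ := hv.swirl_bounded hR hab hT
  have cv := h.conv.continuousOn hγ
  refine eq_zero_on_limitDomain h0 h1 hB hX (f := fun z => inner ℝ (w z.1 z.2) (rotGen xs))
    (cv.inner continuousOn_const) (fun y hy hyk s hs => ?_) hy hs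
  have hS := eventually_mem_domain hT h0 hB hyk hs
  have hlim := (h.conv.tendsto (show (y, s) ∈ X ×ˢ Iic (0 : ℝ) from ⟨hy, hs⟩) hS).inner (𝕜 := ℝ)
    ((rotGen.continuous.tendsto xs).comp (hB.tendsto_unscaleX h0 h1 (tendsto_const_nhds (x := y))))
  refine tendsto_nhds_unique hlim ?_
  have hQ : Tendsto (fun k => (Q k)⁻¹ * C) atTop (𝓝 0) := by
    simpa using (tendsto_inv_atTop_zero.comp hB.tendsto_Q).mul_const C
  refine squeeze_zero_norm' ?_ hQ
  filter_upwards [hS] with k hk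
  have hQk := hB.pos k
  simp only [Function.comp, scaledV]
  rw [inner_smul_left, inner_rotGen, Real.norm_eq_abs, abs_mul]
  simp only [conj_trivial, abs_of_pos (inv_pos.2 hQk)]
  gcongr
  exact hC _ hk.1 _ (unscaleT_mem hQk (hB.mem_time k).2 hk.2).2

/-- By axial symmetry the angular derivative of the velocity is of lower order after rescaling. -/
lemma IsFieldLimit.dx_rotGen_eq_zero (hR : 0 < R) (hT : 0 < T₀)
    (hv : IsASESolution R a b T₀ v p)
    (h0 : 0 < α) (h1 : α < 1) (hγ : 0 < γ) (hB : IsBlowUpSequence R T₀ v xs x t Q)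
    (hX : IsLimitDomain (sideDist R α x Q) (eR xs) X)
    (h : IsFieldLimit R α γ v p x t Q X w q) {y : E 3} (hy : y ∈ X) {s : ℝ} (hs : s ≤ 0) :
    dx X w y s (rotGen xs) = 0 := by
  have cdx := h.conv_dx.continuousOn hγ
  refine eq_zero_on_limitDomain h0 h1 hB hX (f := fun z => dx X w z.1 z.2 (rotGen xs))
    (cdx.clm_apply continuousOn_const) (fun y hy hyk s hs => ?_) hy hs
  have hS := eventually_mem_domain hT h0 hB hyk hs
  have hz : (y, s) ∈ X ×ˢ Iic (0 : ℝ) := ⟨hy, hs⟩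
  have hun := hB.tendsto_unscaleX h0 h1 (tendsto_const_nhds (x := y))
  have hlim := tendsto_clm_apply (h.conv_dx.tendsto hz hS) ((rotGen.continuous.tendsto xs).comp hun)
  have hlim2 := (hB.tendsto_lenScale h0 h1).smul
    ((rotGen.continuous.tendsto _).comp (h.conv.tendsto hz hS))
  rw [zero_smul] at hlim2
  refine tendsto_nhds_unique hlim (hlim2.congr' ?_)
  have hrad := (continuous_radius.tendsto xs).comp hun
  filter_upwards [hS, hrad.eventually (lt_mem_nhds hB.radius_pos)] with k hk hrk
  exact (dx_scaledV_rotGen hR h0.ne' (hB.pos k) hv hk.1 hrk.ne'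
    (unscaleT_mem (hB.pos k) (hB.mem_time k).2 hk.2).2).symm

lemma tendsto_eR {f : ℕ → E 3} (hxs : 0 < radius xs) (hf : Tendsto f atTop (𝓝 xs)) :
    Tendsto (fun k => eR (f k)) atTop (𝓝 (eR xs)) := by
  have h1 := ((continuous_radius.tendsto xs).comp hf).inv₀ hxs.ne'
  have h2 : ∀ y : E 3, eR y = (radius y)⁻¹ • (y - y 2 • e3) := by
    intro y; apply E3_ext <;> simp [div_eq_inv_mul]
  simp only [h2]
  exact h1.smul (hf.sub ((((coordL 2).continuous.tendsto xs).comp hf).smul_const e3))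

/-- Moving a point radially by `s` changes its distance to the axis by `s`. -/
lemma radius_add_smul_eR (y : E 3) (hy : radius y ≠ 0) {s : ℝ} (hs : 0 ≤ radius y + s) :
    radius (y + s • eR y) = radius y + s := by
  have h1 : radius (y + s • eR y) ^ 2 = (radius y + s) ^ 2 := by
    rw [radius_sq]
    have h := radius_sq y
    simp
    field_simp
    linear_combination (-(radius y + s) ^ 2) * h
  exact (sq_eq_sq₀ (radius_nonneg _) hs).1 h1

lemma eR_add_smul_eR (y : E 3) (hy : radius y ≠ 0) {s : ℝ} (hs : 0 < radius y + s) :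
    eR (y + s • eR y) = eR y := by
  apply E3_ext
  · simp [radius_add_smul_eR y hy hs.le]; field_simp
  · simp [radius_add_smul_eR y hy hs.le]; field_simp
  · simp

/-- The rescaled point `y` moved radially onto the side of the cylinder. -/
def sidePoint (R α Q : ℝ) (x₀ y : E 3) : E 3 :=
  y + ((R - radius (unscaleX α Q x₀ y)) / lenScale α Q) • eR (unscaleX α Q x₀ y)

lemma unscaleX_sidePoint {Q : ℝ} (hQ : 0 < Q) (x₀ y : E 3) :
    unscaleX α Q x₀ (sidePoint R α Q x₀ y) = unscaleX α Q x₀ y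
      + (R - radius (unscaleX α Q x₀ y)) • eR (unscaleX α Q x₀ y) := by
  have := (lenScale_pos (α := α) hQ).ne'
  rw [unscaleX_eq, sidePoint, smul_add, smul_smul, mul_div_cancel₀ _ this, unscaleX_eq]
  module

/-- No penetration passes to the limit. Since the rescaled side is not contained in the limit
domain, values at the side and values in the limit domain are compared by means of the uniform
Hölder bounds. -/
lemma IsFieldLimit.no_penetration (hR : 0 < R) (hT : 0 < T₀)
    (hv : IsASESolution R a b T₀ v p)
    (h0 : 0 < α) (h1 : α < 1) (hγ : 0 < γ) (hB : IsBlowUpSequence R T₀ v xs x t Q)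
    {c : ℝ} (hc : 0 ≤ c) (hd : Tendsto (sideDist R α x Q) atTop (𝓝 c))
    (hH : EventuallyHolder R α γ v x t Q)
    (h : IsFieldLimit R α γ v p x t Q {y | inner ℝ y (eR xs) ≤ c} w q)
    {y : E 3} (hy : inner ℝ y (eR xs) = c) {s : ℝ} (hs : s ≤ 0) :
    inner ℝ (w y s) (eR xs) = 0 := by
  set X : Set (E 3) := {y | inner ℝ y (eR xs) ≤ c} with hXdef
  have hX : IsLimitDomain (sideDist R α x Q) (eR xs) X := Or.inr ⟨c, hc, hd, rfl⟩
  have hyX : y ∈ X := le_of_eq hy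
  have hrs := hB.radius_pos
  have hε : ∀ k, 0 < lenScale α (Q k) := fun k => lenScale_pos (hB.pos k)
  have hun := hB.tendsto_unscaleX h0 h1 (tendsto_const_nhds (x := y))
  have heR := tendsto_eR hrs hun
  -- the boundary points converge to `y`
  have hgap : Tendsto (fun k => (R - radius (unscaleX α (Q k) (x k) y)) / lenScale α (Q k))
      atTop (𝓝 0) := by
    have h2 := (tendsto_gap hB.tendsto_space hε (hB.tendsto_lenScale h0 h1) hrs hd y).comp
      (tendsto_id.prodMk (tendsto_const_nhds (x := y)))
    rw [hy, sub_self] at h2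
    exact h2
  have hbd : Tendsto (fun k => sidePoint R α (Q k) (x k) y) atTop (𝓝 y) := by
    have h2 := (hgap.smul heR).const_add y
    rw [zero_smul, add_zero] at h2
    exact h2
  have hrad := (continuous_radius.tendsto xs).comp hun
  obtain ⟨C, hC⟩ := hH (Metric.closedBall y 2 ×ˢ {s})
    ((isCompact_closedBall y 2).prod isCompact_singleton)
  have key : ∀ δ ∈ Ioo (0 : ℝ) 1, |inner ℝ (w (y - δ • eR xs) s) (eR xs)| ≤ C * δ ^ γ := by
    intro δ hδ
    obtain ⟨hyδ, hyk⟩ := hX.eventually_mem hB.tendsto_space hε (hB.tendsto_lenScale h0 h1) hrs hyX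
      hδ.1
    have hS := eventually_mem_domain hT h0 hB hyk hs
    have hδn : ‖δ • eR xs‖ = δ := by
      rw [norm_smul, norm_eR hrs.ne', Real.norm_eq_abs, abs_of_pos hδ.1, mul_one]
    have hlim := ((h.conv.tendsto (show (y - δ • eR xs, s) ∈ X ×ˢ Iic (0 : ℝ) from ⟨hyδ, hs⟩)
      hS).inner (𝕜 := ℝ) heR).abs
    have hlim2 : Tendsto (fun k => C * ‖y - δ • eR xs - sidePoint R α (Q k) (x k) y‖ ^ γ) atTop
        (𝓝 (C * δ ^ γ)) := by
      have h2 := ((tendsto_const_nhds (x := y - δ • eR xs)).sub hbd).norm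
      rw [sub_sub_cancel_left, norm_neg, hδn] at h2
      exact (h2.rpow_const (Or.inr hγ.le)).const_mul C
    refine le_of_tendsto_of_tendsto hlim hlim2 ?_
    filter_upwards [hC, hS, hrad.eventually (lt_mem_nhds hrs),
      hbd.eventually (Metric.closedBall_mem_nhds y two_pos)] with k hCk hSk hrk hbk
    have hrk : 0 < radius (unscaleX α (Q k) (x k) y) := hrk
    have hside := unscaleX_sidePoint (R := R) (α := α) (hB.pos k) (x k) y
    have hradside : radius (unscaleX α (Q k) (x k) (sidePoint R α (Q k) (x k) y)) = R := by
      rw [hside, radius_add_smul_eR _ hrk.ne' (by linarith)]; ring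
    have hmem : sidePoint R α (Q k) (x k) y ∈ scaledX R α (Q k) (x k) := hradside.le
    have hpen := hv.no_penetration _ hradside _
      (unscaleT_mem (hB.pos k) (hB.mem_time k).2 hSk.2).2
    rw [hside, eR_add_smul_eR _ hrk.ne' (by linarith), ← hside] at hpen
    have hpen2 : inner ℝ (scaledV α (Q k) (x k) (t k) v (sidePoint R α (Q k) (x k) y) s)
        (eR (unscaleX α (Q k) (x k) y)) = 0 := by
      rw [scaledV, inner_smul_left, hpen, mul_zero]
    have hyball : y - δ • eR xs ∈ Metric.closedBall y 2 := by
      rw [mem_closedBall_iff_norm, sub_sub_cancel_left, norm_neg, hδn]; linarith [hδ.2]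
    have h3 := hCk.2 (y - δ • eR xs, s) ⟨⟨hyball, rfl⟩, hSk⟩
      (sidePoint R α (Q k) (x k) y, s) ⟨⟨hbk, rfl⟩, hmem, hSk.2⟩
    simp only [sub_self, abs_zero, Real.sqrt_zero, add_zero] at h3
    refine le_trans ?_ h3
    have h4 := abs_real_inner_le_norm (scaledV α (Q k) (x k) (t k) v (y - δ • eR xs) s
      - scaledV α (Q k) (x k) (t k) v (sidePoint R α (Q k) (x k) y) s)
      (eR (unscaleX α (Q k) (x k) y))
    rw [norm_eR hrk.ne', mul_one, inner_sub_left, hpen2, sub_zero] at h4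
    exact h4
  have hcont := h.conv.continuousOn hγ (y, s) ⟨hyX, hs⟩
  have hpath : Tendsto (fun δ : ℝ => (y - δ • eR xs, s)) (𝓝[>] 0) (𝓝[X ×ˢ Iic 0] (y, s)) := by
    refine tendsto_nhdsWithin_iff.2 ⟨?_, ?_⟩
    · have hc2 : Continuous fun δ : ℝ => (y - δ • eR xs, s) := by fun_prop
      have := hc2.tendsto 0
      simp only [zero_smul, sub_zero] at this
      exact this.mono_left nhdsWithin_le_nhds
    · filter_upwards [self_mem_nhdsWithin] with δ hδ
      exact ⟨(hX.eventually_mem hB.tendsto_space hε (hB.tendsto_lenScale h0 h1) hrs hyX hδ).1, hs⟩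
  have hl := ((hcont.tendsto.comp hpath).inner (𝕜 := ℝ) (tendsto_const_nhds (x := eR xs))).abs
  have hr : Tendsto (fun δ : ℝ => C * δ ^ γ) (𝓝[>] 0) (𝓝 0) := by
    have hc2 : Continuous fun δ : ℝ => C * δ ^ γ :=
      continuous_const.mul (continuous_id.rpow_const fun _ => Or.inr hγ.le)
    have := hc2.tendsto 0
    rw [Real.zero_rpow hγ.ne', mul_zero] at this
    exact this.mono_left nhdsWithin_le_nhds
  have hfin := le_of_tendsto_of_tendsto hl hr (by
    filter_upwards [Ioo_mem_nhdsGT one_pos] with δ hδ using key δ hδ)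
  exact abs_nonpos_iff.1 hfin

/-- The limit is nontrivial, because the rescaled velocities at the centre are bounded below. -/
lemma IsFieldLimit.ne_zero (hT : 0 < T₀) (h0 : 0 < α) (hB : IsBlowUpSequence R T₀ v xs x t Q)
    (hX : IsLimitDomain (sideDist R α x Q) (eR xs) X)
    (h : IsFieldLimit R α γ v p x t Q X w q) : w 0 0 ≠ 0 := by
  have hmem : ∀ k, (0 : E 3) ∈ scaledX R α (Q k) (x k) := fun k => by
    show unscaleX α (Q k) (x k) 0 ∈ pipe R
    simpa [unscaleX_eq] using hB.mem_space k
  have hS := eventually_mem_domain hT h0 hB (Eventually.of_forall hmem) le_rfl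
  have hlim := (h.conv.tendsto (show ((0 : E 3), (0 : ℝ)) ∈ X ×ˢ Iic (0 : ℝ) from
    ⟨hX.zero_mem, self_mem_Iic⟩) hS).norm
  obtain ⟨c, hc, hk⟩ := hB.comparable
  have hcpos : 0 < c := by linarith
  have hge : c⁻¹ ≤ ‖w 0 0‖ := by
    refine ge_of_tendsto' hlim fun k => ?_
    have hQ := hB.pos k
    simp only [scaledV, unscaleX_eq, unscaleT_eq, smul_zero, mul_zero, zero_add, norm_smul,
      norm_inv, Real.norm_eq_abs, abs_of_pos hQ]
    rw [inv_mul_eq_div, le_div_iff₀ hQ, inv_mul_le_iff₀ hcpos]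
    exact (hk k).2
  intro h2
  rw [h2, norm_zero] at hge
  exact absurd hge (not_le.2 (inv_pos.2 hcpos))

/-- Near maximal points give a bounded limit: the rescaled velocities are uniformly bounded. -/
lemma IsFieldLimit.bounded (hT : 0 < T₀) (h0 : 0 < α) (h1 : α < 1) (hγ : 0 < γ)
    (hB : IsBlowUpSequence R T₀ v xs x t Q)
    (hX : IsLimitDomain (sideDist R α x Q) (eR xs) X)
    (h : IsFieldLimit R α γ v p x t Q X w q) (hN : IsNearMaximal R v x t) :
    IsBoundedField X w := by
  obtain ⟨c', hc', hmax⟩ := hN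
  obtain ⟨c, hc, hk⟩ := hB.comparable
  have hcpos : 0 < c := by linarith
  refine ⟨c'⁻¹ * c, fun y hy s hs => ?_⟩
  have hcont := (h.conv.continuousOn hγ).norm
  have key : ∀ y ∈ X, (∀ᶠ k in atTop, y ∈ scaledX R α (Q k) (x k)) → ∀ s ≤ 0,
      ‖w y s‖ ≤ c'⁻¹ * c := by
    intro y hy hyk s hs
    have hS := eventually_mem_domain hT h0 hB hyk hs
    refine le_of_tendsto
      (h.conv.tendsto (show (y, s) ∈ X ×ˢ Iic (0 : ℝ) from ⟨hy, hs⟩) hS).norm ?_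
    filter_upwards [hS] with k hkS
    have hQ := hB.pos k
    simp only [scaledV, norm_smul, norm_inv, Real.norm_eq_abs, abs_of_pos hQ]
    have h2 := hmax k _ hkS.1 _ (unscaleT_mem hQ (hB.mem_time k).2 hkS.2).1
    have h3 := (hk k).1
    rw [inv_mul_le_iff₀ hcpos] at h3
    rw [inv_mul_eq_div, div_le_iff₀ hQ, mul_assoc, le_inv_mul_iff₀ hc']
    linarith
  -- the excess over the bound vanishes on a dense set
  have h4 := eq_zero_on_limitDomain h0 h1 hB hX
    (f := fun z => max (‖w z.1 z.2‖ - c'⁻¹ * c) 0)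
    ((hcont.sub continuousOn_const).sup continuousOn_const)
    (fun y hy hyk s hs => max_eq_right (by linarith [key y hy hyk s hs])) hy hs
  have h5 := le_max_left (‖w y s‖ - c'⁻¹ * c) 0
  simp only at h4
  linarith

/-- Limits of the rescaled fields are two-dimensional ancient solutions. Of the smoothness of the
sequence only eventual Hölder bounds for the velocities enter, through the boundary condition. -/
theorem IsFieldLimit.isPlanar (hR : 0 < R) (hab : a < b) (hT : 0 < T₀)
    (hv : IsASESolution R a b T₀ v p)
    (h0 : 0 < α) (h1 : α < 1) (hγ : 0 < γ) (hB : IsBlowUpSequence R T₀ v xs x t Q)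
    (hX : IsLimitDomain (sideDist R α x Q) (eR xs) X)
    (hH : EventuallyHolder R α γ v x t Q)
    (h : IsFieldLimit R α γ v p x t Q X w q) :
    IsPlanarAncientSolution (eR xs) X w q := by
  have hrs := hB.radius_pos
  have hrot : rotGen (eR xs) = (radius xs)⁻¹ • rotGen xs := by
    apply E3_ext <;> simp <;> field_simp
  have hζ : (eR xs 0) ^ 2 + (eR xs 1) ^ 2 = 1 := by
    have := inner_eR_self hrs.ne'
    rw [inner_E3] at this
    simp only [eR_two, mul_zero, add_zero] at this
    linarith
  have hζ0 : eR xs ≠ 0 := by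
    intro h2; have := norm_eR hrs.ne'; rw [h2] at this; simp at this
  have hw : ∀ y ∈ X, ∀ s ≤ 0, inner ℝ (w y s) (rotGen (eR xs)) = 0 := fun y hy s hs => by
    rw [hrot, inner_smul_right, h.inner_rotGen_eq_zero hR hab hT hv h0 h1 hγ hB hX hy hs, mul_zero]
  have hD : ∀ y ∈ X, ∀ s ≤ 0, dx X w y s (rotGen (eR xs)) = 0 := fun y hy s hs => by
    rw [hrot, map_smul, h.dx_rotGen_eq_zero hR hT hv h0 h1 hγ hB hX hy hs, smul_zero]
  have hE := h.isEulerSolution hR hT hv h0 h1 hγ hB hX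
  have hne : ∃ y ∈ X, ∃ s ≤ 0, w y s ≠ 0 := ⟨0, hX.zero_mem, 0, le_rfl, h.ne_zero hT h0 hB hX⟩
  have hXu := hX.uniqueDiffOn hζ0
  rcases hX with ⟨-, rfl⟩ | ⟨c, hc, hd, rfl⟩
  · exact isPlanarAncientSolution_of_invariant (c := 0) (eR_two xs) hζ hXu le_rfl
      (Or.inl ⟨rfl, rfl⟩) hE hw hD hne
  · exact isPlanarAncientSolution_of_invariant (c := c) (eR_two xs) hζ hXu hc
      (Or.inr ⟨rfl, rfl, fun y hy s hs => h.no_penetration hR hT hv h0 h1 hγ hB hc hd hH hy hs⟩)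
      hE hw hD hne

/-- The rescaled cylinders converge along a subsequence. -/
lemma exists_limitDomain (hB : IsBlowUpSequence R T₀ v xs x t Q) :
    ∃ ψ : ℕ → ℕ, StrictMono ψ ∧ ∃ X, IsLimitDomain (sideDist R α (x ∘ ψ) (Q ∘ ψ)) (eR xs) X := by
  obtain ⟨ψ, hψ, h⟩ := exists_subseq_tendsto_or_atTop (sideDist R α x Q) fun k =>
    div_nonneg (sub_nonneg.2 (hB.mem_space k)) (lenScale_pos (hB.pos k)).le
  refine ⟨ψ, hψ, ?_⟩
  rcases h with h | ⟨c, hc, h⟩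
  · exact ⟨univ, Or.inl ⟨h, rfl⟩⟩
  · exact ⟨_, Or.inr ⟨c, hc, h, rfl⟩⟩

lemma IsLimitDomain.setsConverge_scaledX (h0 : 0 < α) (h1 : α < 1)
    (hB : IsBlowUpSequence R T₀ v xs x t Q)
    (hX : IsLimitDomain (sideDist R α x Q) (eR xs) X) :
    SetsConverge (fun k => scaledX R α (Q k) (x k)) X :=
  hX.setsConverge hB.tendsto_space (fun k => lenScale_pos (hB.pos k))
    (hB.tendsto_lenScale h0 h1) hB.radius_pos

/-- The domain of a local limit is, by uniqueness of Kuratowski limits, the one that a further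
subsequence has by compactness; the structure of the limit then follows. -/
theorem IsLocalLimit.isPlanar (hR : 0 < R) (hab : a < b) (hT : 0 < T₀)
    (hv : IsASESolution R a b T₀ v p)
    (h0 : 0 < α) (h1 : α < 1) (hγ : 0 < γ) (hB : IsBlowUpSequence R T₀ v xs x t Q)
    (hH : LocallyBoundedC21 R α γ v x t Q)
    (h : IsLocalLimit R α γ v p x t Q X w q) :
    IsPlanarAncientSolution (eR xs) X w q ∧ (IsNearMaximal R v x t → IsBoundedField X w) := by
  obtain ⟨d1, d2, d3, φ, hφ, hconv, c1, c2, c3, c4⟩ := h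
  have hL : IsFieldLimit R α γ v p (x ∘ φ) (t ∘ φ) (Q ∘ φ) X w q := ⟨d1, d2, d3, c1, c2, c3, c4⟩
  obtain ⟨ψ, hψ, X', hX'⟩ := exists_limitDomain (α := α) (hB.comp hφ)
  have hB' := (hB.comp hφ).comp hψ
  have hXX : X = X' := (hconv.comp hψ).unique (hX'.setsConverge_scaledX h0 h1 hB')
  subst hXX
  have hL' := hL.comp hψ
  refine ⟨hL'.isPlanar hR hab hT hv h0 h1 hγ hB' hX' fun K hK => ?_, fun hN =>
    hL'.bounded hT h0 h1 hγ hB' hX' ((hN.comp φ).comp ψ)⟩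
  obtain ⟨C, hC⟩ := hH K hK
  exact ⟨C, Eventually.of_forall fun k => (hC (φ (ψ k))).1⟩

end Limit

/-! ### Self-similar fields with slowly varying profile -/

section SelfSimilar

variable {G : Type*} [NormedAddCommGroup G] [NormedSpace ℝ G] {T₀ α β B θ κ : ℝ}
  {Ψ : E 3 → G}

/-- Bounded profiles whose gradient decays at least like `1 / |y|`. -/
structure SlowlyVarying (Ψ : E 3 → G) (B : ℝ) : Prop where
  diff : Differentiable ℝ Ψ
  bound : ∀ y, ‖Ψ y‖ ≤ B
  decay : ∀ y, ‖y‖ * ‖fderiv ℝ Ψ y‖ ≤ B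

/-- The self-similar field `(T₀-t)^{-β} Ψ(x / (T₀-t)^{1-α})`. -/
def selfSim (T₀ α β : ℝ) (Ψ : E 3 → G) (x : E 3) (t : ℝ) : G :=
  ((T₀ - t) ^ β)⁻¹ • Ψ (((T₀ - t) ^ (1 - α))⁻¹ • x)

/-- The profile of the time derivative of a self-similar field. -/
def timeProfile (α β : ℝ) (Ψ : E 3 → G) (y : E 3) : G := β • Ψ y + (1 - α) • fderiv ℝ Ψ y y

lemma SlowlyVarying.nonneg (h : SlowlyVarying Ψ B) : 0 ≤ B := (norm_nonneg _).trans (h.bound 0)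

lemma SlowlyVarying.norm_timeProfile_le (h : SlowlyVarying Ψ B) (hβ : 0 ≤ β) (h0 : 0 ≤ α)
    (h1 : α ≤ 1) (y : E 3) : ‖timeProfile α β Ψ y‖ ≤ (β + 1) * B := by
  have h2 : ‖fderiv ℝ Ψ y y‖ ≤ B := by
    refine ((fderiv ℝ Ψ y).le_opNorm y).trans ?_
    rw [mul_comm]; exact h.decay y
  refine (norm_add_le _ _).trans ?_
  rw [norm_smul, norm_smul, Real.norm_of_nonneg hβ, Real.norm_of_nonneg (by linarith : 0 ≤ 1 - α)]
  have h3 := mul_le_mul_of_nonneg_left (h.bound y) hβ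
  have h4 := mul_le_mul_of_nonneg_left h2 (by linarith : 0 ≤ 1 - α)
  have h5 := mul_nonneg h0 h.nonneg
  linarith

lemma hasDerivAt_inv_rpow {t : ℝ} (ht : t < T₀) (β : ℝ) :
    HasDerivAt (fun t => ((T₀ - t) ^ β)⁻¹) (β * ((T₀ - t) ^ (β + 1))⁻¹) t := by
  have hp : 0 < T₀ - t := by linarith
  have h1 : HasDerivAt (fun t => T₀ - t) (-1) t := by
    simpa using (hasDerivAt_id t).const_sub T₀
  have h2 := h1.rpow_const (p := -β) (Or.inl hp.ne')
  have h3 : (fun t => ((T₀ - t) ^ β)⁻¹) =ᶠ[𝓝 t] fun t => (T₀ - t) ^ (-β) := by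
    filter_upwards [gt_mem_nhds ht] with s hs
    rw [Real.rpow_neg (by linarith)]
  refine (h2.congr_of_eventuallyEq h3).congr_deriv ?_
  rw [← Real.rpow_neg hp.le, show -(β + 1) = -β - 1 by ring]; ring

/-- The time derivative of a self-similar field is self-similar, with exponent `β + 1`. -/
lemma hasDerivAt_selfSim (hΨ : Differentiable ℝ Ψ) (x : E 3) {t : ℝ} (ht : t < T₀) :
    HasDerivAt (fun t => selfSim T₀ α β Ψ x t)
      (selfSim T₀ α (β + 1) (timeProfile α β Ψ) x t) t := by
  have hp : 0 < T₀ - t := by linarith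
  have h1 := hasDerivAt_inv_rpow ht β
  have h2 := (hasDerivAt_inv_rpow ht (1 - α)).smul_const x
  have h3 := (hΨ (((T₀ - t) ^ (1 - α))⁻¹ • x)).hasFDerivAt.comp_hasDerivAt t h2
  refine (h1.smul h3).congr_deriv ?_
  simp only [selfSim, timeProfile, map_smul, smul_add, smul_smul]
  rw [Real.rpow_add hp, Real.rpow_add hp, Real.rpow_one]
  rw [add_comm]
  congr 2 <;> (field_simp)

/-- The spatial derivative of a self-similar field is self-similar, with exponent `β + 1 - α`. -/
lemma hasFDerivAt_selfSim (hΨ : Differentiable ℝ Ψ) (x : E 3) {t : ℝ} (ht : t < T₀) :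
    HasFDerivAt (fun x => selfSim T₀ α β Ψ x t)
      (selfSim T₀ α (β + (1 - α)) (fderiv ℝ Ψ) x t) x := by
  have hp : 0 < T₀ - t := by linarith
  have h2 := (hasFDerivAt_id (𝕜 := ℝ) x).const_smul ((T₀ - t) ^ (1 - α))⁻¹
  have h3 := ((hΨ (((T₀ - t) ^ (1 - α))⁻¹ • x)).hasFDerivAt.comp x h2).const_smul
    ((T₀ - t) ^ β)⁻¹
  refine h3.congr_fderiv ?_
  ext d
  simp only [selfSim]
  rw [Real.rpow_add hp]
  simp [smul_smul]
  ring_nf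

lemma rpow_mul_inv_le {u : ℝ} (hθ : 0 < θ) (hu : 0 < u) (hκ : θ ≤ κ * u) (hβ : 0 ≤ β) :
    θ ^ β * (u ^ β)⁻¹ ≤ κ ^ β := by
  have hκ0 : 0 ≤ κ := by
    by_contra hneg
    nlinarith [not_le.1 hneg]
  rw [mul_inv_le_iff₀ (Real.rpow_pos_of_pos hu β), ← Real.mul_rpow hκ0 hu.le]
  exact Real.rpow_le_rpow hθ.le hκ hβ

lemma norm_selfSim_le (hΨ : ∀ y, ‖Ψ y‖ ≤ B) (hβ : 0 ≤ β) (hθ : 0 < θ) {t : ℝ} (ht : t < T₀)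
    (hκ : θ ≤ κ * (T₀ - t)) (x : E 3) :
    θ ^ β * ‖selfSim T₀ α β Ψ x t‖ ≤ κ ^ β * B := by
  have hp : 0 < T₀ - t := by linarith
  rw [selfSim, norm_smul, norm_inv, Real.norm_of_nonneg (Real.rpow_nonneg hp.le _), ← mul_assoc]
  exact mul_le_mul (rpow_mul_inv_le hθ hp hκ hβ) (hΨ _) (norm_nonneg _)
    ((mul_nonneg (by positivity) (by positivity)).trans (rpow_mul_inv_le hθ hp hκ hβ))

/-- A self-similar field is Lipschitz in time with respect to a time scale `θ` that is at most
comparable to the time to blow-up. -/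
lemma norm_selfSim_sub_time_le (hΨ : SlowlyVarying Ψ B) (hβ : 0 ≤ β) (h0 : 0 ≤ α) (h1 : α ≤ 1)
    (hθ : 0 < θ) {t₁ : ℝ} (ht₁ : t₁ < T₀) (hκ : θ ≤ κ * (T₀ - t₁)) (x : E 3) {t t' : ℝ}
    (ht : t ≤ t₁) (ht' : t' ≤ t₁) :
    θ ^ β * ‖selfSim T₀ α β Ψ x t - selfSim T₀ α β Ψ x t'‖
      ≤ κ ^ (β + 1) * ((β + 1) * B) * (|t - t'| / θ) := by
  have hκ0 : 0 ≤ κ := by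
    by_contra hneg
    nlinarith [not_le.1 hneg]
  have hb : ∀ s ∈ Iic t₁, ‖selfSim T₀ α (β + 1) (timeProfile α β Ψ) x s‖
      ≤ κ ^ (β + 1) * ((β + 1) * B) / θ ^ (β + 1) := by
    intro s hs
    have hs : s ≤ t₁ := hs
    rw [le_div_iff₀ (Real.rpow_pos_of_pos hθ _), mul_comm]
    exact norm_selfSim_le (hΨ.norm_timeProfile_le hβ h0 h1) (by linarith) hθ (by linarith)
      (hκ.trans (mul_le_mul_of_nonneg_left (by linarith) hκ0)) x
  have h2 := (convex_Iic t₁).norm_image_sub_le_of_norm_hasDerivWithin_le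
    (fun s hs => (hasDerivAt_selfSim (α := α) (β := β) hΨ.diff x
      ((mem_Iic.1 hs).trans_lt ht₁)).hasDerivWithinAt) hb (mem_Iic.2 ht') (mem_Iic.2 ht)
  rw [Real.norm_eq_abs] at h2
  refine (mul_le_mul_of_nonneg_left h2 (Real.rpow_nonneg hθ.le β)).trans (le_of_eq ?_)
  rw [Real.rpow_add hθ, Real.rpow_one]
  have := (Real.rpow_pos_of_pos hθ β).ne'
  field_simp

/-- Away from the origin a self-similar field with slowly varying profile is Lipschitz in space,
with a constant that is of the order of its size: this is where `|y| |∇Ψ(y)| ≤ B` enters. -/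
lemma norm_selfSim_sub_space_le (hΨ : SlowlyVarying Ψ B) (hβ : 0 ≤ β)
    (hθ : 0 < θ) {t : ℝ} (ht : t < T₀) (hκ : θ ≤ κ * (T₀ - t)) {ρ : ℝ} (hρ : 0 < ρ) {x x' : E 3}
    (hseg : ∀ z ∈ segment ℝ x' x, ρ ≤ ‖z‖) :
    θ ^ β * ‖selfSim T₀ α β Ψ x t - selfSim T₀ α β Ψ x' t‖ ≤ κ ^ β * B / ρ * ‖x - x'‖ := by
  have hp : 0 < T₀ - t := by linarith
  have hb : ∀ z ∈ segment ℝ x' x, ‖selfSim T₀ α (β + (1 - α)) (fderiv ℝ Ψ) z t‖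
      ≤ ((T₀ - t) ^ β)⁻¹ * B / ρ := by
    intro z hz
    have h1 := hΨ.decay (((T₀ - t) ^ (1 - α))⁻¹ • z)
    have hpos := Real.rpow_pos_of_pos hp (1 - α)
    have hposβ := Real.rpow_pos_of_pos hp β
    rw [norm_smul, norm_inv, Real.norm_of_nonneg hpos.le] at h1
    rw [selfSim, norm_smul, norm_inv, Real.norm_of_nonneg (Real.rpow_nonneg hp.le _),
      Real.rpow_add hp, mul_inv, mul_div_assoc, mul_assoc]
    refine mul_le_mul_of_nonneg_left ?_ (by positivity)
    rw [le_div_iff₀ hρ]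
    calc ((T₀ - t) ^ (1 - α))⁻¹ * ‖fderiv ℝ Ψ (((T₀ - t) ^ (1 - α))⁻¹ • z)‖ * ρ
        ≤ ((T₀ - t) ^ (1 - α))⁻¹ * ‖fderiv ℝ Ψ (((T₀ - t) ^ (1 - α))⁻¹ • z)‖ * ‖z‖ :=
          mul_le_mul_of_nonneg_left (hseg z hz) (by positivity)
      _ ≤ B := by linarith
  have h2 := (convex_segment x' x).norm_image_sub_le_of_norm_hasFDerivWithin_le
    (fun z _ => (hasFDerivAt_selfSim (α := α) (β := β) hΨ.diff z ht).hasFDerivWithinAt) hb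
    (left_mem_segment ℝ x' x) (right_mem_segment ℝ x' x)
  refine (mul_le_mul_of_nonneg_left h2 (Real.rpow_nonneg hθ.le β)).trans ?_
  rw [← mul_assoc]
  refine mul_le_mul_of_nonneg_right ?_ (norm_nonneg _)
  rw [← mul_div_assoc, ← mul_assoc]
  gcongr
  · exact hΨ.nonneg
  · exact rpow_mul_inv_le hθ hp hκ hβ

/-- Decay of the profile at distance at least `ρ` from the origin. -/
lemma norm_selfSim_le_of_decay {ρ : ℝ} (hΨ : ∀ y, ‖y‖ * ‖Ψ y‖ ≤ B) (hα : 0 ≤ α) (hθ : 0 < θ)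
    {t : ℝ} (ht : t < T₀) (hκ : θ ≤ κ * (T₀ - t)) (hρ : 0 < ρ) {x : E 3} (hx : ρ ≤ ‖x‖) :
    θ * ‖selfSim T₀ α 1 Ψ x t‖ ≤ θ ^ (1 - α) * (κ ^ α * B / ρ) := by
  have hp : 0 < T₀ - t := by linarith
  have h1 := hΨ (((T₀ - t) ^ (1 - α))⁻¹ • x)
  have hpos := Real.rpow_pos_of_pos hp (1 - α)
  have hposα := Real.rpow_pos_of_pos hp α
  have hB : 0 ≤ B := (mul_nonneg (norm_nonneg _) (norm_nonneg _)).trans (hΨ 0)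
  rw [norm_smul, norm_inv, Real.norm_of_nonneg hpos.le] at h1
  have h2 : ((T₀ - t) ^ (1 - α))⁻¹ * ‖Ψ (((T₀ - t) ^ (1 - α))⁻¹ • x)‖ ≤ B / ρ := by
    rw [le_div_iff₀ hρ]
    calc ((T₀ - t) ^ (1 - α))⁻¹ * ‖Ψ (((T₀ - t) ^ (1 - α))⁻¹ • x)‖ * ρ
        ≤ ((T₀ - t) ^ (1 - α))⁻¹ * ‖Ψ (((T₀ - t) ^ (1 - α))⁻¹ • x)‖ * ‖x‖ :=
          mul_le_mul_of_nonneg_left hx (by positivity)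
      _ ≤ B := by linarith
  have h3 := rpow_mul_inv_le hθ hp hκ hα
  have h4 : ((T₀ - t) ^ (1 : ℝ))⁻¹ = ((T₀ - t) ^ α)⁻¹ * ((T₀ - t) ^ (1 - α))⁻¹ := by
    rw [← mul_inv, ← Real.rpow_add hp]; congr 2; ring
  have h5 : θ = θ ^ (1 - α) * θ ^ α := by
    rw [← Real.rpow_add hθ]; simp
  rw [selfSim, norm_smul, norm_inv, Real.norm_of_nonneg (Real.rpow_nonneg hp.le _), h4]
  calc θ * (((T₀ - t) ^ α)⁻¹ * ((T₀ - t) ^ (1 - α))⁻¹ * ‖Ψ (((T₀ - t) ^ (1 - α))⁻¹ • x)‖)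
      = θ ^ (1 - α) * ((θ ^ α * ((T₀ - t) ^ α)⁻¹) *
        (((T₀ - t) ^ (1 - α))⁻¹ * ‖Ψ (((T₀ - t) ^ (1 - α))⁻¹ • x)‖)) := by
        nth_rewrite 1 [h5]; ring
    _ ≤ θ ^ (1 - α) * (κ ^ α * (B / ρ)) := by
        refine mul_le_mul_of_nonneg_left ?_ (by positivity)
        exact mul_le_mul h3 h2 (by positivity) ((by positivity : (0:ℝ) ≤ _).trans h3)
    _ = _ := by ring

end SelfSimilar

section Error

variable {G : Type*} [NormedAddCommGroup G] [NormedSpace ℝ G] {T₀ α β γ C θ κ : ℝ}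
  {D : Set (E 3)} {H : E 3 → ℝ → G}

lemma norm_error_le (hH : ParabolicHolderLE γ (D ×ˢ Ico 0 T₀) H C) (hβ : 0 ≤ β) (hθ : 0 < θ)
    {t : ℝ} (ht : t ∈ Ico 0 T₀) (hκ : θ ≤ κ * (T₀ - t)) {x : E 3} (hx : x ∈ D) :
    θ ^ β * ‖((T₀ - t) ^ β)⁻¹ • H x t‖ ≤ κ ^ β * C := by
  have hp : 0 < T₀ - t := by linarith [ht.2]
  rw [norm_smul, norm_inv, Real.norm_of_nonneg (Real.rpow_nonneg hp.le _), ← mul_assoc]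
  have h1 := rpow_mul_inv_le hθ hp hκ hβ
  exact mul_le_mul h1 (hH.1 (x, t) ⟨hx, ht⟩) (norm_nonneg _)
    ((mul_nonneg (by positivity) (by positivity)).trans h1)

lemma norm_error_sub_space_le (hH : ParabolicHolderLE γ (D ×ˢ Ico 0 T₀) H C) (hβ : 0 ≤ β)
    (hθ : 0 < θ) {t : ℝ} (ht : t ∈ Ico 0 T₀) (hκ : θ ≤ κ * (T₀ - t)) {x x' : E 3} (hx : x ∈ D)
    (hx' : x' ∈ D) :
    θ ^ β * ‖((T₀ - t) ^ β)⁻¹ • H x t - ((T₀ - t) ^ β)⁻¹ • H x' t‖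
      ≤ κ ^ β * C * ‖x - x'‖ ^ γ := by
  have hp : 0 < T₀ - t := by linarith [ht.2]
  rw [← smul_sub, norm_smul, norm_inv, Real.norm_of_nonneg (Real.rpow_nonneg hp.le _), ← mul_assoc,
    mul_assoc _ C]
  have h1 := rpow_mul_inv_le hθ hp hκ hβ
  have h2 := hH.2 (x, t) ⟨hx, ht⟩ (x', t) ⟨hx', ht⟩
  simp only [sub_self, abs_zero, Real.sqrt_zero, add_zero] at h2
  exact mul_le_mul h1 h2 (norm_nonneg _) ((mul_nonneg (by positivity) (by positivity)).trans h1)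

lemma norm_error_sub_time_le (hγ : 0 < γ) (hH : ParabolicHolderLE γ (D ×ˢ Ico 0 T₀) H C)
    (hβ : 0 ≤ β) (hθ : 0 < θ) (hθ1 : θ ≤ 1) {t₁ : ℝ} (ht₁ : t₁ < T₀) (hκ : θ ≤ κ * (T₀ - t₁))
    {t t' : ℝ} (ht : t ∈ Icc 0 t₁) (ht' : t' ∈ Icc 0 t₁) {x : E 3} (hx : x ∈ D) :
    θ ^ β * ‖((T₀ - t) ^ β)⁻¹ • H x t - ((T₀ - t') ^ β)⁻¹ • H x t'‖
      ≤ κ ^ β * C * (|t - t'| / θ) ^ (γ / 2)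
        + κ ^ (β + 1) * (β + 1) * C * (|t - t'| / θ) := by
  have hκ0 : 0 ≤ κ := by
    by_contra hneg
    nlinarith [not_le.1 hneg]
  have hI : t ∈ Ico 0 T₀ := ⟨ht.1, ht.2.trans_lt ht₁⟩
  have hI' : t' ∈ Ico 0 T₀ := ⟨ht'.1, ht'.2.trans_lt ht₁⟩
  have hp : 0 < T₀ - t := by linarith [hI.2]
  have hC : 0 ≤ C := (norm_nonneg _).trans (hH.1 (x, t) ⟨hx, hI⟩)
  -- the scalar factor is itself a self-similar field with constant profile
  have h1 := norm_selfSim_sub_time_le (Ψ := fun _ : E 3 => (1 : ℝ)) (B := 1) (α := 0)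
    ⟨by fun_prop, by simp, by simp⟩ hβ le_rfl zero_le_one hθ ht₁ hκ 0 ht.2 ht'.2
  simp only [selfSim, smul_eq_mul, mul_one, Real.norm_eq_abs] at h1
  have h2 := hH.2 (x, t) ⟨hx, hI⟩ (x, t') ⟨hx, hI'⟩
  simp only [sub_self, norm_zero, zero_add] at h2
  have h3 : √|t - t'| ^ γ ≤ (|t - t'| / θ) ^ (γ / 2) := by
    rw [Real.sqrt_eq_rpow, ← Real.rpow_mul (abs_nonneg _), show 1 / 2 * γ = γ / 2 by ring]
    refine Real.rpow_le_rpow (abs_nonneg _) ?_ (by positivity)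
    rw [le_div_iff₀ hθ]
    exact mul_le_of_le_one_right (abs_nonneg _) hθ1
  have h4 := rpow_mul_inv_le hθ hp
    (hκ.trans (mul_le_mul_of_nonneg_left (by linarith [ht.2]) hκ0)) hβ
  have hsplit : ((T₀ - t) ^ β)⁻¹ • H x t - ((T₀ - t') ^ β)⁻¹ • H x t'
      = ((T₀ - t) ^ β)⁻¹ • (H x t - H x t')
        + (((T₀ - t) ^ β)⁻¹ - ((T₀ - t') ^ β)⁻¹) • H x t' := by
    rw [smul_sub, sub_smul]; abel
  rw [hsplit]
  refine (mul_le_mul_of_nonneg_left (norm_add_le _ _) (by positivity)).trans ?_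
  rw [mul_add, norm_smul, norm_smul, norm_inv, Real.norm_of_nonneg (Real.rpow_nonneg hp.le _),
    ← mul_assoc, ← mul_assoc, Real.norm_eq_abs]
  refine add_le_add ?_ ?_
  · rw [mul_assoc _ C]
    exact mul_le_mul h4 (h2.trans (mul_le_mul_of_nonneg_left h3 hC)) (norm_nonneg _)
      (by positivity)
  · calc _ ≤ κ ^ (β + 1) * (β + 1) * (|t - t'| / θ) * C :=
          mul_le_mul h1 (hH.1 (x, t') ⟨hx, hI'⟩) (norm_nonneg _) (by positivity)
      _ = _ := by ring

end Error

/-! ### Compactness and interpolation in Hölder spaces -/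

/-- Arzelà–Ascoli on the line, for a fixed modulus of continuity. -/
lemma exists_subseq_locallyUniform {ω : ℝ → ℝ} (hω : Continuous ω) (hω0 : ω 0 = 0)
    {C : ℝ} {f : ℕ → ℝ → E 3} (hb : ∀ k s, ‖f k s‖ ≤ C)
    (hm : ∀ k s s', ‖f k s - f k s'‖ ≤ ω |s - s'|) :
    ∃ φ : ℕ → ℕ, StrictMono φ ∧ ∃ g : ℝ → E 3, Continuous g ∧ (∀ s, ‖g s‖ ≤ C) ∧
      (∀ s s', ‖g s - g s'‖ ≤ ω |s - s'|) ∧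
      ∀ ρ : ℝ, ∀ ε > 0, ∀ᶠ k in atTop, ∀ s ∈ Icc (-ρ) ρ, ‖f (φ k) s - g s‖ ≤ ε := by
  have htend : ∀ s : ℝ, Tendsto (fun r => ω |r - s|) (𝓝 s) (𝓝 0) := by
    intro s
    have hc : Continuous fun r => ω |r - s| := by fun_prop
    have := hc.tendsto s
    simpa [hω0] using this
  have hcont : ∀ g : ℝ → E 3, (∀ s s', ‖g s - g s'‖ ≤ ω |s - s'|) → Continuous g := by
    intro g hg
    refine continuous_iff_continuousAt.2 fun s => ?_
    rw [ContinuousAt, tendsto_iff_norm_sub_tendsto_zero]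
    exact squeeze_zero (fun r => norm_nonneg _) (fun r => hg r s) (htend s)
  set S : Set C(ℝ, E 3) := {g | (∀ s, ‖g s‖ ≤ C) ∧ ∀ s s', ‖g s - g s'‖ ≤ ω |s - s'|} with hS
  have himage : ContinuousMap.toFun '' S
      = {g : ℝ → E 3 | (∀ s, ‖g s‖ ≤ C) ∧ ∀ s s', ‖g s - g s'‖ ≤ ω |s - s'|} := by
    ext g
    constructor
    · rintro ⟨g', hg', rfl⟩; exact hg'
    · intro hg; exact ⟨⟨g, hcont g hg.2⟩, hg, rfl⟩
  have hcomp : IsCompact (ContinuousMap.toFun '' S) := by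
    rw [himage]
    refine (isCompact_univ_pi fun _ : ℝ => isCompact_closedBall (0 : E 3) C).of_isClosed_subset
      ?_ ?_
    · have h1 : IsClosed {g : ℝ → E 3 | ∀ s, ‖g s‖ ≤ C} := by
        simp only [ofPred_forall]
        exact isClosed_iInter fun s => isClosed_le (by fun_prop) continuous_const
      have h2 : IsClosed {g : ℝ → E 3 | ∀ s s', ‖g s - g s'‖ ≤ ω |s - s'|} := by
        simp only [ofPred_forall]
        exact isClosed_iInter fun s => isClosed_iInter fun s' =>
          isClosed_le (by fun_prop) continuous_const
      exact h1.inter h2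
    · intro g hg s _
      simpa using hg.1 s
  have hequi : Equicontinuous ((↑) : S → ℝ → E 3) := by
    intro s
    rw [Metric.equicontinuousAt_iff_right]
    intro ε hε
    filter_upwards [(htend s).eventually (gt_mem_nhds hε)] with r hr g
    rw [dist_eq_norm]
    refine (g.2.2 s r).trans_lt ?_
    rwa [abs_sub_comm]
  have hScomp := ArzelaAscoli.isCompact_of_equicontinuous S hcomp hequi
  obtain ⟨g, hg, φ, hφ, hlim⟩ := hScomp.tendsto_subseq
    (x := fun k => (⟨f k, hcont _ (hm k)⟩ : C(ℝ, E 3))) fun k => ⟨hb k, hm k⟩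
  refine ⟨φ, hφ, g, g.continuous, hg.1, hg.2, fun ρ ε hε => ?_⟩
  have h1 := (ContinuousMap.tendsto_iff_forall_isCompact_tendstoUniformlyOn.1 hlim)
    (Icc (-ρ) ρ) isCompact_Icc
  filter_upwards [Metric.tendstoUniformlyOn_iff.1 h1 ε hε] with k hk s hs
  have := hk s hs
  rw [dist_eq_norm, norm_sub_rev] at this
  exact this.le

section Holder

variable {n : ℕ} {F : Type*} [NormedAddCommGroup F] {γ γ' : ℝ} {S : Set (E n × ℝ)}
  {f g : E n → ℝ → F}

/-- The parabolic distance of two space-time points. -/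
def pdist (z w : E n × ℝ) : ℝ := ‖z.1 - w.1‖ + √|z.2 - w.2|

lemma pdist_nonneg (z w : E n × ℝ) : 0 ≤ pdist z w := by unfold pdist; positivity

lemma ParabolicHolderLE.mono {S' : Set (E n × ℝ)} {C C' : ℝ} (h : ParabolicHolderLE γ S f C)
    (hS : S' ⊆ S) (hC : C ≤ C') : ParabolicHolderLE γ S' f C' :=
  ⟨fun z hz => (h.1 z (hS hz)).trans hC, fun z hz w hw => (h.2 z (hS hz) w (hS hw)).trans
    (mul_le_mul_of_nonneg_right hC (Real.rpow_nonneg (pdist_nonneg z w) γ))⟩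

lemma ParabolicHolderLE.add {C C' : ℝ} (h : ParabolicHolderLE γ S f C)
    (h' : ParabolicHolderLE γ S g C') :
    ParabolicHolderLE γ S (fun x t => f x t + g x t) (C + C') := by
  refine ⟨fun z hz => (norm_add_le _ _).trans (add_le_add (h.1 z hz) (h'.1 z hz)),
    fun z hz w hw => ?_⟩
  rw [add_sub_add_comm, add_mul]
  exact (norm_add_le _ _).trans (add_le_add (h.2 z hz w hw) (h'.2 z hz w hw))

lemma ParabolicHolderLE.neg {C : ℝ} (h : ParabolicHolderLE γ S f C) :
    ParabolicHolderLE γ S (fun x t => -f x t) C := by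
  refine ⟨fun z hz => by rw [norm_neg]; exact h.1 z hz, fun z hz w hw => ?_⟩
  rw [neg_sub_neg, norm_sub_rev]
  exact h.2 z hz w hw

lemma ParabolicHolderLE.congr {C : ℝ} (h : ParabolicHolderLE γ S f C)
    (hfg : ∀ z ∈ S, g z.1 z.2 = f z.1 z.2) : ParabolicHolderLE γ S g C :=
  ⟨fun z hz => by rw [hfg z hz]; exact h.1 z hz,
    fun z hz w hw => by rw [hfg z hz, hfg w hw]; exact h.2 z hz w hw⟩

lemma ParabolicHolderLE.clm_apply {G : Type*} [NormedAddCommGroup G] [NormedSpace ℝ G]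
    [NormedSpace ℝ F] {A : E n → ℝ → G →L[ℝ] F} {u : E n → ℝ → G} {C C' : ℝ} (hC : 0 ≤ C)
    (h : ParabolicHolderLE γ S A C) (h' : ParabolicHolderLE γ S u C') :
    ParabolicHolderLE γ S (fun x t => A x t (u x t)) (2 * (C * C')) := by
  have hCu : ∀ z ∈ S, 0 ≤ C' := fun z hz => (norm_nonneg _).trans (h'.1 z hz)
  refine ⟨fun z hz => ?_, fun z hz w hw => ?_⟩
  · refine ((A z.1 z.2).le_opNorm _).trans ((mul_le_mul (h.1 z hz) (h'.1 z hz) (norm_nonneg _)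
      hC).trans ?_)
    have := mul_nonneg hC (hCu z hz)
    linarith
  · have hsplit : A z.1 z.2 (u z.1 z.2) - A w.1 w.2 (u w.1 w.2)
        = A z.1 z.2 (u z.1 z.2 - u w.1 w.2) + (A z.1 z.2 - A w.1 w.2) (u w.1 w.2) := by
      simp
    rw [hsplit]
    refine (norm_add_le _ _).trans ?_
    have h1 := ((A z.1 z.2).le_opNorm (u z.1 z.2 - u w.1 w.2)).trans
      (mul_le_mul (h.1 z hz) (h'.2 z hz w hw) (norm_nonneg _) hC)
    have h2 := ((A z.1 z.2 - A w.1 w.2).le_opNorm (u w.1 w.2)).trans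
      (mul_le_mul (h.2 z hz w hw) (h'.1 w hw) (norm_nonneg _)
        (mul_nonneg hC (Real.rpow_nonneg (pdist_nonneg z w) γ)))
    linarith

/-- Interpolation: a small supremum and a bounded `C^γ` seminorm give a small `C^{γ'}` norm for
`γ' < γ`. -/
lemma parabolicHolderLE_interpolate (hγ : 0 < γ) (hγ' : 0 < γ') (h : γ' < γ) {δ C : ℝ}
    (hδ : 0 ≤ δ) (hC : 0 ≤ C) (hs : ∀ z ∈ S, ‖f z.1 z.2‖ ≤ δ)
    (hH : ∀ z ∈ S, ∀ w ∈ S, ‖f z.1 z.2 - f w.1 w.2‖ ≤ C * pdist z w ^ γ) :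
    ParabolicHolderLE γ' S f (max δ ((2 * δ) ^ (1 - γ' / γ) * C ^ (γ' / γ))) := by
  refine ⟨fun z hz => (hs z hz).trans (le_max_left _ _), fun z hz w hw => ?_⟩
  refine le_trans ?_ (mul_le_mul_of_nonneg_right (le_max_right _ _)
    (Real.rpow_nonneg (pdist_nonneg z w) γ'))
  have hθ0 : 0 < γ' / γ := by positivity
  have hθ1 : γ' / γ < 1 := (div_lt_one hγ).2 h
  have h1 : ‖f z.1 z.2 - f w.1 w.2‖ ≤ 2 * δ :=
    (norm_sub_le _ _).trans (by linarith [hs z hz, hs w hw])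
  have h2 := hH z hz w hw
  have hN := norm_nonneg (f z.1 z.2 - f w.1 w.2)
  calc ‖f z.1 z.2 - f w.1 w.2‖
      = ‖f z.1 z.2 - f w.1 w.2‖ ^ (1 - γ' / γ) * ‖f z.1 z.2 - f w.1 w.2‖ ^ (γ' / γ) := by
        rcases hN.eq_or_lt with h0 | h0
        · rw [← h0, Real.zero_rpow hθ0.ne', mul_zero]
        · rw [← Real.rpow_add h0]; simp
    _ ≤ (2 * δ) ^ (1 - γ' / γ) * (C * pdist z w ^ γ) ^ (γ' / γ) := by
        refine mul_le_mul (Real.rpow_le_rpow hN h1 (by linarith))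
          (Real.rpow_le_rpow hN h2 hθ0.le) (by positivity) (by positivity)
    _ = _ := by
        rw [Real.mul_rpow hC (Real.rpow_nonneg (pdist_nonneg z w) γ),
          ← Real.rpow_mul (pdist_nonneg z w), mul_div_cancel₀ _ hγ.ne', ← mul_assoc]
        rfl

/-- The `C^γ` norms of `f k` on `K ∩ S k` tend to zero for every compact set `K`. -/
def TendsToZeroHolder (γ : ℝ) (S : ℕ → Set (E n × ℝ)) (f : ℕ → E n → ℝ → F) : Prop :=
  ∀ K : Set (E n × ℝ), IsCompact K → ∀ ε > 0, ∀ᶠ k in atTop, ParabolicHolderLE γ (K ∩ S k) (f k) ε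

/-- The `C^γ` norms of `f k` on `K ∩ S k` are eventually bounded for every compact set `K`. -/
def BoundedHolder (γ : ℝ) (S : ℕ → Set (E n × ℝ)) (f : ℕ → E n → ℝ → F) : Prop :=
  ∀ K : Set (E n × ℝ), IsCompact K → ∃ C, 0 ≤ C ∧
    ∀ᶠ k in atTop, ParabolicHolderLE γ (K ∩ S k) (f k) C

lemma BoundedHolder.add {S : ℕ → Set (E n × ℝ)} {f g : ℕ → E n → ℝ → F}
    (hf : BoundedHolder γ S f) (hg : BoundedHolder γ S g) :
    BoundedHolder γ S (fun k x t => f k x t + g k x t) := by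
  intro K hK
  obtain ⟨C, hC, h1⟩ := hf K hK
  obtain ⟨C', hC', h2⟩ := hg K hK
  exact ⟨C + C', by positivity, by filter_upwards [h1, h2] with k h1 h2 using h1.add h2⟩

lemma BoundedHolder.neg {S : ℕ → Set (E n × ℝ)} {f : ℕ → E n → ℝ → F}
    (hf : BoundedHolder γ S f) : BoundedHolder γ S (fun k x t => -f k x t) := by
  intro K hK
  obtain ⟨C, hC, h1⟩ := hf K hK
  exact ⟨C, hC, by filter_upwards [h1] with k h1 using h1.neg⟩

lemma TendsToZeroHolder.add {S : ℕ → Set (E n × ℝ)} {f g : ℕ → E n → ℝ → F}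
    (hf : TendsToZeroHolder γ S f) (hg : TendsToZeroHolder γ S g) :
    TendsToZeroHolder γ S (fun k x t => f k x t + g k x t) := by
  intro K hK ε hε
  filter_upwards [hf K hK _ (half_pos hε), hg K hK _ (half_pos hε)] with k h1 h2
  exact (h1.add h2).mono subset_rfl (by linarith)

lemma TendsToZeroHolder.neg {S : ℕ → Set (E n × ℝ)} {f : ℕ → E n → ℝ → F}
    (hf : TendsToZeroHolder γ S f) : TendsToZeroHolder γ S (fun k x t => -f k x t) :=
  fun K hK ε hε => by filter_upwards [hf K hK ε hε] with k hk using hk.neg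

lemma TendsToZeroHolder.clm_apply {G : Type*} [NormedAddCommGroup G] [NormedSpace ℝ G]
    [NormedSpace ℝ F] {S : ℕ → Set (E n × ℝ)} {A : ℕ → E n → ℝ → G →L[ℝ] F} {u : ℕ → E n → ℝ → G}
    (hA : TendsToZeroHolder γ S A) (hu : BoundedHolder γ S u) :
    TendsToZeroHolder γ S (fun k x t => A k x t (u k x t)) := by
  intro K hK ε hε
  obtain ⟨C, hC, h1⟩ := hu K hK
  have hδ : 0 < ε / (2 * (C + 1)) := by positivity
  filter_upwards [hA K hK _ hδ, h1] with k hk1 hk2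
  refine (hk1.clm_apply hδ.le hk2).mono subset_rfl ?_
  have : ε / (2 * (C + 1)) * C ≤ ε / 2 := by
    rw [div_mul_eq_mul_div, div_le_div_iff₀ (by positivity) (by positivity)]
    nlinarith
  linarith

/-- Uniform convergence to zero and bounded `C^γ` norms give convergence to zero in `C^{γ'}`. -/
lemma BoundedHolder.tendsToZero {S : ℕ → Set (E n × ℝ)} {f : ℕ → E n → ℝ → F} (hγ' : 0 < γ')
    (h : γ' < γ) (hf : BoundedHolder γ S f)
    (hs : ∀ K : Set (E n × ℝ), IsCompact K → ∀ ε > 0, ∀ᶠ k in atTop,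
      ∀ z ∈ K ∩ S k, ‖f k z.1 z.2‖ ≤ ε) : TendsToZeroHolder γ' S f := by
  intro K hK ε hε
  obtain ⟨C, hC, h1⟩ := hf K hK
  have hγ : 0 < γ := hγ'.trans h
  have hθ1 : γ' / γ < 1 := (div_lt_one hγ).2 h
  have hlim : Tendsto (fun δ : ℝ => max δ ((2 * δ) ^ (1 - γ' / γ) * C ^ (γ' / γ))) (𝓝[>] 0)
      (𝓝 0) := by
    have hc : Continuous fun δ : ℝ => max δ ((2 * δ) ^ (1 - γ' / γ) * C ^ (γ' / γ)) :=
      continuous_id.max (((continuous_const.mul continuous_id).rpow_const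
        fun _ => Or.inr (by linarith)).mul continuous_const)
    have h2 := hc.tendsto 0
    rw [mul_zero, Real.zero_rpow (by linarith), zero_mul, max_self] at h2
    exact h2.mono_left nhdsWithin_le_nhds
  obtain ⟨δ, hδε, hδ⟩ := ((hlim.eventually (gt_mem_nhds hε)).and self_mem_nhdsWithin).exists
  filter_upwards [hs K hK δ hδ, h1] with k hk1 hk2
  exact (parabolicHolderLE_interpolate hγ hγ' h (le_of_lt hδ) hC hk1 hk2.2).mono subset_rfl hδε.le

lemma rpow_add_le_mul_rpow {r M : ℝ} (hr : 0 ≤ r) (hrM : r ≤ M) (hM : 1 ≤ M) (hγ : 0 < γ)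
    (hγ1 : γ ≤ 1) : r + r ^ γ ≤ 2 * M * r ^ γ := by
  have h1 : r ≤ M * r ^ γ := by
    rcases hr.eq_or_lt with h0 | h0
    · rw [← h0, Real.zero_rpow hγ.ne', mul_zero]
    · calc r = r ^ (1 - γ) * r ^ γ := by rw [← Real.rpow_add h0]; simp
        _ ≤ M ^ (1 - γ) * r ^ γ := by gcongr
        _ ≤ M ^ (1 : ℝ) * r ^ γ := by gcongr; linarith
        _ = _ := by rw [Real.rpow_one]
  have h2 : r ^ γ ≤ M * r ^ γ := le_mul_of_one_le_left (by positivity) hM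
  linarith

/-- Bounds for the increments in space and in time, at most of the sizes `r + r^γ` and
`s + s^{γ/2}`, give parabolic Hölder bounds on compact sets. -/
lemma boundedHolder_of_increments {A : ℕ → Set (E n)} {I : ℕ → Set ℝ} {f : ℕ → E n → ℝ → F}
    (hγ : 0 < γ) (hγ1 : γ ≤ 1) {C : ℝ} (hC : 0 ≤ C)
    (hb : ∀ M : ℝ, ∀ᶠ k in atTop, ∀ x ∈ A k, ∀ t ∈ I k, ‖x‖ ≤ M → |t| ≤ M → ‖f k x t‖ ≤ C)
    (hx : ∀ M : ℝ, ∀ᶠ k in atTop, ∀ x ∈ A k, ∀ x' ∈ A k, ∀ t ∈ I k, ‖x‖ ≤ M → ‖x'‖ ≤ M →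
      ‖f k x t - f k x' t‖ ≤ C * (‖x - x'‖ + ‖x - x'‖ ^ γ))
    (ht : ∀ M : ℝ, ∀ᶠ k in atTop, ∀ x ∈ A k, ∀ t ∈ I k, ∀ t' ∈ I k, ‖x‖ ≤ M → |t| ≤ M → |t'| ≤ M →
      ‖f k x t - f k x t'‖ ≤ C * (|t - t'| + |t - t'| ^ (γ / 2))) :
    BoundedHolder γ (fun k => A k ×ˢ I k) f := by
  intro K hK
  obtain ⟨M₀, hM₀⟩ := hK.isBounded.subset_closedBall 0
  set M := max M₀ 1 with hM
  have hM1 : 1 ≤ M := le_max_right _ _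
  have hKM : ∀ z ∈ K, ‖z.1‖ ≤ M ∧ |z.2| ≤ M := by
    intro z hz
    have h1 := mem_closedBall_zero_iff.1 (hM₀ hz)
    exact ⟨(norm_fst_le z).trans (h1.trans (le_max_left _ _)),
      (norm_snd_le z).trans (h1.trans (le_max_left _ _))⟩
  refine ⟨8 * M * C, by positivity, ?_⟩
  filter_upwards [hb M, hx M, ht M] with k hbk hxk htk
  refine ⟨fun z hz => (hbk _ hz.2.1 _ hz.2.2 (hKM z hz.1).1 (hKM z hz.1).2).trans ?_,
    fun z hz w hw => ?_⟩
  · nlinarith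
  · have h1 := hxk z.1 hz.2.1 w.1 hw.2.1 z.2 hz.2.2 (hKM z hz.1).1 (hKM w hw.1).1
    have h2 := htk w.1 hw.2.1 z.2 hz.2.2 w.2 hw.2.2 (hKM w hw.1).1 (hKM z hz.1).2 (hKM w hw.1).2
    have h3 : ‖z.1 - w.1‖ + ‖z.1 - w.1‖ ^ γ ≤ 2 * (2 * M) * ‖z.1 - w.1‖ ^ γ := by
      refine rpow_add_le_mul_rpow (norm_nonneg _) ((norm_sub_le _ _).trans ?_) (by linarith) hγ hγ1
      linarith [(hKM z hz.1).1, (hKM w hw.1).1]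
    have h4 : |z.2 - w.2| + |z.2 - w.2| ^ (γ / 2) ≤ 2 * (2 * M) * |z.2 - w.2| ^ (γ / 2) := by
      refine rpow_add_le_mul_rpow (abs_nonneg _) ((abs_sub _ _).trans ?_) (by linarith)
        (by positivity) (by linarith)
      linarith [(hKM z hz.1).2, (hKM w hw.1).2]
    have h5 : |z.2 - w.2| ^ (γ / 2) = √|z.2 - w.2| ^ γ := by
      rw [Real.sqrt_eq_rpow, ← Real.rpow_mul (abs_nonneg _)]; congr 1; ring
    rw [h5] at h2 h4
    have h6 : ‖z.1 - w.1‖ ^ γ ≤ pdist z w ^ γ :=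
      Real.rpow_le_rpow (norm_nonneg _) (le_add_of_nonneg_right (Real.sqrt_nonneg _)) hγ.le
    have h7 : √|z.2 - w.2| ^ γ ≤ pdist z w ^ γ :=
      Real.rpow_le_rpow (Real.sqrt_nonneg _) (le_add_of_nonneg_left (norm_nonneg _)) hγ.le
    calc ‖f k z.1 z.2 - f k w.1 w.2‖
        ≤ ‖f k z.1 z.2 - f k w.1 z.2‖ + ‖f k w.1 z.2 - f k w.1 w.2‖ :=
          norm_sub_le_norm_sub_add_norm_sub _ _ _
      _ ≤ C * (2 * (2 * M) * pdist z w ^ γ) + C * (2 * (2 * M) * pdist z w ^ γ) := by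
          refine add_le_add (h1.trans (mul_le_mul_of_nonneg_left (h3.trans ?_) hC))
            (h2.trans (mul_le_mul_of_nonneg_left (h4.trans ?_) hC))
          · exact mul_le_mul_of_nonneg_left h6 (by positivity)
          · exact mul_le_mul_of_nonneg_left h7 (by positivity)
      _ = 8 * M * C * pdist z w ^ γ := by ring

end Holder

/-! ### From the finite cylinder to the periodic pipe -/

section Cells

variable {R a b : ℝ}

lemma isOpen_cylinder : IsOpen (cylinder R a b) := by
  have h : Continuous fun x : E 3 => x 2 := by fun_prop
  exact (isOpen_lt continuous_radius continuous_const).inter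
    ((isOpen_lt continuous_const h).inter (isOpen_lt h continuous_const))

lemma cylinder_subset_pipe : cylinder R a b ⊆ pipe R :=
  fun x (hx : radius x < R ∧ a < x 2 ∧ x 2 < b) => hx.1.le

/-- Shift by `m` periods. -/
def shift (L : ℝ) (m : ℤ) (x : E 3) : E 3 := x + ((m : ℝ) * L) • e3

lemma shift_two (L : ℝ) (m : ℤ) (x : E 3) : shift L m x 2 = x 2 + m * L := by simp [shift]

lemma radius_shift (L : ℝ) (m : ℤ) (x : E 3) : radius (shift L m x) = radius x :=
  radius_add_smul_e3 _ _

lemma shift_mem_pipe {L : ℝ} {m : ℤ} {x : E 3} : shift L m x ∈ pipe R ↔ x ∈ pipe R := by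
  simp [pipe, radius_shift]

/-- A point of the closed cell is a limit of points of the open cell. -/
lemma mem_closure_cell (hR : 0 < R) (hab : a < b) {m : ℤ} {x : E 3} (hx : x ∈ pipe R)
    (h1 : a ≤ shift (b - a) m x 2) (h2 : shift (b - a) m x 2 ≤ b) :
    x ∈ closure (shift (b - a) m ⁻¹' cylinder R a b) := by
  have hx : radius x ≤ R := hx
  rw [shift_two] at h1 h2
  set z : E 3 := ((a + b) / 2 - m * (b - a)) • e3 with hz
  have hlim : Tendsto (fun η : ℝ => (1 - η) • x + η • z) (𝓝[>] 0) (𝓝 x) := by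
    have hc : Continuous fun η : ℝ => (1 - η) • x + η • z := by fun_prop
    have := hc.tendsto 0
    simp only [sub_zero, one_smul, zero_smul, add_zero] at this
    exact this.mono_left nhdsWithin_le_nhds
  refine mem_closure_of_tendsto hlim ?_
  filter_upwards [Ioo_mem_nhdsGT one_pos] with η hη
  have hcoord : shift (b - a) m ((1 - η) • x + η • z) 2
      = (1 - η) * (x 2 + m * (b - a)) + η * ((a + b) / 2) := by
    rw [shift_two]; simp [hz]; ring
  have hrad : radius ((1 - η) • x + η • z) ≤ (1 - η) * R := by
    rw [hz, smul_smul, radius_add_smul_e3, radius_smul, abs_of_pos (by linarith [hη.2])]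
    exact mul_le_mul_of_nonneg_left hx (by linarith [hη.2])
  refine ⟨?_, ?_, ?_⟩
  · rw [radius_shift]
    nlinarith [hη.1]
  · rw [hcoord]
    nlinarith [hη.1, hη.2]
  · rw [hcoord]
    nlinarith [hη.1, hη.2]

/-- An upper bound on the open cells extends to their closures by continuity. -/
lemma le_of_le_on_cell {m : ℤ} {U : Set (E 3)} (hU : IsOpen U) {f : E 3 → ℝ} {c : ℝ}
    (hf : ContinuousOn f (pipe R))
    (h : ∀ x ∈ U, shift (b - a) m x ∈ cylinder R a b → f x ≤ c) {x : E 3} (hxU : x ∈ U)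
    (hx : x ∈ closure (shift (b - a) m ⁻¹' cylinder R a b)) : f x ≤ c := by
  have hcl : IsClosed (pipe R ∩ f ⁻¹' Iic c) :=
    hf.preimage_isClosed_of_isClosed (isClosed_pipe R) isClosed_Iic
  have hsub : U ∩ shift (b - a) m ⁻¹' cylinder R a b ⊆ pipe R ∩ f ⁻¹' Iic c :=
    fun y hy => ⟨shift_mem_pipe.1 (cylinder_subset_pipe hy.2), h y hy.1 hy.2⟩
  exact (closure_minimal hsub hcl (hU.inter_closure ⟨hxU, hx⟩)).2

variable {G : Type*} [NormedAddCommGroup G] {g : E 3 → G} {ρ M γ : ℝ}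

/-- A bound on the finite cylinder, away from the axis, extends to the pipe for a continuous
periodic field. -/
lemma norm_le_on_pipe (hR : 0 < R) (hab : a < b) (hg : ContinuousOn g (pipe R))
    (hper : ∀ x ∈ pipe R, ∀ m : ℤ, g (shift (b - a) m x) = g x)
    (h : ∀ x ∈ cylinder R a b, ρ ≤ radius x → ‖g x‖ ≤ M) {x : E 3} (hx : x ∈ pipe R)
    (hρ : ρ < radius x) : ‖g x‖ ≤ M := by
  obtain ⟨m, hm⟩ := exists_shift hab x
  have hm1 : shift (b - a) m x 2 ∈ Ico a b := by rw [shift_two]; exact hm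
  refine le_of_le_on_cell (f := fun x => ‖g x‖) (U := {x | ρ < radius x})
    (isOpen_lt continuous_const continuous_radius) hg.norm
    (fun y hy hym => ?_) hρ (mem_closure_cell hR hab hx hm1.1 hm1.2.le)
  have hy : ρ < radius y := hy
  rw [← hper y (shift_mem_pipe.1 (cylinder_subset_pipe hym)) m]
  exact h _ hym (by rw [radius_shift]; exact hy.le)

/-- Increments of a continuous periodic field near a point off the axis are controlled by increments
in the finite cylinder: two points in adjacent cells are joined through the common face. -/
lemma norm_sub_le_on_pipe (hR : 0 < R) (hab : a < b) (hγ : 0 < γ) (hM : 0 ≤ M)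
    (hg : ContinuousOn g (pipe R))
    (hper : ∀ x ∈ pipe R, ∀ m : ℤ, g (shift (b - a) m x) = g x)
    (h : ∀ x ∈ cylinder R a b, ∀ x' ∈ cylinder R a b, (∀ z ∈ segment ℝ x' x, ρ ≤ radius z) →
      ‖g x - g x'‖ ≤ M * (‖x - x'‖ + ‖x - x'‖ ^ γ))
    {U : Set (E 3)} (hUo : IsOpen U) (hUc : Convex ℝ U) (hUρ : ∀ z ∈ U, ρ ≤ radius z)
    (hUL : ∀ x ∈ U, ∀ x' ∈ U, |x 2 - x' 2| < b - a)
    {x x' : E 3} (hx : x ∈ pipe R) (hx' : x' ∈ pipe R) (hxU : x ∈ U) (hxU' : x' ∈ U) :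
    ‖g x - g x'‖ ≤ 2 * M * (‖x - x'‖ + ‖x - x'‖ ^ γ) := by
  -- increments within one cell
  have hcell : ∀ m : ℤ, ∀ x ∈ U, ∀ x' ∈ U, x ∈ closure (shift (b - a) m ⁻¹' cylinder R a b) →
      x' ∈ closure (shift (b - a) m ⁻¹' cylinder R a b) →
      ‖g x - g x'‖ ≤ M * (‖x - x'‖ + ‖x - x'‖ ^ γ) := by
    intro m
    have hcont : ∀ y : E 3, Continuous fun x : E 3 => M * (‖x - y‖ + ‖x - y‖ ^ γ) := by
      intro y
      have h1 : Continuous fun x : E 3 => ‖x - y‖ := by fun_prop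
      exact continuous_const.mul (h1.add (h1.rpow_const fun _ => Or.inr hγ.le))
    have h0 : ∀ x ∈ U, shift (b - a) m x ∈ cylinder R a b → ∀ x' ∈ U,
        shift (b - a) m x' ∈ cylinder R a b →
        ‖g x - g x'‖ ≤ M * (‖x - x'‖ + ‖x - x'‖ ^ γ) := by
      intro x hx hxm x' hx' hxm'
      have h2 := h _ hxm _ hxm' (fun z hz => by
        have h3 : z + (-((m : ℝ) * (b - a))) • e3 ∈ segment ℝ x' x := by
          have h4 := (mem_segment_translate ℝ (((m : ℝ) * (b - a)) • e3)
            (x := z + (-((m : ℝ) * (b - a))) • e3) (b := x') (c := x)).1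
          apply h4
          have h5 : ((m : ℝ) * (b - a)) • e3 + (z + (-((m : ℝ) * (b - a))) • e3) = z := by module
          rw [h5, add_comm _ x', add_comm _ x]
          exact hz
        rw [← radius_add_smul_e3 z (-((m : ℝ) * (b - a)))]
        exact hUρ _ (hUc.segment_subset hx' hx h3))
      rw [hper x (shift_mem_pipe.1 (cylinder_subset_pipe hxm)) m,
        hper x' (shift_mem_pipe.1 (cylinder_subset_pipe hxm')) m] at h2
      have h3 : shift (b - a) m x - shift (b - a) m x' = x - x' := by simp [shift]
      rwa [h3] at h2
    intro x hx x' hx' hxc hxc'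
    have h1 : ∀ y' ∈ U, shift (b - a) m y' ∈ cylinder R a b →
        ‖g x - g y'‖ ≤ M * (‖x - y'‖ + ‖x - y'‖ ^ γ) := by
      intro y' hy' hym'
      have := le_of_le_on_cell (f := fun y => ‖g y - g y'‖ - M * (‖y - y'‖ + ‖y - y'‖ ^ γ)) (c := 0)
        hUo ((hg.sub continuousOn_const).norm.sub (hcont y').continuousOn)
        (fun y hy hym => sub_nonpos.2 (h0 y hy hym y' hy' hym')) hx hxc
      exact sub_nonpos.1 this
    have := le_of_le_on_cell (f := fun y => ‖g y - g x‖ - M * (‖y - x‖ + ‖y - x‖ ^ γ)) (c := 0)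
        hUo ((hg.sub continuousOn_const).norm.sub (hcont x).continuousOn)
        (fun y hy hym => sub_nonpos.2 (by
          rw [norm_sub_rev (g y), norm_sub_rev y]; exact h1 y hy hym)) hx' hxc'
    have := sub_nonpos.1 this
    rwa [norm_sub_rev (g x'), norm_sub_rev x'] at this
  -- the case that the first point lies below the second
  have hord : ∀ x ∈ U, ∀ x' ∈ U, x ∈ pipe R → x' ∈ pipe R → x 2 ≤ x' 2 →
      ‖g x - g x'‖ ≤ 2 * M * (‖x - x'‖ + ‖x - x'‖ ^ γ) := by
    intro x hxU x' hxU' hx hx' hle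
    have hnn : 0 ≤ M * (‖x - x'‖ + ‖x - x'‖ ^ γ) := by positivity
    obtain ⟨m, hm⟩ := exists_shift hab x
    have hxc := mem_closure_cell hR hab (m := m) hx (by rw [shift_two]; exact hm.1)
      (by rw [shift_two]; exact hm.2.le)
    by_cases hcase : x' 2 + m * (b - a) ≤ b
    · have := hcell m x hxU x' hxU' hxc (mem_closure_cell hR hab hx'
        (by rw [shift_two]; linarith [hm.1]) (by rw [shift_two]; exact hcase))
      linarith
    · have hcase := not_le.1 hcase
      have hlt : x 2 < x' 2 := by linarith [hm.2]
      -- the point of the segment on the face between the two cells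
      set lam : ℝ := (b - m * (b - a) - x 2) / (x' 2 - x 2) with hlam
      have hl0 : 0 ≤ lam := div_nonneg (by linarith [hm.2]) (by linarith)
      have hl1 : lam ≤ 1 := (div_le_one (by linarith)).2 (by linarith)
      set c : E 3 := (1 - lam) • x + lam • x' with hc
      have hcU : c ∈ U := hUc hxU hxU' (by linarith) hl0 (by ring)
      have hcp : c ∈ pipe R := convex_pipe R hx hx' (by linarith) hl0 (by ring)
      have hc2 : c 2 = b - m * (b - a) := by
        have : lam * (x' 2 - x 2) = b - m * (b - a) - x 2 := by
          rw [hlam]; exact div_mul_cancel₀ _ (by linarith)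
        simp [hc]; linarith
      have h1 := hcell m x hxU c hcU hxc (mem_closure_cell hR hab hcp
        (by rw [shift_two, hc2]; linarith) (by rw [shift_two, hc2]; linarith))
      have hd := abs_lt.1 (hUL x hxU x' hxU')
      have h2 := hcell (m - 1) c hcU x' hxU' (mem_closure_cell hR hab hcp
        (by rw [shift_two, hc2]; push_cast; linarith) (by rw [shift_two, hc2]; push_cast; linarith))
        (mem_closure_cell hR hab hx'
        (by rw [shift_two]; push_cast; linarith)
        (by rw [shift_two]; push_cast; linarith [hm.2]))
      have e1 : ‖x - c‖ ≤ ‖x - x'‖ := by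
        have : x - c = lam • (x - x') := by rw [hc]; module
        rw [this, norm_smul, Real.norm_of_nonneg hl0]
        exact mul_le_of_le_one_left (norm_nonneg _) hl1
      have e2 : ‖c - x'‖ ≤ ‖x - x'‖ := by
        have : c - x' = (1 - lam) • (x - x') := by rw [hc]; module
        rw [this, norm_smul, Real.norm_of_nonneg (by linarith)]
        exact mul_le_of_le_one_left (norm_nonneg _) (by linarith)
      have hmono : ∀ r : ℝ, 0 ≤ r → r ≤ ‖x - x'‖ →
          M * (r + r ^ γ) ≤ M * (‖x - x'‖ + ‖x - x'‖ ^ γ) := fun r h0 hr =>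
        mul_le_mul_of_nonneg_left (add_le_add hr (Real.rpow_le_rpow h0 hr hγ.le)) hM
      have h3 := norm_sub_le_norm_sub_add_norm_sub (g x) (g c) (g x')
      have h4 := hmono _ (norm_nonneg _) e1
      have h5 := hmono _ (norm_nonneg _) e2
      linarith
  rcases le_total (x 2) (x' 2) with hle | hle
  · exact hord x hxU x' hxU' hx hx' hle
  · rw [norm_sub_rev (g x), norm_sub_rev x]
    exact hord x' hxU' x hxU hx' hx hle

end Cells

section Periodic

variable {R a b T₀ : ℝ} {v : E 3 → ℝ → E 3} {p : E 3 → ℝ → ℝ}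

lemma IsASESolution.map_shift (hv : IsASESolution R a b T₀ v p) {x : E 3} (hx : x ∈ pipe R)
    {t : ℝ} (ht : t ∈ Ico 0 T₀) (m : ℤ) : v (shift (b - a) m x) t = v x t :=
  hv.periodic_int hx ht m

lemma IsASESolution.dx_shift (hR : 0 < R) (hv : IsASESolution R a b T₀ v p) {x : E 3}
    (hx : x ∈ pipe R) {t : ℝ} (ht : t ∈ Ico 0 T₀) (m : ℤ) :
    dx (pipe R) v (shift (b - a) m x) t = dx (pipe R) v x t := by
  have h1 := hv.hasFDerivWithinAt (shift_mem_pipe (L := b - a) (m := m).2 hx) ht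
  have h2 : HasFDerivWithinAt (shift (b - a) m) (ContinuousLinearMap.id ℝ (E 3)) (pipe R) x :=
    ((hasFDerivAt_id x).add_const _).hasFDerivWithinAt
  have h3 := h1.comp x h2 fun y hy => shift_mem_pipe.2 hy
  have h4 := h3.congr (f₁ := fun y => v y t) (fun y hy => (hv.map_shift hy ht m).symm)
    (hv.map_shift hx ht m).symm
  have h5 := h4.fderivWithin (uniqueDiffOn_pipe hR x hx)
  rw [ContinuousLinearMap.comp_id] at h5
  exact h5.symm

lemma IsASESolution.dt_shift (hv : IsASESolution R a b T₀ v p) {x : E 3}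
    (hx : x ∈ pipe R) {t : ℝ} (ht : t ∈ Ico 0 T₀) (m : ℤ) :
    dt (Ico 0 T₀) v (shift (b - a) m x) t = dt (Ico 0 T₀) v x t :=
  derivWithin_congr (fun _ hs => hv.map_shift hx hs m) (hv.map_shift hx ht m)

end Periodic

/-! ### Asymptotically self-similar solutions -/

/-- The part of the assumptions of asymptotic self-similarity that enters the estimates: `v` is the
sum of a self-similar field with profile `V` and of the error `(T₀-t)^{-α} F`. -/
structure SelfSimilarWithError (D : Set (E 3)) (T₀ α γ : ℝ) (v : E 3 → ℝ → E 3) (V : E 3 → E 3)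
    (F : E 3 → ℝ → E 3) (B C : ℝ) : Prop where
  slow : SlowlyVarying V B
  slow_fderiv : SlowlyVarying (fderiv ℝ V) B
  slow_time : SlowlyVarying (timeProfile α α V) B
  diff_space : ∀ t ∈ Ico 0 T₀, DifferentiableOn ℝ (fun x => F x t) D
  diff_time : ∀ x ∈ D, DifferentiableOn ℝ (fun t => F x t) (Ico 0 T₀)
  holder : C21HolderLE γ D (Ico 0 T₀) (D ×ˢ Ico 0 T₀) F C
  small : ∀ᶠ t in 𝓝[<] T₀, ∀ x ∈ D, ‖F x t‖ ≤ T₀ - t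
  form : ∀ x ∈ D, ∀ t ∈ Ico 0 T₀, v x t = selfSim T₀ α α V x t + ((T₀ - t) ^ α)⁻¹ • F x t

lemma SlowlyVarying.mono {G : Type*} [NormedAddCommGroup G] [NormedSpace ℝ G] {Ψ : E 3 → G}
    {B B' : ℝ} (h : SlowlyVarying Ψ B) (hB : B ≤ B') : SlowlyVarying Ψ B' :=
  ⟨h.diff, fun y => (h.bound y).trans hB, fun y => (h.decay y).trans hB⟩

/-- The decay assumptions on the profile say that the profile, its gradient and the profile of the
time derivative vary slowly at infinity. -/
lemma exists_slowlyVarying {α γ : ℝ} (h0 : 0 ≤ α) (h1 : α ≤ 1) {V : E 3 → E 3}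
    (hV : MemC2Holder γ V)
    (hd1 : MemCHolder γ (fun y => ‖y‖ * ‖fderiv ℝ V y‖))
    (hd2 : MemCHolder γ (fun y => ‖y‖ ^ 2 * ‖fderiv ℝ (fderiv ℝ V) y‖)) :
    ∃ B, SlowlyVarying V B ∧ SlowlyVarying (fderiv ℝ V) B ∧
      SlowlyVarying (timeProfile α α V) B := by
  obtain ⟨hsm, ⟨C0, hC0, -⟩, ⟨C1, hC1, -⟩, ⟨C2, hC2, -⟩⟩ := hV
  obtain ⟨D1, hD1, -⟩ := hd1
  obtain ⟨D2, hD2, -⟩ := hd2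
  have hdV : Differentiable ℝ V := hsm.differentiable (by norm_num)
  have hdDV : Differentiable ℝ (fderiv ℝ V) :=
    (hsm.fderiv_right (m := 1) (by norm_num)).differentiable (by norm_num)
  have hD1' : ∀ y, ‖y‖ * ‖fderiv ℝ V y‖ ≤ D1 := fun y => by
    have := hD1 y; rwa [Real.norm_of_nonneg (by positivity)] at this
  have hD2' : ∀ y, ‖y‖ ^ 2 * ‖fderiv ℝ (fderiv ℝ V) y‖ ≤ D2 := fun y => by
    have := hD2 y; rwa [Real.norm_of_nonneg (by positivity)] at this
  have hV0 : SlowlyVarying V (max C0 D1) :=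
    ⟨hdV, fun y => (hC0 y).trans (le_max_left _ _), fun y => (hD1' y).trans (le_max_right _ _)⟩
  have hV1 : SlowlyVarying (fderiv ℝ V) (max C1 (C2 + D2)) := by
    refine ⟨hdDV, fun y => (hC1 y).trans (le_max_left _ _),
      fun y => le_trans ?_ (le_max_right _ _)⟩
    have h2 := hC2 y
    have h3 := hD2' y
    have hn := norm_nonneg (fderiv ℝ (fderiv ℝ V) y)
    -- `|y| ≤ 1 + |y|²`
    nlinarith [mul_nonneg (sq_nonneg (‖y‖ - 1)) hn, norm_nonneg y]
  have hU : SlowlyVarying (timeProfile α α V) (max ((α + 1) * max C0 D1) (2 * D1 + D2)) := by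
    have hder : ∀ y, HasFDerivAt (timeProfile α α V) (α • fderiv ℝ V y + (1 - α) •
        ((fderiv ℝ V y).comp (ContinuousLinearMap.id ℝ (E 3))
          + (fderiv ℝ (fderiv ℝ V) y).flip y)) y := fun y =>
      ((hdV y).hasFDerivAt.const_smul α).add
        (((hdDV y).hasFDerivAt.clm_apply (hasFDerivAt_id y)).const_smul (1 - α))
    refine ⟨fun y => (hder y).differentiableAt, fun y =>
      (hV0.norm_timeProfile_le h0 h0 h1 y).trans (le_max_left _ _),
      fun y => le_trans ?_ (le_max_right _ _)⟩
    rw [(hder y).fderiv, ContinuousLinearMap.comp_id]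
    have hn : ‖α • fderiv ℝ V y + (1 - α) •
        (fderiv ℝ V y + (fderiv ℝ (fderiv ℝ V) y).flip y)‖
        ≤ 2 * ‖fderiv ℝ V y‖ + ‖fderiv ℝ (fderiv ℝ V) y‖ * ‖y‖ := by
      refine (norm_add_le _ _).trans ?_
      rw [norm_smul, norm_smul, Real.norm_of_nonneg h0,
        Real.norm_of_nonneg (by linarith : 0 ≤ 1 - α)]
      have h2 : ‖(fderiv ℝ (fderiv ℝ V) y).flip y‖ ≤ ‖fderiv ℝ (fderiv ℝ V) y‖ * ‖y‖ := by
        refine ((fderiv ℝ (fderiv ℝ V) y).flip.le_opNorm y).trans ?_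
        rw [ContinuousLinearMap.opNorm_flip]
      have h3 := norm_add_le (fderiv ℝ V y) ((fderiv ℝ (fderiv ℝ V) y).flip y)
      have hn1 := norm_nonneg (fderiv ℝ V y)
      have h4 := norm_nonneg (fderiv ℝ V y + (fderiv ℝ (fderiv ℝ V) y).flip y)
      nlinarith
    have h5 := mul_le_mul_of_nonneg_left hn (norm_nonneg y)
    have := hD1' y
    have := hD2' y
    linarith
  exact ⟨max (max C0 D1) (max (max C1 (C2 + D2)) (max ((α + 1) * max C0 D1) (2 * D1 + D2))),
    hV0.mono (le_max_left _ _), hV1.mono ((le_max_left _ _).trans (le_max_right _ _)),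
    hU.mono ((le_max_right _ _).trans (le_max_right _ _))⟩

lemma IsAsymptoticallySelfSimilar.exists_error {D : Set (E 3)} {T₀ α γ : ℝ} {v : E 3 → ℝ → E 3}
    {V : E 3 → E 3} {W : E 3 → ℝ → E 3} (h0 : 0 ≤ α) (h1 : α ≤ 1)
    (h : IsAsymptoticallySelfSimilar D T₀ α γ v V W)
    (hd1 : MemCHolder γ (fun y => ‖y‖ * ‖fderiv ℝ V y‖))
    (hd2 : MemCHolder γ (fun y => ‖y‖ ^ 2 * ‖fderiv ℝ (fderiv ℝ V) y‖)) (hT : 0 < T₀) :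
    ∃ F B C, SelfSimilarWithError D T₀ α γ v V F B C := by
  obtain ⟨hV, ⟨M, hM⟩, ε, hε, ⟨hF1, hF2, C, hC⟩, hform⟩ := h
  obtain ⟨B, hB1, hB2, hB3⟩ := exists_slowlyVarying h0 h1 hV hd1 hd2
  refine ⟨fun x t => ε t • W x t, B, C, hB1, hB2, hB3,
    fun t ht => (hF1 t ht).differentiableOn (by norm_num), hF2, hC, ?_, fun x hx t ht => ?_⟩
  · have hc : (0 : ℝ) < (|M| + 1)⁻¹ := by positivity
    filter_upwards [hε.bound hc, Ico_mem_nhdsLT hT] with t ht htI x hx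
    have hp : 0 < T₀ - t := by linarith [htI.2]
    rw [Real.norm_of_nonneg hp.le] at ht
    rw [norm_smul]
    have h3 : ‖W x t‖ ≤ |M| + 1 := (hM x hx t htI).trans (by linarith [le_abs_self M])
    calc ‖ε t‖ * ‖W x t‖ ≤ ((|M| + 1)⁻¹ * (T₀ - t)) * (|M| + 1) :=
          mul_le_mul ht h3 (norm_nonneg _) (by positivity)
      _ = T₀ - t := by field_simp
  · rw [hform x hx t ht, selfSim, one_div, one_div, div_eq_inv_mul, mul_smul]

section CellEstimates

variable {R a b T₀ α γ B C θ κ ρ : ℝ} {v : E 3 → ℝ → E 3} {p : E 3 → ℝ → ℝ} {V : E 3 → E 3}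
  {F : E 3 → ℝ → E 3}

lemma SelfSimilarWithError.dx_eq (hR : 0 < R)
    (h : SelfSimilarWithError (cylinder R a b) T₀ α γ v V F B C) {x : E 3}
    (hx : x ∈ cylinder R a b) {t : ℝ} (ht : t ∈ Ico 0 T₀) :
    dx (pipe R) v x t = selfSim T₀ α 1 (fderiv ℝ V) x t
      + ((T₀ - t) ^ α)⁻¹ • dx (cylinder R a b) F x t := by
  have hn : cylinder R a b ∈ 𝓝 x := isOpen_cylinder.mem_nhds hx
  have h1 := hasFDerivAt_selfSim (α := α) (β := α) h.slow.diff x ht.2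
  have h2 : HasFDerivAt (fun y => F y t) (dx (cylinder R a b) F x t) x :=
    (h.diff_space t ht x hx).hasFDerivWithinAt.hasFDerivAt hn
  have h3 := h1.add (h2.const_smul ((T₀ - t) ^ α)⁻¹)
  have h4 : HasFDerivAt (fun y => v y t) _ x := h3.congr_of_eventuallyEq (by
    filter_upwards [hn] with y hy using h.form y hy t ht)
  have h5 := h4.hasFDerivWithinAt.fderivWithin (uniqueDiffOn_pipe hR x (cylinder_subset_pipe hx))
  rw [add_sub_cancel] at h5
  exact h5

lemma SelfSimilarWithError.dt_eq
    (h : SelfSimilarWithError (cylinder R a b) T₀ α γ v V F B C) {x : E 3}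
    (hx : x ∈ cylinder R a b) {t : ℝ} (ht : t ∈ Ico 0 T₀) :
    dt (Ico 0 T₀) v x t = selfSim T₀ α (α + 1) (timeProfile α α V) x t
      + (α • ((T₀ - t) ^ (α + 1))⁻¹ • F x t + ((T₀ - t) ^ α)⁻¹ • dt (Ico 0 T₀) F x t) := by
  have h1 := (hasDerivAt_selfSim (α := α) (β := α) h.slow.diff x ht.2).hasDerivWithinAt
    (s := Ico 0 T₀)
  have h2 : HasDerivWithinAt (fun s => F x s) (dt (Ico 0 T₀) F x t) (Ico 0 T₀) t :=
    (h.diff_time x hx t ht).hasDerivWithinAt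
  have h3 := h1.add ((hasDerivAt_inv_rpow ht.2 α).hasDerivWithinAt.smul h2)
  have h4 : HasDerivWithinAt (fun s => v x s) _ (Ico 0 T₀) t :=
    h3.congr (fun s hs => h.form x hx s hs) (h.form x hx t ht)
  have h5 := h4.derivWithin (uniqueDiffOn_Ico 0 T₀ t ht)
  refine Eq.trans h5 ?_
  rw [add_comm (((T₀ - t) ^ α)⁻¹ • dt (Ico 0 T₀) F x t), smul_smul]

lemma SelfSimilarWithError.nonneg (h : SelfSimilarWithError (cylinder R a b) T₀ α γ v V F B C)
    {x : E 3} (hx : x ∈ cylinder R a b) {t : ℝ} (ht : t ∈ Ico 0 T₀) : 0 ≤ C :=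
  (norm_nonneg _).trans (h.holder.1.1 (x, t) ⟨hx, ht⟩)

lemma SelfSimilarWithError.norm_le (h : SelfSimilarWithError (cylinder R a b) T₀ α γ v V F B C)
    {x : E 3} (hx : x ∈ cylinder R a b) {t : ℝ} (ht : t ∈ Ico 0 T₀) :
    ‖v x t‖ ≤ ((T₀ - t) ^ α)⁻¹ * (B + C) := by
  have hp : 0 < T₀ - t := by linarith [ht.2]
  rw [h.form x hx t ht, selfSim, ← smul_add, norm_smul, norm_inv,
    Real.norm_of_nonneg (Real.rpow_nonneg hp.le _)]
  refine mul_le_mul_of_nonneg_left ((norm_add_le _ _).trans (add_le_add (h.slow.bound _)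
    (h.holder.1.1 (x, t) ⟨hx, ht⟩))) (by positivity)

lemma mul_rpow_split (hθ : 0 < θ) (α N : ℝ) : θ * N = θ ^ (1 - α) * (θ ^ α * N) := by
  rw [← mul_assoc, ← Real.rpow_add hθ]; simp

lemma rpow_succ_mul (hθ : 0 < θ) (α N : ℝ) : θ ^ (α + 1) * N = θ * (θ ^ α * N) := by
  rw [Real.rpow_add hθ, Real.rpow_one]; ring

lemma le_norm_of_le_radius {x : E 3} {ρ : ℝ} (h : ρ ≤ radius x) : ρ ≤ ‖x‖ :=
  h.trans (radius_le_norm x)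

/-- After rescaling, the spatial derivative is of the order of the length scale `θ^(1-α)`. -/
lemma SelfSimilarWithError.dx_bound (hR : 0 < R) (h0 : 0 ≤ α) (hρ : 0 < ρ)
    (h : SelfSimilarWithError (cylinder R a b) T₀ α γ v V F B C) (hθ : 0 < θ) {x : E 3}
    (hx : x ∈ cylinder R a b) (hxρ : ρ ≤ radius x) {t : ℝ} (ht : t ∈ Ico 0 T₀)
    (hκ : θ ≤ κ * (T₀ - t)) :
    θ * ‖dx (pipe R) v x t‖ ≤ θ ^ (1 - α) * (κ ^ α * B / ρ + κ ^ α * C) := by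
  rw [h.dx_eq hR hx ht]
  refine (mul_le_mul_of_nonneg_left (norm_add_le _ _) hθ.le).trans ?_
  rw [mul_add, mul_add]
  refine add_le_add (norm_selfSim_le_of_decay h.slow.decay h0 hθ ht.2 hκ hρ
    (le_norm_of_le_radius hxρ)) ?_
  rw [mul_rpow_split hθ α]
  exact mul_le_mul_of_nonneg_left (norm_error_le h.holder.2.1 h0 hθ ht hκ hx) (by positivity)

lemma SelfSimilarWithError.dx_sub_space (hR : 0 < R) (h0 : 0 ≤ α) (h1 : α ≤ 1) (hρ : 0 < ρ)
    (h : SelfSimilarWithError (cylinder R a b) T₀ α γ v V F B C) (hθ : 0 < θ) (hθ1 : θ ≤ 1)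
    {x x' : E 3} (hx : x ∈ cylinder R a b) (hx' : x' ∈ cylinder R a b)
    (hseg : ∀ z ∈ segment ℝ x' x, ρ ≤ radius z) {t : ℝ} (ht : t ∈ Ico 0 T₀)
    (hκ : θ ≤ κ * (T₀ - t)) :
    θ * ‖dx (pipe R) v x t - dx (pipe R) v x' t‖
      ≤ κ * B / ρ * ‖x - x'‖ + κ ^ α * C * ‖x - x'‖ ^ γ := by
  rw [h.dx_eq hR hx ht, h.dx_eq hR hx' ht, add_sub_add_comm]
  refine (mul_le_mul_of_nonneg_left (norm_add_le _ _) hθ.le).trans ?_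
  rw [mul_add]
  refine add_le_add ?_ ?_
  · have := norm_selfSim_sub_space_le (α := α) h.slow_fderiv zero_le_one hθ ht.2 hκ hρ
      fun z hz => le_norm_of_le_radius (hseg z hz)
    simpa using this
  · rw [mul_rpow_split hθ α]
    refine (mul_le_of_le_one_left (by positivity)
      (Real.rpow_le_one hθ.le hθ1 (by linarith))).trans ?_
    exact norm_error_sub_space_le h.holder.2.1 h0 hθ ht hκ hx hx'

lemma SelfSimilarWithError.dx_sub_time (hR : 0 < R) (h0 : 0 ≤ α) (h1 : α ≤ 1) (hγ : 0 < γ)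
    (h : SelfSimilarWithError (cylinder R a b) T₀ α γ v V F B C) (hθ : 0 < θ) (hθ1 : θ ≤ 1)
    {x : E 3} (hx : x ∈ cylinder R a b) {t₁ : ℝ} (ht₁ : t₁ < T₀) (hκ : θ ≤ κ * (T₀ - t₁))
    {t t' : ℝ} (ht : t ∈ Icc 0 t₁) (ht' : t' ∈ Icc 0 t₁) :
    θ * ‖dx (pipe R) v x t - dx (pipe R) v x t'‖
      ≤ κ ^ ((1 : ℝ) + 1) * ((1 + 1) * B) * (|t - t'| / θ)
        + (κ ^ α * C * (|t - t'| / θ) ^ (γ / 2) + κ ^ (α + 1) * (α + 1) * C * (|t - t'| / θ)) := by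
  have hI : t ∈ Ico 0 T₀ := ⟨ht.1, ht.2.trans_lt ht₁⟩
  have hI' : t' ∈ Ico 0 T₀ := ⟨ht'.1, ht'.2.trans_lt ht₁⟩
  rw [h.dx_eq hR hx hI, h.dx_eq hR hx hI', add_sub_add_comm]
  refine (mul_le_mul_of_nonneg_left (norm_add_le _ _) hθ.le).trans ?_
  rw [mul_add]
  refine add_le_add ?_ ?_
  · have := norm_selfSim_sub_time_le h.slow_fderiv zero_le_one h0 h1 hθ ht₁ hκ x ht.2 ht'.2
    rwa [Real.rpow_one] at this
  · rw [mul_rpow_split hθ α]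
    refine (mul_le_of_le_one_left (by positivity)
      (Real.rpow_le_one hθ.le hθ1 (by linarith))).trans ?_
    exact norm_error_sub_time_le hγ h.holder.2.1 h0 hθ hθ1 ht₁ hκ ht ht' hx

lemma SelfSimilarWithError.dt_bound (h0 : 0 ≤ α) (h1 : α ≤ 1)
    (h : SelfSimilarWithError (cylinder R a b) T₀ α γ v V F B C) (hθ : 0 < θ) (hθ1 : θ ≤ 1)
    {x : E 3} (hx : x ∈ cylinder R a b) {t : ℝ} (ht : t ∈ Ico 0 T₀)
    (hκ : θ ≤ κ * (T₀ - t)) :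
    θ ^ (α + 1) * ‖dt (Ico 0 T₀) v x t‖
      ≤ κ ^ (α + 1) * B + (κ ^ (α + 1) * C + κ ^ α * C) := by
  rw [h.dt_eq hx ht]
  refine (mul_le_mul_of_nonneg_left ((norm_add_le _ _).trans
    (add_le_add_right (norm_add_le _ _) _)) (by positivity)).trans ?_
  rw [mul_add, mul_add]
  refine add_le_add (norm_selfSim_le h.slow_time.bound (by linarith) hθ ht.2 hκ x)
    (add_le_add ?_ ?_)
  · rw [norm_smul, Real.norm_of_nonneg h0, mul_left_comm]
    exact (mul_le_of_le_one_left (by positivity) h1).trans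
      (norm_error_le h.holder.1 (by linarith) hθ ht hκ hx)
  · rw [rpow_succ_mul hθ]
    exact (mul_le_of_le_one_left (by positivity) hθ1).trans
      (norm_error_le h.holder.2.2.2 h0 hθ ht hκ hx)

lemma SelfSimilarWithError.dt_sub_space (h0 : 0 ≤ α) (h1 : α ≤ 1) (hρ : 0 < ρ)
    (h : SelfSimilarWithError (cylinder R a b) T₀ α γ v V F B C) (hθ : 0 < θ) (hθ1 : θ ≤ 1)
    {x x' : E 3} (hx : x ∈ cylinder R a b) (hx' : x' ∈ cylinder R a b)
    (hseg : ∀ z ∈ segment ℝ x' x, ρ ≤ radius z) {t : ℝ} (ht : t ∈ Ico 0 T₀)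
    (hκ : θ ≤ κ * (T₀ - t)) :
    θ ^ (α + 1) * ‖dt (Ico 0 T₀) v x t - dt (Ico 0 T₀) v x' t‖
      ≤ κ ^ (α + 1) * B / ρ * ‖x - x'‖
        + (κ ^ (α + 1) * C * ‖x - x'‖ ^ γ + κ ^ α * C * ‖x - x'‖ ^ γ) := by
  rw [h.dt_eq hx ht, h.dt_eq hx' ht, add_sub_add_comm, add_sub_add_comm, ← smul_sub]
  refine (mul_le_mul_of_nonneg_left ((norm_add_le _ _).trans
    (add_le_add_right (norm_add_le _ _) _)) (by positivity)).trans ?_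
  rw [mul_add, mul_add]
  refine add_le_add (norm_selfSim_sub_space_le h.slow_time (by linarith) hθ ht.2 hκ hρ
    fun z hz => le_norm_of_le_radius (hseg z hz)) (add_le_add ?_ ?_)
  · rw [norm_smul, Real.norm_of_nonneg h0, mul_left_comm]
    exact (mul_le_of_le_one_left (by positivity) h1).trans
      (norm_error_sub_space_le h.holder.1 (by linarith) hθ ht hκ hx hx')
  · rw [rpow_succ_mul hθ]
    exact (mul_le_of_le_one_left (by positivity) hθ1).trans
      (norm_error_sub_space_le h.holder.2.2.2 h0 hθ ht hκ hx hx')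

lemma SelfSimilarWithError.dt_sub_time (h0 : 0 ≤ α) (h1 : α ≤ 1) (hγ : 0 < γ)
    (h : SelfSimilarWithError (cylinder R a b) T₀ α γ v V F B C) (hθ : 0 < θ) (hθ1 : θ ≤ 1)
    {x : E 3} (hx : x ∈ cylinder R a b) {t₁ : ℝ} (ht₁ : t₁ < T₀) (hκ : θ ≤ κ * (T₀ - t₁))
    {t t' : ℝ} (ht : t ∈ Icc 0 t₁) (ht' : t' ∈ Icc 0 t₁) :
    θ ^ (α + 1) * ‖dt (Ico 0 T₀) v x t - dt (Ico 0 T₀) v x t'‖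
      ≤ κ ^ (α + 1 + 1) * ((α + 1 + 1) * B) * (|t - t'| / θ)
        + ((κ ^ (α + 1) * C * (|t - t'| / θ) ^ (γ / 2)
            + κ ^ (α + 1 + 1) * (α + 1 + 1) * C * (|t - t'| / θ))
          + (κ ^ α * C * (|t - t'| / θ) ^ (γ / 2)
            + κ ^ (α + 1) * (α + 1) * C * (|t - t'| / θ))) := by
  have hI : t ∈ Ico 0 T₀ := ⟨ht.1, ht.2.trans_lt ht₁⟩
  have hI' : t' ∈ Ico 0 T₀ := ⟨ht'.1, ht'.2.trans_lt ht₁⟩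
  rw [h.dt_eq hx hI, h.dt_eq hx hI', add_sub_add_comm, add_sub_add_comm, ← smul_sub]
  refine (mul_le_mul_of_nonneg_left ((norm_add_le _ _).trans
    (add_le_add_right (norm_add_le _ _) _)) (by positivity)).trans ?_
  rw [mul_add, mul_add]
  refine add_le_add (norm_selfSim_sub_time_le h.slow_time (by linarith) h0 h1 hθ ht₁ hκ x
    ht.2 ht'.2) (add_le_add ?_ ?_)
  · rw [norm_smul, Real.norm_of_nonneg h0, mul_left_comm]
    exact (mul_le_of_le_one_left (by positivity) h1).trans
      (norm_error_sub_time_le hγ h.holder.1 (by linarith) hθ hθ1 ht₁ hκ ht ht' hx)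
  · rw [rpow_succ_mul hθ]
    exact (mul_le_of_le_one_left (by positivity) hθ1).trans
      (norm_error_sub_time_le hγ h.holder.2.2.2 h0 hθ hθ1 ht₁ hκ ht ht' hx)

end CellEstimates

/-! ### Uniform estimates for the rescaled solutions -/

section PipeEstimates

variable {R a b T₀ α γ B C κ ρ : ℝ} {v : E 3 → ℝ → E 3} {p : E 3 → ℝ → ℝ} {V : E 3 → E 3}
  {F : E 3 → ℝ → E 3}

lemma nonempty_cylinder (hR : 0 < R) (hab : a < b) : (cylinder R a b).Nonempty := by
  refine ⟨((a + b) / 2) • e3, ?_, ?_, ?_⟩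
  · rw [radius_smul]; simp [radius, hR]
  · simp; linarith
  · simp; linarith

lemma continuousOn_slice {G : Type*} [TopologicalSpace G] {f : E 3 → ℝ → G}
    (hf : ContinuousOn (fun z : E 3 × ℝ => f z.1 z.2) (pipe R ×ˢ Ico 0 T₀)) {t : ℝ}
    (ht : t ∈ Ico 0 T₀) : ContinuousOn (fun x => f x t) (pipe R) := by
  have : ContinuousOn (fun x : E 3 => (x, t)) (pipe R) := by fun_prop
  exact hf.comp this fun x hx => ⟨hx, ht⟩

lemma mul_add_mul_le {c₁ c₂ S r s : ℝ} (h₁ : c₁ ≤ S) (h₂ : c₂ ≤ S) (hr : 0 ≤ r) (hs : 0 ≤ s) :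
    c₁ * r + c₂ * s ≤ S * (r + s) := by
  rw [mul_add]
  exact add_le_add (mul_le_mul_of_nonneg_right h₁ hr) (mul_le_mul_of_nonneg_right h₂ hs)

/-- The estimates on the finite cylinder hold, with a common constant, on the part of the pipe away
from the axis. The number `θ` is a time scale with `θ ≤ κ (T₀ - t₁)`. -/
theorem SelfSimilarWithError.exists_pipe_estimates (hR : 0 < R) (hab : a < b) (hT : 0 < T₀)
    (hv : IsASESolution R a b T₀ v p) (h0 : 0 ≤ α) (h1 : α ≤ 1) (hγ : 0 < γ) (hρ : 0 < ρ)
    (hκ : 0 ≤ κ) (h : SelfSimilarWithError (cylinder R a b) T₀ α γ v V F B C) :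
    ∃ M, 0 ≤ M ∧ ∀ θ t₁ : ℝ, 0 < θ → θ ≤ 1 → t₁ < T₀ → θ ≤ κ * (T₀ - t₁) →
      ∀ t ∈ Icc 0 t₁,
        (∀ x ∈ pipe R, ρ < radius x →
          θ * ‖dx (pipe R) v x t‖ ≤ M * θ ^ (1 - α) ∧
          θ ^ (α + 1) * ‖dt (Ico 0 T₀) v x t‖ ≤ M ∧
          ∀ t' ∈ Icc 0 t₁,
            θ * ‖dx (pipe R) v x t - dx (pipe R) v x t'‖
              ≤ M * (|t - t'| / θ + (|t - t'| / θ) ^ (γ / 2)) ∧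
            θ ^ (α + 1) * ‖dt (Ico 0 T₀) v x t - dt (Ico 0 T₀) v x t'‖
              ≤ M * (|t - t'| / θ + (|t - t'| / θ) ^ (γ / 2))) ∧
        ∀ U : Set (E 3), IsOpen U → Convex ℝ U → (∀ z ∈ U, ρ ≤ radius z) →
          (∀ x ∈ U, ∀ x' ∈ U, |x 2 - x' 2| < b - a) →
          ∀ x ∈ pipe R, ∀ x' ∈ pipe R, x ∈ U → x' ∈ U →
            θ * ‖dx (pipe R) v x t - dx (pipe R) v x' t‖ ≤ M * (‖x - x'‖ + ‖x - x'‖ ^ γ) ∧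
            θ ^ (α + 1) * ‖dt (Ico 0 T₀) v x t - dt (Ico 0 T₀) v x' t‖
              ≤ M * (‖x - x'‖ + ‖x - x'‖ ^ γ) := by
  have hB : 0 ≤ B := h.slow.nonneg
  obtain ⟨x₀, hx₀⟩ := nonempty_cylinder (R := R) hR hab
  have hC : 0 ≤ C := h.nonneg hx₀ (t := 0) ⟨le_rfl, hT⟩
  have p1 : 0 ≤ κ ^ α * B / ρ := by positivity
  have p2 : 0 ≤ κ ^ α * C := by positivity
  have p3 : 0 ≤ κ * B / ρ := by positivity
  have p4 : 0 ≤ κ ^ ((1 : ℝ) + 1) * ((1 + 1) * B) := by positivity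
  have p5 : 0 ≤ κ ^ (α + 1) * (α + 1) * C := by positivity
  have p6 : 0 ≤ κ ^ (α + 1) * B := by positivity
  have p7 : 0 ≤ κ ^ (α + 1) * C := by positivity
  have p8 : 0 ≤ κ ^ (α + 1) * B / ρ := by positivity
  have p9 : 0 ≤ κ ^ (α + 1 + 1) * ((α + 1 + 1) * B) := by positivity
  have p10 : 0 ≤ κ ^ (α + 1 + 1) * (α + 1 + 1) * C := by positivity
  -- the sum of all constants in the estimates on the finite cylinder; the factor `2` below comes
  -- from joining two cells through their common face
  set S : ℝ := κ ^ α * B / ρ + κ ^ α * C + κ * B / ρ + κ ^ ((1 : ℝ) + 1) * ((1 + 1) * B)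
    + κ ^ (α + 1) * (α + 1) * C + κ ^ (α + 1) * B + κ ^ (α + 1) * C + κ ^ (α + 1) * B / ρ
    + κ ^ (α + 1 + 1) * ((α + 1 + 1) * B) + κ ^ (α + 1 + 1) * (α + 1 + 1) * C with hS
  have hS0 : 0 ≤ S := by positivity
  refine ⟨2 * S, by positivity, fun θ t₁ hθ hθ1 ht₁ hθκ t ht => ?_⟩
  have hSS : S ≤ 2 * S := by linarith
  have hI : ∀ {s}, s ∈ Icc 0 t₁ → s ∈ Ico 0 T₀ := fun hs => ⟨hs.1, hs.2.trans_lt ht₁⟩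
  have hκt : θ ≤ κ * (T₀ - t) := hθκ.trans (mul_le_mul_of_nonneg_left (by linarith [ht.2]) hκ)
  have hcdx : ∀ {s}, s ∈ Icc 0 t₁ → ContinuousOn (fun x => dx (pipe R) v x s) (pipe R) :=
    fun hs => continuousOn_slice hv.euler.continuous_dx (hI hs)
  have hcdt : ∀ {s}, s ∈ Icc 0 t₁ → ContinuousOn (fun x => dt (Ico 0 T₀) v x s) (pipe R) :=
    fun hs => continuousOn_slice hv.euler.continuous_dt (hI hs)
  have aθ : |θ| = θ := abs_of_pos hθ
  have aθ' : |θ ^ (α + 1)| = θ ^ (α + 1) := abs_of_pos (Real.rpow_pos_of_pos hθ _)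
  refine ⟨fun x hx hxρ => ⟨?_, ?_, fun t' ht' => ⟨?_, ?_⟩⟩,
    fun U hUo hUc hUρ hUL x hx x' hx' hxU hxU' => ⟨?_, ?_⟩⟩
  · have := norm_le_on_pipe (g := fun x => θ • dx (pipe R) v x t) (M := 2 * S * θ ^ (1 - α)) hR hab
      ((hcdx ht).const_smul θ) (fun y hy m => by rw [hv.dx_shift hR hy (hI ht)])
      (fun y hy hyρ => by
        rw [norm_smul, Real.norm_eq_abs, aθ]
        refine (h.dx_bound hR h0 hρ hθ hy hyρ (hI ht) hκt).trans ?_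
        rw [mul_comm]
        exact mul_le_mul_of_nonneg_right (by linarith) (by positivity)) hx hxρ
    rwa [norm_smul, Real.norm_eq_abs, aθ] at this
  · have := norm_le_on_pipe (g := fun x => θ ^ (α + 1) • dt (Ico 0 T₀) v x t) (M := 2 * S) hR hab
      ((hcdt ht).const_smul (θ ^ (α + 1))) (fun y hy m => by rw [hv.dt_shift hy (hI ht)])
      (fun y hy hyρ => by
        rw [norm_smul, Real.norm_eq_abs, aθ']
        exact (h.dt_bound h0 h1 hθ hθ1 hy (hI ht) hκt).trans (by linarith)) hx hxρ
    rwa [norm_smul, Real.norm_eq_abs, aθ'] at this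
  · have := norm_le_on_pipe (g := fun x => θ • (dx (pipe R) v x t - dx (pipe R) v x t'))
      (M := 2 * S * (|t - t'| / θ + (|t - t'| / θ) ^ (γ / 2))) hR hab
      (((hcdx ht).sub (hcdx ht')).const_smul θ)
      (fun y hy m => by rw [hv.dx_shift hR hy (hI ht), hv.dx_shift hR hy (hI ht')])
      (fun y hy hyρ => by
        rw [norm_smul, Real.norm_eq_abs, aθ]
        refine (h.dx_sub_time hR h0 h1 hγ hθ hθ1 hy ht₁ hθκ ht ht').trans ?_
        refine le_trans (le_of_eq (by ring)) (mul_add_mul_le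
          (c₁ := κ ^ ((1 : ℝ) + 1) * ((1 + 1) * B) + κ ^ (α + 1) * (α + 1) * C)
          (c₂ := κ ^ α * C) (by linarith) (by linarith) (by positivity) (by positivity))) hx hxρ
    rwa [norm_smul, Real.norm_eq_abs, aθ] at this
  · have := norm_le_on_pipe
      (g := fun x => θ ^ (α + 1) • (dt (Ico 0 T₀) v x t - dt (Ico 0 T₀) v x t'))
      (M := 2 * S * (|t - t'| / θ + (|t - t'| / θ) ^ (γ / 2))) hR hab
      (((hcdt ht).sub (hcdt ht')).const_smul (θ ^ (α + 1)))
      (fun y hy m => by rw [hv.dt_shift hy (hI ht), hv.dt_shift hy (hI ht')])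
      (fun y hy hyρ => by
        rw [norm_smul, Real.norm_eq_abs, aθ']
        refine (h.dt_sub_time h0 h1 hγ hθ hθ1 hy ht₁ hθκ ht ht').trans ?_
        refine le_trans (le_of_eq (by ring)) (mul_add_mul_le
          (c₁ := κ ^ (α + 1 + 1) * ((α + 1 + 1) * B) + κ ^ (α + 1 + 1) * (α + 1 + 1) * C
            + κ ^ (α + 1) * (α + 1) * C)
          (c₂ := κ ^ (α + 1) * C + κ ^ α * C)
          (by linarith) (by linarith) (by positivity) (by positivity))) hx hxρ
    rwa [norm_smul, Real.norm_eq_abs, aθ'] at this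
  · have := norm_sub_le_on_pipe (g := fun x => θ • dx (pipe R) v x t) (M := S) (γ := γ) (ρ := ρ)
      hR hab hγ hS0 ((hcdx ht).const_smul θ) (fun y hy m => by rw [hv.dx_shift hR hy (hI ht)])
      (fun y hy y' hy' hseg => by
        rw [← smul_sub, norm_smul, Real.norm_eq_abs, aθ]
        refine (h.dx_sub_space hR h0 h1 hρ hθ hθ1 hy hy' hseg (hI ht) hκt).trans ?_
        exact mul_add_mul_le (by linarith) (by linarith) (by positivity) (by positivity))
      hUo hUc hUρ hUL hx hx' hxU hxU'
    rwa [← smul_sub, norm_smul, Real.norm_eq_abs, aθ] at this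
  · have := norm_sub_le_on_pipe (g := fun x => θ ^ (α + 1) • dt (Ico 0 T₀) v x t) (M := S) (γ := γ)
      (ρ := ρ) hR hab hγ hS0 ((hcdt ht).const_smul (θ ^ (α + 1)))
      (fun y hy m => by rw [hv.dt_shift hy (hI ht)])
      (fun y hy y' hy' hseg => by
        rw [← smul_sub, norm_smul, Real.norm_eq_abs, aθ']
        refine (h.dt_sub_space h0 h1 hρ hθ hθ1 hy hy' hseg (hI ht) hκt).trans ?_
        refine le_trans (le_of_eq (by ring)) (mul_add_mul_le
          (c₁ := κ ^ (α + 1) * B / ρ) (c₂ := κ ^ (α + 1) * C + κ ^ α * C)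
          (by linarith) (by linarith) (by positivity) (by positivity)))
      hUo hUc hUρ hUL hx hx' hxU hxU'
    rwa [← smul_sub, norm_smul, Real.norm_eq_abs, aθ'] at this

/-- The self-similar blow-up rate. -/
lemma SelfSimilarWithError.norm_le_pipe (hR : 0 < R) (hab : a < b)
    (hv : IsASESolution R a b T₀ v p)
    (h : SelfSimilarWithError (cylinder R a b) T₀ α γ v V F B C) {x : E 3} (hx : x ∈ pipe R)
    {t : ℝ} (ht : t ∈ Ico 0 T₀) : ‖v x t‖ ≤ ((T₀ - t) ^ α)⁻¹ * (B + C) :=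
  norm_le_on_pipe (g := fun x => v x t) (ρ := -1) hR hab
    (continuousOn_slice hv.euler.continuous ht)
    (fun _ hy m => hv.map_shift hy ht m) (fun _ hy _ => h.norm_le hy ht) hx
    (by linarith [radius_nonneg x])

lemma convex_cylinder : Convex ℝ (cylinder R a b) := by
  intro x hx y hy c d hc hd hcd
  obtain ⟨hx1, hx2, hx3⟩ : radius x < R ∧ a < x 2 ∧ x 2 < b := hx
  obtain ⟨hy1, hy2, hy3⟩ : radius y < R ∧ a < y 2 ∧ y 2 < b := hy
  have hlt : ∀ {r s M : ℝ}, r < M → s < M → c * r + d * s < M := by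
    intro r s M hr hs
    rcases hc.eq_or_lt with h | h
    · have : d = 1 := by linarith
      rw [← h, this]; linarith
    · have h1 := mul_lt_mul_of_pos_left hr h
      have h2 := mul_le_mul_of_nonneg_left hs.le hd
      have h3 : c * M + d * M = M := by rw [← add_mul, hcd, one_mul]
      linarith
  have e2 : (c • x + d • y) 2 = c * x 2 + d * y 2 := by simp
  refine ⟨(radius_add_le _ _).trans_lt ?_, ?_, ?_⟩
  · rw [radius_smul, radius_smul, abs_of_nonneg hc, abs_of_nonneg hd]
    exact hlt hx1 hy1
  · rw [e2]
    have := hlt (neg_lt_neg hx2) (neg_lt_neg hy2)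
    linarith
  · rw [e2]
    exact hlt hx3 hy3

variable {xs : E 3} {x : ℕ → E 3} {t Q : ℕ → ℝ}

/-- The profile does not vanish on the part of space that the rescaled finite cylinders see:
otherwise the solution would stay bounded. -/
lemma SelfSimilarWithError.exists_profile_ne_zero (hR : 0 < R) (hab : a < b) (h1 : α < 1)
    (hT : 0 < T₀) (hv : IsASESolution R a b T₀ v p)
    (hB : IsBlowUpSequence R T₀ v xs x t Q)
    (h : SelfSimilarWithError (cylinder R a b) T₀ α γ v V F B C) :
    ∃ x₁ ∈ cylinder R a b, ∃ t₁ ∈ Ico 0 T₀, V (((T₀ - t₁) ^ (1 - α))⁻¹ • x₁) ≠ 0 := by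
  by_contra! hcon
  have hev : ∀ᶠ s in 𝓝[<] T₀, ∀ y ∈ pipe R, ‖v y s‖ ≤ 1 := by
    filter_upwards [h.small, Ico_mem_nhdsLT hT, Ico_mem_nhdsLT (by linarith : T₀ - 1 < T₀)]
      with s hs hsI hs1 y hy
    have hp : 0 < T₀ - s := by linarith [hsI.2]
    refine norm_le_on_pipe (g := fun x => v x s) (ρ := -1) hR hab
      (continuousOn_slice hv.euler.continuous hsI)
      (fun _ hy m => hv.map_shift hy hsI m) (fun z hz _ => ?_) hy
      (by linarith [radius_nonneg y])
    rw [h.form z hz s hsI, selfSim, hcon z hz s hsI, smul_zero, zero_add, norm_smul, norm_inv,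
      Real.norm_of_nonneg (Real.rpow_nonneg hp.le _), inv_mul_le_iff₀ (Real.rpow_pos_of_pos hp _),
      mul_one]
    refine (hs z hz).trans ?_
    calc T₀ - s = (T₀ - s) ^ (1 : ℝ) := (Real.rpow_one _).symm
      _ ≤ (T₀ - s) ^ α := Real.rpow_le_rpow_of_exponent_ge hp (by linarith [hs1.1]) h1.le
  have htl : Tendsto t atTop (𝓝[<] T₀) :=
    tendsto_nhdsWithin_iff.2 ⟨hB.tendsto_time, Eventually.of_forall fun k => (hB.mem_time k).2⟩
  obtain ⟨k, hk1, hk2⟩ := ((htl.eventually hev).and (hB.blowUp.eventually_gt_atTop 1)).exists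
  exact absurd (hk1 _ (hB.mem_space k)) (not_le.2 hk2)

/-- At near maximal points the time scale is at most comparable to the time to blow-up. -/
lemma SelfSimilarWithError.exists_timeScale_le (hR : 0 < R) (hab : a < b) (h0 : 0 < α) (h1 : α < 1)
    (hT : 0 < T₀) (hv : IsASESolution R a b T₀ v p)
    (hcl : (0 : E 3) ∈ closure (cylinder R a b))
    (hB : IsBlowUpSequence R T₀ v xs x t Q) (hN : IsNearMaximal R v x t)
    (h : SelfSimilarWithError (cylinder R a b) T₀ α γ v V F B C) :
    ∃ κ, 0 ≤ κ ∧ ∀ᶠ k in atTop, timeScale α (Q k) ≤ κ * (T₀ - t k) := by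
  obtain ⟨x₁, hx₁, t₁, ht₁, hne⟩ := h.exists_profile_ne_zero hR hab h1 hT hv hB
  set y₁ := ((T₀ - t₁) ^ (1 - α))⁻¹ • x₁ with hy₁
  have hp₁ : 0 < T₀ - t₁ := by linarith [ht₁.2]
  obtain ⟨c, hc, hk⟩ := hB.comparable
  obtain ⟨c', hc', hmax⟩ := hN
  have hcpos : 0 < c := by linarith
  have hV : 0 < ‖V y₁‖ := norm_pos_iff.2 hne
  set m : ℝ := c⁻¹ * (c' * (‖V y₁‖ / 2)) with hm
  have hmpos : 0 < m := by positivity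
  have htl : Tendsto t atTop (𝓝[<] T₀) :=
    tendsto_nhdsWithin_iff.2 ⟨hB.tendsto_time, Eventually.of_forall fun k => (hB.mem_time k).2⟩
  refine ⟨m ^ (-1 / α), by positivity, ?_⟩
  filter_upwards [htl.eventually h.small, htl.eventually (Ico_mem_nhdsLT ht₁.2),
    htl.eventually (Ico_mem_nhdsLT (by linarith : T₀ - ‖V y₁‖ / 2 < T₀))] with k hsmall hkt hkV
  have hI := hB.mem_time k
  have hp : 0 < T₀ - t k := by linarith [hI.2]
  -- the point of the cylinder at which the self-similar variable is `y₁`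
  set z : E 3 := (T₀ - t k) ^ (1 - α) • y₁ with hz
  have hzD : z ∈ cylinder R a b := by
    set lam : ℝ := (T₀ - t k) ^ (1 - α) * ((T₀ - t₁) ^ (1 - α))⁻¹ with hlam
    have hl0 : 0 < lam := by positivity
    have hl1 : lam ≤ 1 := by
      rw [hlam, mul_inv_le_iff₀ (by positivity), one_mul]
      exact Real.rpow_le_rpow hp.le (by linarith [hkt.1]) (by linarith)
    have h2 := convex_cylinder.combo_closure_interior_mem_interior hcl
      (isOpen_cylinder.interior_eq.symm ▸ hx₁) (by linarith : 0 ≤ 1 - lam) hl0 (by ring)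
    rw [smul_zero, zero_add, isOpen_cylinder.interior_eq] at h2
    rwa [hz, hy₁, smul_smul]
  have hpα := Real.rpow_pos_of_pos hp α
  have hlow : ((T₀ - t k) ^ α)⁻¹ * (‖V y₁‖ / 2) ≤ ‖v z (t k)‖ := by
    rw [h.form z hzD _ hI, selfSim, hz, smul_smul, inv_mul_cancel₀ (by positivity), one_smul,
      ← smul_add, norm_smul, norm_inv, Real.norm_of_nonneg hpα.le]
    refine mul_le_mul_of_nonneg_left ?_ (by positivity)
    have h2 := hsmall z hzD
    have h3 := norm_sub_le_norm_add (V y₁) (F z (t k))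
    rw [← hz]
    linarith [hkV.1]
  have hQ : m * (T₀ - t k) ^ (-α) ≤ Q k := by
    have h2 := hmax k z (cylinder_subset_pipe hzD) (t k) ⟨hI.1, le_rfl⟩
    have h3 := (hk k).1
    have h4 := mul_le_mul_of_nonneg_left hlow hc'.le
    calc m * (T₀ - t k) ^ (-α) = c⁻¹ * (c' * (((T₀ - t k) ^ α)⁻¹ * (‖V y₁‖ / 2))) := by
          rw [hm, Real.rpow_neg hp.le]; ring
      _ ≤ c⁻¹ * ‖v (x k) (t k)‖ := mul_le_mul_of_nonneg_left (h4.trans h2) (by positivity)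
      _ ≤ Q k := h3
  have hαneg : -1 / α ≤ 0 := div_nonpos_of_nonpos_of_nonneg (by norm_num) h0.le
  calc timeScale α (Q k) ≤ (m * (T₀ - t k) ^ (-α)) ^ (-1 / α) :=
        Real.rpow_le_rpow_of_nonpos (by positivity) hQ hαneg
    _ = m ^ (-1 / α) * (T₀ - t k) := by
        rw [Real.mul_rpow hmpos.le (by positivity), ← Real.rpow_mul hp.le]
        congr 1
        have : -α * (-1 / α) = 1 := by field_simp
        rw [this, Real.rpow_one]

end PipeEstimates

section Uniform

/-- Uniform estimates for the rescaled velocities, in balls of arbitrary radius `N`, for large `k`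
depending on `N`: bounds, decay in time at the centre, derivatives, and the increments of the
derivatives in time and in space. -/
structure UniformEstimates (R α γ : ℝ) (v : E 3 → ℝ → E 3) (x : ℕ → E 3) (t Q : ℕ → ℝ)
    (M : ℝ) : Prop where
  nonneg : 0 ≤ M
  norm_le : ∀ᶠ k in atTop, ∀ y ∈ scaledX R α (Q k) (x k), ∀ s ∈ scaledI α (Q k) (t k),
    ‖scaledV α (Q k) (x k) (t k) v y s‖ ≤ M
  decay : ∀ᶠ k in atTop, ∀ s ∈ scaledI α (Q k) (t k), s < 0 →
    ‖scaledV α (Q k) (x k) (t k) v 0 s‖ ≤ M * (|s| ^ α)⁻¹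
  dx_le : ∀ N : ℝ, ∀ᶠ k in atTop, ∀ y ∈ scaledX R α (Q k) (x k), ‖y‖ ≤ N →
    ∀ s ∈ scaledI α (Q k) (t k),
      ‖dx (scaledX R α (Q k) (x k)) (scaledV α (Q k) (x k) (t k) v) y s‖ ≤ M * lenScale α (Q k)
  dt_le : ∀ N : ℝ, ∀ᶠ k in atTop, ∀ y ∈ scaledX R α (Q k) (x k), ‖y‖ ≤ N →
    ∀ s ∈ scaledI α (Q k) (t k),
      ‖dt (scaledI α (Q k) (t k)) (scaledV α (Q k) (x k) (t k) v) y s‖ ≤ M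
  dx_time : ∀ N : ℝ, ∀ᶠ k in atTop, ∀ y ∈ scaledX R α (Q k) (x k), ‖y‖ ≤ N →
    ∀ s ∈ scaledI α (Q k) (t k), ∀ s' ∈ scaledI α (Q k) (t k),
      ‖dx (scaledX R α (Q k) (x k)) (scaledV α (Q k) (x k) (t k) v) y s
        - dx (scaledX R α (Q k) (x k)) (scaledV α (Q k) (x k) (t k) v) y s'‖
          ≤ M * (|s - s'| + |s - s'| ^ (γ / 2))
  dt_time : ∀ N : ℝ, ∀ᶠ k in atTop, ∀ y ∈ scaledX R α (Q k) (x k), ‖y‖ ≤ N →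
    ∀ s ∈ scaledI α (Q k) (t k), ∀ s' ∈ scaledI α (Q k) (t k),
      ‖dt (scaledI α (Q k) (t k)) (scaledV α (Q k) (x k) (t k) v) y s
        - dt (scaledI α (Q k) (t k)) (scaledV α (Q k) (x k) (t k) v) y s'‖
          ≤ M * (|s - s'| + |s - s'| ^ (γ / 2))
  dx_space : ∀ N : ℝ, ∀ᶠ k in atTop, ∀ y ∈ scaledX R α (Q k) (x k),
    ∀ y' ∈ scaledX R α (Q k) (x k), ‖y‖ ≤ N → ‖y'‖ ≤ N → ∀ s ∈ scaledI α (Q k) (t k),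
      ‖dx (scaledX R α (Q k) (x k)) (scaledV α (Q k) (x k) (t k) v) y s
        - dx (scaledX R α (Q k) (x k)) (scaledV α (Q k) (x k) (t k) v) y' s‖
          ≤ M * (lenScale α (Q k) + lenScale α (Q k) ^ γ) * (‖y - y'‖ + ‖y - y'‖ ^ γ)
  dt_space : ∀ N : ℝ, ∀ᶠ k in atTop, ∀ y ∈ scaledX R α (Q k) (x k),
    ∀ y' ∈ scaledX R α (Q k) (x k), ‖y‖ ≤ N → ‖y'‖ ≤ N → ∀ s ∈ scaledI α (Q k) (t k),
      ‖dt (scaledI α (Q k) (t k)) (scaledV α (Q k) (x k) (t k) v) y s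
        - dt (scaledI α (Q k) (t k)) (scaledV α (Q k) (x k) (t k) v) y' s‖
          ≤ M * (lenScale α (Q k) + lenScale α (Q k) ^ γ) * (‖y - y'‖ + ‖y - y'‖ ^ γ)

lemma UniformEstimates.comp {R α γ : ℝ} {v : E 3 → ℝ → E 3} {x : ℕ → E 3} {t Q : ℕ → ℝ} {M : ℝ}
    (h : UniformEstimates R α γ v x t Q M) {φ : ℕ → ℕ} (hφ : StrictMono φ) :
    UniformEstimates R α γ v (x ∘ φ) (t ∘ φ) (Q ∘ φ) M where
  nonneg := h.nonneg
  norm_le := hφ.tendsto_atTop.eventually h.norm_le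
  decay := hφ.tendsto_atTop.eventually h.decay
  dx_le N := hφ.tendsto_atTop.eventually (h.dx_le N)
  dt_le N := hφ.tendsto_atTop.eventually (h.dt_le N)
  dx_time N := hφ.tendsto_atTop.eventually (h.dx_time N)
  dt_time N := hφ.tendsto_atTop.eventually (h.dt_time N)
  dx_space N := hφ.tendsto_atTop.eventually (h.dx_space N)
  dt_space N := hφ.tendsto_atTop.eventually (h.dt_space N)

variable {R a b T₀ α γ B C κ ρ : ℝ} {v : E 3 → ℝ → E 3} {p : E 3 → ℝ → ℝ} {V : E 3 → E 3}
  {F : E 3 → ℝ → E 3} {xs : E 3} {x : ℕ → E 3} {t Q : ℕ → ℝ}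

lemma lenScale_eq_rpow {Q : ℝ} (hQ : 0 < Q) : lenScale α Q = timeScale α Q ^ (1 - α) := by
  unfold lenScale timeScale
  rw [← Real.rpow_mul hQ.le]; congr 1; ring

lemma inv_eq_rpow {Q : ℝ} (h0 : 0 < α) (hQ : 0 < Q) : Q⁻¹ = timeScale α Q ^ α := by
  unfold timeScale
  rw [← Real.rpow_mul hQ.le, ← Real.rpow_neg_one]; congr 1; field_simp

lemma unscaleT_sub {Q t₀ s s' : ℝ} (hQ : 0 < Q) :
    |unscaleT α Q t₀ s - unscaleT α Q t₀ s'| / timeScale α Q = |s - s'| := by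
  have h := timeScale_pos (α := α) hQ
  rw [unscaleT_eq, unscaleT_eq, add_sub_add_right_eq_sub, ← mul_sub, abs_mul, abs_of_pos h]
  field_simp

lemma unscaleX_sub {Q : ℝ} {x₀ y y' : E 3} (hQ : 0 < Q) :
    ‖unscaleX α Q x₀ y - unscaleX α Q x₀ y'‖ = lenScale α Q * ‖y - y'‖ := by
  rw [unscaleX_eq, unscaleX_eq, add_sub_add_right_eq_sub, ← smul_sub, norm_smul,
    Real.norm_of_nonneg (lenScale_pos hQ).le]

lemma scaled_increment_le {e r M γ : ℝ} (hM : 0 ≤ M) (he : 0 ≤ e) (hr : 0 ≤ r) :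
    M * (e * r + (e * r) ^ γ) ≤ M * (e + e ^ γ) * (r + r ^ γ) := by
  rw [mul_assoc, Real.mul_rpow he hr]
  refine mul_le_mul_of_nonneg_left ?_ hM
  have h1 : 0 ≤ e ^ γ := Real.rpow_nonneg he _
  have h2 : 0 ≤ r ^ γ := Real.rpow_nonneg hr _
  nlinarith [mul_nonneg he h2, mul_nonneg h1 hr]

/-- Near maximal points of an asymptotically self-similar solution have rescaled velocities with
uniform estimates, whose dependence on the spatial variable disappears in the limit. -/
theorem SelfSimilarWithError.exists_uniformEstimates (hR : 0 < R) (hab : a < b) (h0 : 0 < α)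
    (h1 : α < 1) (hγ : 0 < γ) (hT : 0 < T₀) (hv : IsASESolution R a b T₀ v p)
    (hcl : (0 : E 3) ∈ closure (cylinder R a b))
    (hB : IsBlowUpSequence R T₀ v xs x t Q) (hN : IsNearMaximal R v x t)
    (h : SelfSimilarWithError (cylinder R a b) T₀ α γ v V F B C) :
    ∃ M, UniformEstimates R α γ v x t Q M := by
  obtain ⟨κ, hκ, hκk⟩ := h.exists_timeScale_le hR hab h0 h1 hT hv hcl hB hN
  obtain ⟨d, hd, hdk⟩ := hB.off_axis
  obtain ⟨M, hM, hest⟩ := h.exists_pipe_estimates hR hab hT hv h0.le h1.le hγ (half_pos hd) hκ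
  obtain ⟨c, hc, hk⟩ := hB.comparable
  obtain ⟨c', hc', hmax⟩ := hN
  have hcpos : 0 < c := by linarith
  have hBC : 0 ≤ B + C := by
    obtain ⟨x₀, hx₀⟩ := nonempty_cylinder (R := R) hR hab
    exact add_nonneg h.slow.nonneg (h.nonneg hx₀ (t := 0) ⟨le_rfl, hT⟩)
  set M' : ℝ := M + c'⁻¹ * c + (B + C) with hM'
  have hcc : 0 ≤ c'⁻¹ * c := by positivity
  have hMM' : M ≤ M' := by rw [hM']; linarith
  have hM'0 : 0 ≤ M' := hM.trans hMM'
  have hθ : ∀ k, 0 < timeScale α (Q k) := fun k => timeScale_pos (hB.pos k)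
  have hε : ∀ k, 0 < lenScale α (Q k) := fun k => lenScale_pos (hB.pos k)
  have hθ1 : ∀ᶠ k in atTop, timeScale α (Q k) ≤ 1 :=
    (hB.tendsto_timeScale h0).eventually (ge_mem_nhds one_pos)
  have htp := hB.eventually_time_pos hT
  have hI : ∀ {k s}, s ∈ scaledI α (Q k) (t k) → unscaleT α (Q k) (t k) s ∈ Icc 0 (t k) ∧
      unscaleT α (Q k) (t k) s ∈ Ico 0 T₀ := fun {k s} hs =>
    unscaleT_mem (hB.pos k) (hB.mem_time k).2 hs
  -- the ball around `x k` on which the estimates are applied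
  set r : ℝ := min (d / 2) ((b - a) / 2) with hr
  have hrpos : 0 < r := lt_min (half_pos hd) (by linarith)
  have hball : ∀ N : ℝ, ∀ᶠ k in atTop, ∀ y : E 3, ‖y‖ ≤ N →
      unscaleX α (Q k) (x k) y ∈ Metric.ball (x k) r := by
    intro N
    have h2 : Tendsto (fun k => lenScale α (Q k) * N) atTop (𝓝 0) := by
      simpa using (hB.tendsto_lenScale h0 h1).mul_const N
    filter_upwards [h2.eventually (gt_mem_nhds hrpos)] with k hk2 y hy
    rw [mem_ball_iff_norm, unscaleX_eq, add_sub_cancel_right, norm_smul,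
      Real.norm_of_nonneg (hε k).le]
    exact (mul_le_mul_of_nonneg_left hy (hε k).le).trans_lt hk2
  have hUρ : ∀ k, ∀ z ∈ Metric.ball (x k) r, d / 2 < radius z := by
    intro k z hz
    rw [mem_ball_iff_norm] at hz
    have h2 := abs_le.1 (abs_radius_sub_le z (x k))
    have h3 : r ≤ d / 2 := min_le_left _ _
    linarith [hdk k, h2.1]
  have hUL : ∀ k, ∀ z ∈ Metric.ball (x k) r, ∀ z' ∈ Metric.ball (x k) r,
      |z 2 - z' 2| < b - a := by
    intro k z hz z' hz'
    have h2 : |z 2 - z' 2| ≤ ‖z - z'‖ := PiLp.norm_apply_le (z - z') 2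
    have h3 : ‖z - z'‖ < r + r := by
      rw [← dist_eq_norm]
      exact (dist_triangle_right z z' (x k)).trans_lt (add_lt_add hz hz')
    have h4 : r ≤ (b - a) / 2 := min_le_right _ _
    linarith
  have hdx : ∀ {k y s}, y ∈ scaledX R α (Q k) (x k) → s ∈ scaledI α (Q k) (t k) →
      dx (scaledX R α (Q k) (x k)) (scaledV α (Q k) (x k) (t k) v) y s =
      timeScale α (Q k) • dx (pipe R) v (unscaleX α (Q k) (x k) y) (unscaleT α (Q k) (t k) s) :=
    fun {k y s} hy hs => dx_scaledV hR h0.ne' (hB.pos k) hv hy (hI hs).2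
  have hdt : ∀ {k y s}, 0 < t k → y ∈ scaledX R α (Q k) (x k) → s ∈ scaledI α (Q k) (t k) →
      dt (scaledI α (Q k) (t k)) (scaledV α (Q k) (x k) (t k) v) y s =
      timeScale α (Q k) ^ (α + 1) •
        dt (Ico 0 T₀) v (unscaleX α (Q k) (x k) y) (unscaleT α (Q k) (t k) s) := by
    intro k y s hk hy hs
    rw [dt_scaledV (hB.pos k) hk (hB.mem_time k).2 hv hy hs, inv_eq_rpow h0 (hB.pos k),
      Real.rpow_add (hθ k), Real.rpow_one]
  have aθ : ∀ k, |timeScale α (Q k)| = timeScale α (Q k) := fun k => abs_of_pos (hθ k)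
  have aθ' : ∀ k, |timeScale α (Q k) ^ (α + 1)| = timeScale α (Q k) ^ (α + 1) :=
    fun k => abs_of_pos (Real.rpow_pos_of_pos (hθ k) _)
  refine ⟨M', hM'0, ?_, ?_, fun N => ?_, fun N => ?_, fun N => ?_, fun N => ?_, fun N => ?_,
    fun N => ?_⟩
  · refine Eventually.of_forall fun k y hy s hs => ?_
    have hQ := hB.pos k
    simp only [scaledV, norm_smul, norm_inv, Real.norm_eq_abs, abs_of_pos hQ]
    have h2 := hmax k _ hy _ (hI hs).1
    have h3 := (hk k).1
    rw [inv_mul_le_iff₀ hcpos] at h3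
    rw [inv_mul_le_iff₀ hQ]
    have h4 : ‖v (unscaleX α (Q k) (x k) y) (unscaleT α (Q k) (t k) s)‖ ≤ c'⁻¹ * (c * Q k) := by
      rw [le_inv_mul_iff₀ hc']; linarith
    have h5 : c'⁻¹ * (c * Q k) = Q k * (c'⁻¹ * c) := by ring
    rw [h5] at h4
    exact h4.trans (mul_le_mul_of_nonneg_left (by rw [hM']; linarith) hQ.le)
  · refine Eventually.of_forall fun k s hs hs0 => ?_
    have hQ := hB.pos k
    have h0mem : unscaleX α (Q k) (x k) 0 ∈ pipe R := by
      simpa [unscaleX_eq] using hB.mem_space k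
    have h2 := h.norm_le_pipe hR hab hv h0mem (hI hs).2
    have h3 : timeScale α (Q k) * |s| ≤ T₀ - unscaleT α (Q k) (t k) s := by
      rw [unscaleT_eq, abs_of_neg hs0]
      linarith [(hB.mem_time k).2]
    have hspos : 0 < |s| := abs_pos.2 hs0.ne
    have h4 : ((T₀ - unscaleT α (Q k) (t k) s) ^ α)⁻¹ ≤ ((timeScale α (Q k) * |s|) ^ α)⁻¹ :=
      inv_anti₀ (Real.rpow_pos_of_pos (mul_pos (hθ k) hspos) _)
        (Real.rpow_le_rpow (mul_pos (hθ k) hspos).le h3 h0.le)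
    simp only [scaledV, norm_smul, norm_inv, Real.norm_eq_abs, abs_of_pos hQ]
    rw [inv_eq_rpow h0 hQ]
    have hθα := Real.rpow_pos_of_pos (hθ k) α
    calc timeScale α (Q k) ^ α *
          ‖v (unscaleX α (Q k) (x k) 0) (unscaleT α (Q k) (t k) s)‖
        ≤ timeScale α (Q k) ^ α * (((timeScale α (Q k) * |s|) ^ α)⁻¹ * (B + C)) :=
          mul_le_mul_of_nonneg_left (h2.trans (mul_le_mul_of_nonneg_right h4 hBC)) hθα.le
      _ = (B + C) * (|s| ^ α)⁻¹ := by
          rw [Real.mul_rpow (hθ k).le hspos.le]; field_simp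
      _ ≤ M' * (|s| ^ α)⁻¹ := mul_le_mul_of_nonneg_right (by rw [hM']; linarith) (by positivity)
  · filter_upwards [hκk, hθ1, hball N] with k hk1 hk2 hk3 y hy hyN s hs
    have h2 := ((hest _ _ (hθ k) hk2 (hB.mem_time k).2 hk1 _ (hI hs).1).1 _ hy
      (hUρ k _ (hk3 y hyN))).1
    rw [hdx hy hs, norm_smul, Real.norm_eq_abs, aθ, lenScale_eq_rpow (hB.pos k)]
    exact h2.trans (mul_le_mul_of_nonneg_right hMM' (Real.rpow_nonneg (hθ k).le _))
  · filter_upwards [hκk, hθ1, hball N, htp] with k hk1 hk2 hk3 hk4 y hy hyN s hs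
    have h2 := ((hest _ _ (hθ k) hk2 (hB.mem_time k).2 hk1 _ (hI hs).1).1 _ hy
      (hUρ k _ (hk3 y hyN))).2.1
    rw [hdt hk4 hy hs, norm_smul, Real.norm_eq_abs, aθ']
    exact h2.trans hMM'
  · filter_upwards [hκk, hθ1, hball N] with k hk1 hk2 hk3 y hy hyN s hs s' hs'
    have h2 := (((hest _ _ (hθ k) hk2 (hB.mem_time k).2 hk1 _ (hI hs).1).1 _ hy
      (hUρ k _ (hk3 y hyN))).2.2 _ (hI hs').1).1
    rw [unscaleT_sub (hB.pos k)] at h2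
    rw [hdx hy hs, hdx hy hs', ← smul_sub, norm_smul, Real.norm_eq_abs, aθ]
    exact h2.trans (mul_le_mul_of_nonneg_right hMM' (by positivity))
  · filter_upwards [hκk, hθ1, hball N, htp] with k hk1 hk2 hk3 hk4 y hy hyN s hs s' hs'
    have h2 := (((hest _ _ (hθ k) hk2 (hB.mem_time k).2 hk1 _ (hI hs).1).1 _ hy
      (hUρ k _ (hk3 y hyN))).2.2 _ (hI hs').1).2
    rw [unscaleT_sub (hB.pos k)] at h2
    rw [hdt hk4 hy hs, hdt hk4 hy hs', ← smul_sub, norm_smul, Real.norm_eq_abs, aθ']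
    exact h2.trans (mul_le_mul_of_nonneg_right hMM' (by positivity))
  · filter_upwards [hκk, hθ1, hball N] with k hk1 hk2 hk3 y hy y' hy' hyN hyN' s hs
    have h2 := ((hest _ _ (hθ k) hk2 (hB.mem_time k).2 hk1 _ (hI hs).1).2 (Metric.ball (x k) r)
      Metric.isOpen_ball (convex_ball _ _) (fun z hz => (hUρ k z hz).le) (hUL k) _ hy _ hy'
      (hk3 y hyN) (hk3 y' hyN')).1
    rw [unscaleX_sub (hB.pos k)] at h2
    rw [hdx hy hs, hdx hy' hs, ← smul_sub, norm_smul, Real.norm_eq_abs, aθ]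
    refine (h2.trans (mul_le_mul_of_nonneg_right hMM' ?_)).trans
      (scaled_increment_le hM'0 (hε k).le (norm_nonneg _))
    have := (hε k).le
    positivity
  · filter_upwards [hκk, hθ1, hball N, htp] with k hk1 hk2 hk3 hk4 y hy y' hy' hyN hyN' s hs
    have h2 := ((hest _ _ (hθ k) hk2 (hB.mem_time k).2 hk1 _ (hI hs).1).2 (Metric.ball (x k) r)
      Metric.isOpen_ball (convex_ball _ _) (fun z hz => (hUρ k z hz).le) (hUL k) _ hy _ hy'
      (hk3 y hyN) (hk3 y' hyN')).2
    rw [unscaleX_sub (hB.pos k)] at h2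
    rw [hdt hk4 hy hs, hdt hk4 hy' hs, ← smul_sub, norm_smul, Real.norm_eq_abs, aθ']
    refine (h2.trans (mul_le_mul_of_nonneg_right hMM' ?_)).trans
      (scaled_increment_le hM'0 (hε k).le (norm_nonneg _))
    have := (hε k).le
    positivity

end Uniform

/-! ### Limits of self-similar solutions -/

section TimeLimit

/-- Curves on the growing intervals `[-τ k, 0]` whose derivatives have a common bound and a common
modulus of continuity have a subsequence that converges in `C¹`, locally uniformly. -/
lemma exists_timeLimit {τ : ℕ → ℝ} (hτ : Tendsto τ atTop atTop) {g : ℕ → ℝ → E 3}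
    (hg : ∀ k, DifferentiableOn ℝ (g k) (Icc (-τ k) 0)) {M : ℝ} {ω : ℝ → ℝ} (hω : Continuous ω)
    (hω0 : ω 0 = 0) (hωm : MonotoneOn ω (Ici 0)) (h0 : ∀ᶠ k in atTop, ‖g k 0‖ ≤ M)
    (hb : ∀ᶠ k in atTop, ∀ s ∈ Icc (-τ k) 0, ‖derivWithin (g k) (Icc (-τ k) 0) s‖ ≤ M)
    (hm : ∀ᶠ k in atTop, ∀ s ∈ Icc (-τ k) 0, ∀ s' ∈ Icc (-τ k) 0,
      ‖derivWithin (g k) (Icc (-τ k) 0) s - derivWithin (g k) (Icc (-τ k) 0) s'‖ ≤ ω |s - s'|) :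
    ∃ φ : ℕ → ℕ, StrictMono φ ∧ ∃ W f : ℝ → E 3, (∀ s, HasDerivAt W (f s) s) ∧
      (∀ s, ‖f s‖ ≤ M) ∧ (∀ s s', ‖f s - f s'‖ ≤ ω |s - s'|) ∧
      ∀ ρ : ℝ, ∀ ε > 0, ∀ᶠ k in atTop, ∀ s ∈ Icc (-ρ) 0, s ∈ Icc (-τ (φ k)) 0 ∧
        ‖g (φ k) s - W s‖ ≤ ε ∧ ‖derivWithin (g (φ k)) (Icc (-τ (φ k)) 0) s - f s‖ ≤ ε := by
  obtain ⟨k₀, hk₀⟩ := eventually_atTop.1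
    (((h0.and hb).and hm).and (hτ.eventually_ge_atTop 0))
  have hadd : StrictMono fun k : ℕ => k + k₀ := strictMono_id.add_const k₀
  have hτ0 : ∀ k, -τ (k + k₀) ≤ 0 := fun k => neg_nonpos.2 (hk₀ _ (Nat.le_add_left _ _)).2
  -- the derivatives, extended to the line by constants
  set F : ℕ → ℝ → E 3 := fun k s => derivWithin (g (k + k₀)) (Icc (-τ (k + k₀)) 0)
    (projIcc (-τ (k + k₀)) 0 (hτ0 k) s) with hF
  obtain ⟨φ, hφ, f, hfc, hfb, hfm, hfl⟩ := exists_subseq_locallyUniform (C := M) (f := F) hω hω0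
    (fun k s => (hk₀ _ (Nat.le_add_left _ _)).1.1.2 _ (projIcc _ _ (hτ0 k) s).2)
    (fun k s s' => ((hk₀ _ (Nat.le_add_left _ _)).1.2 _ (projIcc _ _ (hτ0 k) s).2 _
      (projIcc _ _ (hτ0 k) s').2).trans (hωm (mem_Ici.2 (abs_nonneg _)) (mem_Ici.2 (abs_nonneg _))
        (abs_projIcc_sub_projIcc (hτ0 k))))
  obtain ⟨w₀, -, ψ, hψ, hw₀⟩ := (isCompact_closedBall (0 : E 3) M).tendsto_subseq
    (x := fun k => g (φ k + k₀) 0)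
    (fun k => mem_closedBall_zero_iff.2 (hk₀ _ (Nat.le_add_left _ _)).1.1.1)
  have hW : ∀ s, HasDerivAt (fun s => w₀ + ∫ r in (0 : ℝ)..s, f r) (f s) s := fun s =>
    (hfc.integral_hasStrictDerivAt 0 s).hasDerivAt.const_add w₀
  refine ⟨fun k => φ (ψ k) + k₀, hadd.comp (hφ.comp hψ), _, f, hW, hfb, hfm, fun ρ ε hε => ?_⟩
  have hδ : 0 < ε / (|ρ| + 2) := by positivity
  have hδε : ε / (|ρ| + 2) * (|ρ| + 1) ≤ ε / (|ρ| + 2) * (|ρ| + 2) :=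
    mul_le_mul_of_nonneg_left (by linarith) hδ.le
  have hδε' : ε / (|ρ| + 2) * (|ρ| + 2) = ε := div_mul_cancel₀ _ (by positivity)
  have hτφ := hτ.comp (hadd.comp (hφ.comp hψ)).tendsto_atTop
  filter_upwards [hψ.tendsto_atTop.eventually (hfl |ρ| _ hδ), hτφ.eventually_ge_atTop |ρ|,
    (Metric.tendsto_nhds.1 hw₀) _ hδ] with k hk1 hk2 hk3 s hs
  have hk2 : |ρ| ≤ τ (φ (ψ k) + k₀) := hk2
  set I := Icc (-τ (φ (ψ k) + k₀)) 0 with hI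
  have hsub : Icc (-|ρ|) 0 ⊆ I := Icc_subset_Icc_left (by linarith)
  have hmem : ∀ r ∈ Icc (-|ρ|) 0, ‖derivWithin (g (φ (ψ k) + k₀)) I r - f r‖ ≤ ε / (|ρ| + 2) := by
    intro r hr
    have h2 := hk1 r ⟨hr.1, hr.2.trans (abs_nonneg ρ)⟩
    have h3 : (projIcc _ _ (hτ0 (φ (ψ k))) r : ℝ) = r := by
      rw [projIcc_of_mem (hτ0 (φ (ψ k))) (hsub hr)]
    simp only [hF, h3] at h2
    exact h2
  have hs' : s ∈ Icc (-|ρ|) 0 := ⟨by linarith [hs.1, le_abs_self ρ], hs.2⟩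
  refine ⟨hsub hs', ?_, (hmem s hs').trans ?_⟩
  · have hmv := (convex_Icc (-|ρ|) 0).norm_image_sub_le_of_norm_hasDerivWithin_le
      (f := fun r => g (φ (ψ k) + k₀) r - (w₀ + ∫ r in (0 : ℝ)..r, f r))
      (fun r hr => (((hg _ r (hsub hr)).hasDerivWithinAt.mono hsub).sub
        (hW r).hasDerivWithinAt)) hmem
      (right_mem_Icc.2 (by linarith [abs_nonneg ρ])) hs'
    simp only [intervalIntegral.integral_same, add_zero, sub_zero] at hmv
    have h4 : ‖g (φ (ψ k) + k₀) 0 - w₀‖ ≤ ε / (|ρ| + 2) := by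
      rw [← dist_eq_norm]; exact hk3.le
    have h5 : ‖s‖ ≤ |ρ| := by
      rw [Real.norm_eq_abs, abs_of_nonpos hs.2]; linarith [hs'.1]
    have h6 := mul_le_mul_of_nonneg_left h5 hδ.le
    have h7 := norm_le_norm_sub_add (g (φ (ψ k) + k₀) s - (w₀ + ∫ r in (0 : ℝ)..s, f r))
      (g (φ (ψ k) + k₀) 0 - w₀)
    linarith
  · linarith [mul_nonneg hδ.le (abs_nonneg ρ)]

end TimeLimit

section HolderLimit

variable {n : ℕ} {F : Type*} [NormedAddCommGroup F] {γ γ' : ℝ} {S : ℕ → Set (E n × ℝ)}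
  {T : Set (E n × ℝ)} {f : ℕ → E n → ℝ → F} {g : E n → ℝ → F}

/-- On compact sets, bounds in `C^γ` imply bounds in `C^{γ'}` for `γ' < γ`. -/
lemma BoundedHolder.of_lt (hγ' : 0 < γ') (h : γ' < γ) (hf : BoundedHolder γ S f) :
    BoundedHolder γ' S f := by
  intro K hK
  obtain ⟨C, hC, h1⟩ := hf K hK
  refine ⟨max C ((2 * C) ^ (1 - γ' / γ) * C ^ (γ' / γ)), le_max_of_le_left hC, ?_⟩
  filter_upwards [h1] with k hk
  exact parabolicHolderLE_interpolate (hγ'.trans h) hγ' h hC hC hk.1 hk.2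

lemma TendsToZeroHolder.congr {f' : ℕ → E n → ℝ → F} (hf : TendsToZeroHolder γ S f)
    (h : ∀ᶠ k in atTop, ∀ z ∈ S k, f' k z.1 z.2 = f k z.1 z.2) : TendsToZeroHolder γ S f' :=
  fun K hK ε hε => by
    filter_upwards [hf K hK ε hε, h] with k hk1 hk2
    exact hk1.congr fun z hz => hk2 z hz.2

lemma TendsToZeroHolder.holderConverges {g' : E n → ℝ → F}
    (hf : TendsToZeroHolder γ S (fun k x t => f k x t - g' x t))
    (hg : BoundedHolder γ (fun _ => T) (fun _ => g')) (h : ∀ z ∈ T, g z.1 z.2 = g' z.1 z.2) :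
    HolderConverges γ S T f g := by
  refine ⟨fun K hK => ?_, fun K hK ε hε => ?_⟩
  · obtain ⟨C, -, h1⟩ := hg K hK
    obtain ⟨k, hk⟩ := h1.exists
    exact ⟨C, hk.congr fun z hz => h z hz.2⟩
  · filter_upwards [hf K hK ε hε] with k hk
    exact (hk.mono inter_subset_left le_rfl).congr fun z hz => by simp only [h z hz.2]

/-- A field that depends on time only, with increments of size `s + s^{γ/2}`. -/
lemma boundedHolder_of_time {A : ℕ → Set (E n)} {I : ℕ → Set ℝ} {g : ℝ → F} (hγ : 0 < γ)
    (hγ1 : γ ≤ 1) {C : ℝ} (hC : 0 ≤ C) (hI : ∀ k, I k ⊆ Iic 0) (hb : ∀ s ≤ 0, ‖g s‖ ≤ C)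
    (hm : ∀ s s', ‖g s - g s'‖ ≤ C * (|s - s'| + |s - s'| ^ (γ / 2))) :
    BoundedHolder γ (fun k => A k ×ˢ I k) (fun _ (_ : E n) s => g s) := by
  refine boundedHolder_of_increments hγ hγ1 hC
    (fun M => Eventually.of_forall fun k x _ t ht _ _ => hb t (hI k ht))
    (fun M => Eventually.of_forall fun k x _ x' _ t _ _ _ => ?_)
    (fun M => Eventually.of_forall fun k x _ t _ t' _ _ _ _ => hm t t')
  rw [sub_self, norm_zero]
  positivity

lemma BoundedHolder.sub {f' : ℕ → E n → ℝ → F} (hf : BoundedHolder γ S f)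
    (hf' : BoundedHolder γ S f') : BoundedHolder γ S (fun k x t => f k x t - f' k x t) := by
  simpa only [sub_eq_add_neg] using hf.add hf'.neg

end HolderLimit

section Spatial

variable {R a b T₀ α γ γ' M : ℝ} {v : E 3 → ℝ → E 3} {p : E 3 → ℝ → ℝ} {xs : E 3} {x : ℕ → E 3}
  {t Q : ℕ → ℝ} {X : Set (E 3)} {W f : ℝ → E 3}

lemma differentiableOn_scaledV_space {Q : ℝ} {x₀ : E 3} {t₀ : ℝ} (hv : IsASESolution R a b T₀ v p)
    {s : ℝ} (hs : unscaleT α Q t₀ s ∈ Ico 0 T₀) :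
    DifferentiableOn ℝ (fun y => scaledV α Q x₀ t₀ v y s) (scaledX R α Q x₀) := fun y hy =>
  ((hv.hasFDerivWithinAt hy hs).comp y (hasFDerivAt_unscaleX y).hasFDerivWithinAt
    (fun _ hz => hz : MapsTo _ (scaledX R α Q x₀) (pipe R))).differentiableWithinAt.const_smul Q⁻¹

lemma differentiableOn_scaledV_time {Q : ℝ} {x₀ : E 3} {t₀ : ℝ} (hQ : 0 < Q) (hT : t₀ < T₀)
    (hv : IsASESolution R a b T₀ v p) {y : E 3} (hy : y ∈ scaledX R α Q x₀) :
    DifferentiableOn ℝ (fun s => scaledV α Q x₀ t₀ v y s) (scaledI α Q t₀) := fun s hs =>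
  ((hv.euler.differentiable_time _ hy _ (unscaleT_mem hQ hT hs).2).hasDerivWithinAt.scomp s
    (hasDerivAt_unscaleT s).hasDerivWithinAt
    (fun _ hz => (unscaleT_mem hQ hT hz).2 :
      MapsTo _ (scaledI α Q t₀) (Ico 0 T₀))).differentiableWithinAt.const_smul Q⁻¹

lemma zero_mem_scaledX {Q : ℝ} {x₀ : E 3} (h : x₀ ∈ pipe R) : (0 : E 3) ∈ scaledX R α Q x₀ := by
  show unscaleX α Q x₀ 0 ∈ pipe R
  simpa [unscaleX_eq] using h

lemma UniformEstimates.sub_space_le (hB : IsBlowUpSequence R T₀ v xs x t Q)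
    (hv : IsASESolution R a b T₀ v p) (hU : UniformEstimates R α γ v x t Q M) (N : ℝ) :
    ∀ᶠ k in atTop, ∀ y ∈ scaledX R α (Q k) (x k), ∀ y' ∈ scaledX R α (Q k) (x k), ‖y‖ ≤ N →
      ‖y'‖ ≤ N → ∀ s ∈ scaledI α (Q k) (t k),
      ‖scaledV α (Q k) (x k) (t k) v y s - scaledV α (Q k) (x k) (t k) v y' s‖
        ≤ M * lenScale α (Q k) * ‖y - y'‖ := by
  filter_upwards [hU.dx_le N] with k hk y hy y' hy' hyN hyN' s hs
  have hd := differentiableOn_scaledV_space (x₀ := x k) hv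
    (unscaleT_mem (hB.pos k) (hB.mem_time k).2 hs).2
  exact (convex_scaledX.inter (convex_closedBall 0 N)).norm_image_sub_le_of_norm_hasFDerivWithin_le
    (fun z hz => (hd z hz.1).hasFDerivWithinAt.mono inter_subset_left)
    (fun z hz => hk z hz.1 (mem_closedBall_zero_iff.1 hz.2) s hs)
    ⟨hy', mem_closedBall_zero_iff.2 hyN'⟩ ⟨hy, mem_closedBall_zero_iff.2 hyN⟩

lemma UniformEstimates.sub_time_le (hB : IsBlowUpSequence R T₀ v xs x t Q)
    (hv : IsASESolution R a b T₀ v p) (hU : UniformEstimates R α γ v x t Q M) (N : ℝ) :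
    ∀ᶠ k in atTop, ∀ y ∈ scaledX R α (Q k) (x k), ‖y‖ ≤ N →
      ∀ s ∈ scaledI α (Q k) (t k), ∀ s' ∈ scaledI α (Q k) (t k),
      ‖scaledV α (Q k) (x k) (t k) v y s - scaledV α (Q k) (x k) (t k) v y s'‖
        ≤ M * |s - s'| := by
  filter_upwards [hU.dt_le N] with k hk y hy hyN s hs s' hs'
  have hd := differentiableOn_scaledV_time (hB.pos k) (hB.mem_time k).2 hv hy
  have hc : Convex ℝ (scaledI α (Q k) (t k)) := by
    rw [scaledI_eq (hB.pos k)]; exact convex_Icc _ _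
  exact hc.norm_image_sub_le_of_norm_hasDerivWithin_le (fun r hr => (hd r hr).hasDerivWithinAt)
    (fun r hr => hk y hy hyN r hr) hs' hs

lemma UniformEstimates.boundedHolder (h0 : 0 < α) (h1 : α < 1) (hγ : 0 < γ) (hγ1 : γ ≤ 1)
    (hB : IsBlowUpSequence R T₀ v xs x t Q)
    (hv : IsASESolution R a b T₀ v p) (hU : UniformEstimates R α γ v x t Q M) :
    BoundedHolder γ (fun k => scaledX R α (Q k) (x k) ×ˢ scaledI α (Q k) (t k))
      (fun k => scaledV α (Q k) (x k) (t k) v) ∧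
    BoundedHolder γ (fun k => scaledX R α (Q k) (x k) ×ˢ scaledI α (Q k) (t k))
      (fun k => dx (scaledX R α (Q k) (x k)) (scaledV α (Q k) (x k) (t k) v)) ∧
    BoundedHolder γ (fun k => scaledX R α (Q k) (x k) ×ˢ scaledI α (Q k) (t k))
      (fun k => dt (scaledI α (Q k) (t k)) (scaledV α (Q k) (x k) (t k) v)) := by
  have hM := hU.nonneg
  have hε1 : ∀ᶠ k in atTop, lenScale α (Q k) ≤ 1 :=
    (hB.tendsto_lenScale h0 h1).eventually (ge_mem_nhds one_pos)
  have hε : ∀ k, 0 < lenScale α (Q k) := fun k => lenScale_pos (hB.pos k)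
  have hM2 : 0 ≤ 2 * M := by linarith
  have hle : ∀ {k} {r : ℝ}, lenScale α (Q k) ≤ 1 → 0 ≤ r →
      M * (lenScale α (Q k) + lenScale α (Q k) ^ γ) * r ≤ 2 * M * r := by
    intro k r hk hr
    refine mul_le_mul_of_nonneg_right ?_ hr
    have := Real.rpow_le_one (hε k).le hk hγ.le
    nlinarith
  have htime : ∀ {r : ℝ}, 0 ≤ r → M * r ≤ 2 * M * r := fun hr =>
    mul_le_mul_of_nonneg_right (by linarith) hr
  refine ⟨boundedHolder_of_increments hγ hγ1 hM2 (fun N => ?_) (fun N => ?_) (fun N => ?_),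
    boundedHolder_of_increments hγ hγ1 hM2 (fun N => ?_) (fun N => ?_) (fun N => ?_),
    boundedHolder_of_increments hγ hγ1 hM2 (fun N => ?_) (fun N => ?_) (fun N => ?_)⟩
  · filter_upwards [hU.norm_le] with k hk y hy s hs _ _
    exact (hk y hy s hs).trans (by linarith)
  · filter_upwards [hU.sub_space_le hB hv N, hε1] with k hk hk1 y hy y' hy' s hs hyN hyN'
    refine (hk y hy y' hy' hyN hyN' s hs).trans ?_
    have h2 : 0 ≤ ‖y - y'‖ ^ γ := by positivity
    refine mul_le_mul ?_ (le_add_of_nonneg_right h2) (norm_nonneg _) hM2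
    nlinarith
  · filter_upwards [hU.sub_time_le hB hv N] with k hk y hy s hs s' hs' hyN _ _
    refine (hk y hy hyN s hs s' hs').trans ?_
    have h2 : 0 ≤ |s - s'| ^ (γ / 2) := by positivity
    exact mul_le_mul (by linarith) (le_add_of_nonneg_right h2) (abs_nonneg _) hM2
  · filter_upwards [hU.dx_le N, hε1] with k hk hk1 y hy s hs hyN _
    refine (hk y hy hyN s hs).trans ?_
    nlinarith
  · filter_upwards [hU.dx_space N, hε1] with k hk hk1 y hy y' hy' s hs hyN hyN'
    exact (hk y hy y' hy' hyN hyN' s hs).trans (hle hk1 (by positivity))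
  · filter_upwards [hU.dx_time N] with k hk y hy s hs s' hs' hyN _ _
    exact (hk y hy hyN s hs s' hs').trans (htime (by positivity))
  · filter_upwards [hU.dt_le N] with k hk y hy s hs hyN _
    exact (hk y hy hyN s hs).trans (by linarith)
  · filter_upwards [hU.dt_space N, hε1] with k hk hk1 y hy y' hy' s hs hyN hyN'
    exact (hk y hy y' hy' hyN hyN' s hs).trans (hle hk1 (by positivity))
  · filter_upwards [hU.dt_time N] with k hk y hy s hs s' hs' hyN _ _
    exact (hk y hy hyN s hs s' hs').trans (htime (by positivity))

/-- A compact set of space-time points is contained in a product of a ball and an interval. -/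
lemma exists_radius_of_isCompact {n : ℕ} {K : Set (E n × ℝ)} (hK : IsCompact K) :
    ∃ N, 0 ≤ N ∧ ∀ z ∈ K, ‖z.1‖ ≤ N ∧ |z.2| ≤ N := by
  obtain ⟨N, hN⟩ := hK.isBounded.subset_closedBall 0
  refine ⟨max N 0, le_max_right _ _, fun z hz => ?_⟩
  have h1 := (mem_closedBall_zero_iff.1 (hN hz)).trans (le_max_left N 0)
  exact ⟨(norm_fst_le z).trans h1, (norm_snd_le z).trans h1⟩

/-- Rescaled solutions that become constant in space, and whose values at the centre converge in
`C¹`, converge to a field that depends on time only. -/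
theorem UniformEstimates.isFieldLimit (hR : 0 < R) (hT : 0 < T₀) (hv : IsASESolution R a b T₀ v p)
    (h0 : 0 < α) (h1 : α < 1) (hγ' : 0 < γ') (hγγ : γ' < γ) (hγ1 : γ ≤ 1)
    (hB : IsBlowUpSequence R T₀ v xs x t Q)
    (hX : IsLimitDomain (sideDist R α x Q) (eR xs) X)
    (hU : UniformEstimates R α γ v x t Q M) (hW : ∀ s, HasDerivAt W (f s) s)
    (hWb : ∀ s ≤ 0, ‖W s‖ ≤ M) (hfb : ∀ s, ‖f s‖ ≤ M)
    (hfm : ∀ s s', ‖f s - f s'‖ ≤ M * (|s - s'| + |s - s'| ^ (γ / 2)))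
    (hlim : ∀ ρ : ℝ, ∀ ε > 0, ∀ᶠ k in atTop, ∀ s ∈ Icc (-ρ) 0, s ∈ scaledI α (Q k) (t k) ∧
      ‖scaledV α (Q k) (x k) (t k) v 0 s - W s‖ ≤ ε ∧
      ‖dt (scaledI α (Q k) (t k)) (scaledV α (Q k) (x k) (t k) v) 0 s - f s‖ ≤ ε) :
    IsFieldLimit R α γ' v p x t Q X (fun _ s => W s) (fun y s => -inner ℝ (f s) y) := by
  have hγ : 0 < γ := hγ'.trans hγγ
  have hM := hU.nonneg
  obtain ⟨bV, bdx, bdt⟩ := hU.boundedHolder h0 h1 hγ hγ1 hB hv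
  have hε : ∀ k, 0 < lenScale α (Q k) := fun k => lenScale_pos (hB.pos k)
  have hεl := hB.tendsto_lenScale h0 h1
  have hWm : ∀ s s', ‖W s - W s'‖ ≤ M * (|s - s'| + |s - s'| ^ (γ / 2)) := by
    intro s s'
    have h2 := convex_univ.norm_image_sub_le_of_norm_hasDerivWithin_le
      (fun r _ => (hW r).hasDerivWithinAt) (fun r _ => hfb r) (mem_univ s') (mem_univ s)
    refine h2.trans (mul_le_mul_of_nonneg_left (le_add_of_nonneg_right ?_) hM)
    positivity
  have hI : ∀ k, scaledI α (Q k) (t k) ⊆ Iic 0 := fun k s hs => hs.1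
  have bW : ∀ {A : ℕ → Set (E 3)} {I : ℕ → Set ℝ}, (∀ k, I k ⊆ Iic 0) →
      BoundedHolder γ (fun k => A k ×ˢ I k) (fun _ (_ : E 3) s => W s) :=
    fun hI => boundedHolder_of_time hγ hγ1 hM hI hWb hWm
  have bf : ∀ {A : ℕ → Set (E 3)} {I : ℕ → Set ℝ}, (∀ k, I k ⊆ Iic 0) →
      BoundedHolder γ (fun k => A k ×ˢ I k) (fun _ (_ : E 3) s => f s) :=
    fun hI => boundedHolder_of_time hγ hγ1 hM hI (fun s _ => hfb s) hfm
  have h00 : ∀ k, (0 : E 3) ∈ scaledX R α (Q k) (x k) := fun k => zero_mem_scaledX (hB.mem_space k)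
  -- convergence of the four fields
  have zV : TendsToZeroHolder γ' (fun k => scaledX R α (Q k) (x k) ×ˢ scaledI α (Q k) (t k))
      (fun k y s => scaledV α (Q k) (x k) (t k) v y s - W s) := by
    refine (bV.sub (bW hI)).tendsToZero hγ' hγγ fun K hK ε hε' => ?_
    obtain ⟨N, hN, hKN⟩ := exists_radius_of_isCompact hK
    have h2 : Tendsto (fun k => M * lenScale α (Q k) * N) atTop (𝓝 0) := by
      simpa using (hεl.const_mul M).mul_const N
    filter_upwards [hU.sub_space_le hB hv N, hlim N _ (half_pos hε'),
      h2.eventually (gt_mem_nhds (half_pos hε'))] with k hk1 hk2 hk3 z hz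
    have h3 := hk1 z.1 hz.2.1 0 (h00 k) (hKN z hz.1).1 (by simpa using hN) z.2 hz.2.2
    have h4 := (hk2 z.2 ⟨(abs_le.1 (hKN z hz.1).2).1, hz.2.2.1⟩).2.1
    rw [sub_zero] at h3
    have h5 : M * lenScale α (Q k) * ‖z.1‖ ≤ M * lenScale α (Q k) * N :=
      mul_le_mul_of_nonneg_left (hKN z hz.1).1 (mul_nonneg hM (hε k).le)
    have h6 := norm_sub_le_norm_sub_add_norm_sub (scaledV α (Q k) (x k) (t k) v z.1 z.2)
      (scaledV α (Q k) (x k) (t k) v 0 z.2) (W z.2)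
    linarith
  have zdx : TendsToZeroHolder γ' (fun k => scaledX R α (Q k) (x k) ×ˢ scaledI α (Q k) (t k))
      (fun k => dx (scaledX R α (Q k) (x k)) (scaledV α (Q k) (x k) (t k) v)) := by
    refine bdx.tendsToZero hγ' hγγ fun K hK ε hε' => ?_
    obtain ⟨N, hN, hKN⟩ := exists_radius_of_isCompact hK
    have h2 : Tendsto (fun k => M * lenScale α (Q k)) atTop (𝓝 0) := by
      simpa using hεl.const_mul M
    filter_upwards [hU.dx_le N, h2.eventually (gt_mem_nhds hε')] with k hk1 hk2 z hz
    exact (hk1 z.1 hz.2.1 (hKN z hz.1).1 z.2 hz.2.2).trans hk2.le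
  have zdt : TendsToZeroHolder γ' (fun k => scaledX R α (Q k) (x k) ×ˢ scaledI α (Q k) (t k))
      (fun k y s => dt (scaledI α (Q k) (t k)) (scaledV α (Q k) (x k) (t k) v) y s - f s) := by
    refine (bdt.sub (bf hI)).tendsToZero hγ' hγγ fun K hK ε hε' => ?_
    obtain ⟨N, hN, hKN⟩ := exists_radius_of_isCompact hK
    have h2 : Tendsto (fun k => M * (lenScale α (Q k) + lenScale α (Q k) ^ γ) * (N + N ^ γ)) atTop
        (𝓝 0) := by
      have h3 := hεl.rpow_const (p := γ) (Or.inr hγ.le)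
      rw [Real.zero_rpow hγ.ne'] at h3
      simpa using ((hεl.add h3).const_mul M).mul_const (N + N ^ γ)
    filter_upwards [hU.dt_space N, hlim N _ (half_pos hε'),
      h2.eventually (gt_mem_nhds (half_pos hε'))] with k hk1 hk2 hk3 z hz
    have h3 := hk1 z.1 hz.2.1 0 (h00 k) (hKN z hz.1).1 (by simpa using hN) z.2 hz.2.2
    have h4 := (hk2 z.2 ⟨(abs_le.1 (hKN z hz.1).2).1, hz.2.2.1⟩).2.2
    rw [sub_zero] at h3
    have hr := Real.rpow_nonneg (hε k).le γ
    have h5 : M * (lenScale α (Q k) + lenScale α (Q k) ^ γ) * (‖z.1‖ + ‖z.1‖ ^ γ)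
        ≤ M * (lenScale α (Q k) + lenScale α (Q k) ^ γ) * (N + N ^ γ) :=
      mul_le_mul_of_nonneg_left (add_le_add (hKN z hz.1).1
        (Real.rpow_le_rpow (norm_nonneg _) (hKN z hz.1).1 hγ.le))
        (mul_nonneg hM (add_nonneg (hε k).le hr))
    have h6 := norm_sub_le_norm_sub_add_norm_sub
      (dt (scaledI α (Q k) (t k)) (scaledV α (Q k) (x k) (t k) v) z.1 z.2)
      (dt (scaledI α (Q k) (t k)) (scaledV α (Q k) (x k) (t k) v) 0 z.2) (f z.2)
    linarith
  -- the pressure gradient is expressed by the other fields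
  have zgrad : TendsToZeroHolder γ' (fun k => scaledX R α (Q k) (x k) ×ˢ scaledI α (Q k) (t k))
      (fun k y s => grad (scaledX R α (Q k) (x k)) (scaledP α (Q k) (x k) (t k) p) y s - -f s) := by
    refine (zdt.neg.add (zdx.clm_apply (bV.of_lt hγ' hγγ)).neg).congr ?_
    filter_upwards [hB.eventually_time_pos hT] with k hk z hz
    have h2 := scaled_momentum hR h0.ne' (hB.pos k) hk (hB.mem_time k).2 hv hz.1 hz.2
    rw [eq_neg_of_add_eq_zero_right h2]
    abel
  have hζ0 : eR xs ≠ 0 := by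
    intro h2; have := norm_eR hB.radius_pos.ne'; rw [h2] at this; simp at this
  have hXu := hX.uniqueDiffOn hζ0
  have hq : ∀ y s, HasFDerivAt (fun y => -inner ℝ (f s) y) (-(innerSL ℝ (f s))) y :=
    fun y s => (innerSL ℝ (f s)).hasFDerivAt.neg
  have bX : ∀ {g : ℝ → E 3}, BoundedHolder γ (fun _ => X ×ˢ Iic 0) (fun _ (_ : E 3) s => g s) →
      BoundedHolder γ' (fun _ => X ×ˢ Iic 0) (fun _ (_ : E 3) s => g s) :=
    fun h => h.of_lt hγ' hγγ
  have hfm' : ∀ s s', ‖-f s - -f s'‖ ≤ M * (|s - s'| + |s - s'| ^ (γ / 2)) := fun s s' => by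
    rw [neg_sub_neg, norm_sub_rev]; exact hfm s s'
  refine ⟨fun s _ => differentiableOn_const _,
    fun y _ s _ => (hW s).differentiableAt.differentiableWithinAt,
    fun s _ y _ => (hq y s).differentiableAt.differentiableWithinAt,
    zV.holderConverges (g' := fun _ s => W s) (bX (bW fun _ => subset_rfl)) fun z hz => rfl,
    TendsToZeroHolder.holderConverges (g' := fun _ _ => 0) (by simpa using zdx) ?_ ?_,
    zdt.holderConverges (g' := fun _ s => f s) (bX (bf fun _ => subset_rfl)) ?_,
    zgrad.holderConverges (g' := fun _ s => -f s)
      (bX (boundedHolder_of_time hγ hγ1 hM (fun _ => subset_rfl)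
        (fun s _ => (norm_neg (f s)).le.trans (hfb s)) hfm')) ?_⟩
  · refine boundedHolder_of_time (g := fun _ => (0 : E 3 →L[ℝ] E 3)) hγ' (hγγ.le.trans hγ1) le_rfl
      (fun _ => subset_rfl) (fun s _ => by simp) (fun s s' => by simp)
  · intro z hz
    simp [dx]
  · intro z hz
    exact (hW z.2).hasDerivWithinAt.derivWithin (uniqueDiffOn_Iic 0 z.2 hz.2)
  · intro z hz
    refine ext_inner_right ℝ fun d => ?_
    rw [grad, inner_gradientWithin_left, (hq z.1 z.2).hasFDerivWithinAt.fderivWithin (hXu z.1 hz.1)]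
    simp

/-- A blow-up sequence with uniform estimates has a local limit that depends on time only and decays
at time `-∞`. -/
theorem UniformEstimates.exists_isLocalLimit (hR : 0 < R) (hab : a < b) (hT : 0 < T₀)
    (hv : IsASESolution R a b T₀ v p) (h0 : 0 < α) (h1 : α < 1) (hγ' : 0 < γ') (hγγ : γ' < γ)
    (hγ1 : γ ≤ 1) (hB : IsBlowUpSequence R T₀ v xs x t Q) (hN : IsNearMaximal R v x t)
    (hU : UniformEstimates R α γ v x t Q M) :
    ∃ (X : Set (E 3)) (w : E 3 → ℝ → E 3) (q : E 3 → ℝ → ℝ),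
      IsLocalLimit R α γ' v p x t Q X w q ∧ IsPlanarAncientSolution (eR xs) X w q ∧
      IsBoundedField X w ∧
      ∃ f : ℝ → E 3, (∀ y ∈ X, ∀ s ≤ 0, w y s = f s) ∧ Tendsto f atBot (𝓝 0) := by
  have hγ : 0 < γ := hγ'.trans hγγ
  have h00 : ∀ k, (0 : E 3) ∈ scaledX R α (Q k) (x k) := fun k => zero_mem_scaledX (hB.mem_space k)
  have hI : ∀ k, scaledI α (Q k) (t k) = Icc (-(t k / timeScale α (Q k))) 0 :=
    fun k => scaledI_eq (hB.pos k)
  have h0I : ∀ k, (0 : ℝ) ∈ scaledI α (Q k) (t k) := fun k => by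
    refine ⟨le_rfl, ?_⟩
    rw [unscaleT_eq, mul_zero, zero_add]; exact (hB.mem_time k).1
  have hτ : Tendsto (fun k => t k / timeScale α (Q k)) atTop atTop := by
    have h2 : Tendsto (fun k => timeScale α (Q k)) atTop (𝓝[>] 0) :=
      tendsto_nhdsWithin_iff.2 ⟨hB.tendsto_timeScale h0,
        Eventually.of_forall fun k => timeScale_pos (hB.pos k)⟩
    exact hB.tendsto_time.pos_mul_atTop hT h2.inv_tendsto_nhdsGT_zero
  obtain ⟨φ, hφ, W, f, hW, hfb, hfm, hlim⟩ := exists_timeLimit (M := M)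
    (ω := fun r => M * (r + r ^ (γ / 2))) hτ
    (g := fun k s => scaledV α (Q k) (x k) (t k) v 0 s)
    (fun k => by
      rw [← hI]; exact differentiableOn_scaledV_time (hB.pos k) (hB.mem_time k).2 hv (h00 k))
    (continuous_const.mul (continuous_id.add
      (continuous_id.rpow_const fun _ => Or.inr (half_pos hγ).le)))
    (by simp [Real.zero_rpow (half_pos hγ).ne'])
    (fun r hr r' _ hrr => mul_le_mul_of_nonneg_left
      (add_le_add hrr (Real.rpow_le_rpow hr hrr (half_pos hγ).le)) hU.nonneg)
    (by filter_upwards [hU.norm_le] with k hk using hk 0 (h00 k) 0 (h0I k))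
    (by
      filter_upwards [hU.dt_le 0] with k hk s hs
      rw [← hI] at hs ⊢
      exact hk 0 (h00 k) (by simp) s hs)
    (by
      filter_upwards [hU.dt_time 0] with k hk s hs s' hs'
      rw [← hI] at hs hs' ⊢
      exact hk 0 (h00 k) (by simp) s hs s' hs')
  simp only [← hI] at hlim
  -- pointwise convergence at the centre carries the bounds over to the limit
  have hconv : ∀ s ≤ 0, (∀ᶠ k in atTop, s ∈ scaledI α (Q (φ k)) (t (φ k))) ∧
      Tendsto (fun k => scaledV α (Q (φ k)) (x (φ k)) (t (φ k)) v 0 s) atTop (𝓝 (W s)) := by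
    intro s hs
    have hmem : s ∈ Icc (-|s|) 0 := ⟨neg_abs_le s, hs⟩
    refine ⟨(hlim |s| 1 one_pos).mono fun k hk => (hk s hmem).1, ?_⟩
    rw [Metric.tendsto_nhds]
    intro ε hε
    filter_upwards [hlim |s| _ (half_pos hε)] with k hk
    rw [dist_eq_norm]
    linarith [(hk s hmem).2.1]
  have hWb : ∀ s ≤ 0, ‖W s‖ ≤ M := fun s hs => by
    refine le_of_tendsto (hconv s hs).2.norm ?_
    filter_upwards [(hconv s hs).1, hφ.tendsto_atTop.eventually hU.norm_le] with k hk1 hk2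
    exact hk2 0 (h00 _) s hk1
  have hWd : ∀ s < 0, ‖W s‖ ≤ M * (|s| ^ α)⁻¹ := fun s hs => by
    refine le_of_tendsto (hconv s hs.le).2.norm ?_
    filter_upwards [(hconv s hs.le).1, hφ.tendsto_atTop.eventually hU.decay] with k hk1 hk2
    exact hk2 s hk1 hs
  obtain ⟨ψ, hψ, X, hX⟩ := exists_limitDomain (α := α) (hB.comp hφ)
  have hB' := (hB.comp hφ).comp hψ
  have hU' := (hU.comp hφ).comp hψ
  have hL := hU'.isFieldLimit hR hT hv h0 h1 hγ' hγγ hγ1 hB' hX hW hWb hfb hfm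
    fun ρ ε hε => hψ.tendsto_atTop.eventually (hlim ρ ε hε)
  have hH : EventuallyHolder R α γ' v ((x ∘ φ) ∘ ψ) ((t ∘ φ) ∘ ψ) ((Q ∘ φ) ∘ ψ) := fun K hK => by
    obtain ⟨C, -, hC⟩ := (hU'.boundedHolder h0 h1 hγ hγ1 hB' hv).1.of_lt hγ' hγγ K hK
    exact ⟨C, hC⟩
  refine ⟨X, _, _, ⟨hL.diff_space, hL.diff_time, hL.diff_pressure, φ ∘ ψ, hφ.comp hψ,
      hX.setsConverge_scaledX h0 h1 hB', hL.conv, hL.conv_dx, hL.conv_dt, hL.conv_grad⟩,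
    hL.isPlanar hR hab hT hv h0 h1 hγ' hB' hX hH,
    hL.bounded hT h0 h1 hγ' hB' hX ((hN.comp φ).comp ψ), W, fun _ _ _ _ => rfl, ?_⟩
  have hz : Tendsto (fun s : ℝ => M * (|s| ^ α)⁻¹) atBot (𝓝 0) := by
    have := (((tendsto_rpow_atTop h0).comp tendsto_abs_atBot_atTop).inv_tendsto_atTop).const_mul M
    simpa using this
  refine squeeze_zero_norm' ?_ hz
  filter_upwards [eventually_lt_atBot 0] with s hs using hWd s hs

end Spatial

end AxiEuler

end

theorem mainTheorem1 (R a b T₀ : ℝ) (hR : 0 < R) (hab : a < b) (hT : 0 < T₀)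
    (v : E 3 → ℝ → E 3) (p : E 3 → ℝ → ℝ) (hv : IsASESolution R a b T₀ v p) :
    (∀ α γ : ℝ, 0 < α → α < 1 → 0 < γ → γ < 1 →
      ∀ (xs : E 3) (x : ℕ → E 3) (t Q : ℕ → ℝ),
        IsBlowUpSequence R T₀ v xs x t Q →
        IsAnchor R α v x t Q →
        LocallyBoundedC21 R α γ v x t Q →
        ∀ (X : Set (E 3)) (w : E 3 → ℝ → E 3) (q : E 3 → ℝ → ℝ),
          IsLocalLimit R α γ v p x t Q X w q →
            IsPlanarAncientSolution (eR xs) X w q ∧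
            (IsNearMaximal R v x t → IsBoundedField X w)) ∧
    (∀ α γ : ℝ, 0 < α → α < 1 → 0 < γ → γ < 1 →
      (0 : E 3) ∈ closure (cylinder R a b) →
      ∀ (V : E 3 → E 3) (W : E 3 → ℝ → E 3),
        IsAsymptoticallySelfSimilar (cylinder R a b) T₀ α γ v V W →
        MemCHolder γ (fun y => ‖y‖ * ‖fderiv ℝ V y‖) →
        MemCHolder γ (fun y => ‖y‖ ^ 2 * ‖fderiv ℝ (fderiv ℝ V) y‖) →
        ∀ γ' : ℝ, 0 < γ' → γ' < γ →
        ∀ (xs : E 3) (x : ℕ → E 3) (t Q : ℕ → ℝ),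
          IsBlowUpSequence R T₀ v xs x t Q →
          IsNearMaximal R v x t →
          ∃ (X : Set (E 3)) (w : E 3 → ℝ → E 3) (q : E 3 → ℝ → ℝ),
            IsLocalLimit R α γ' v p x t Q X w q ∧
            IsPlanarAncientSolution (eR xs) X w q ∧
            IsBoundedField X w ∧
            ∃ f : ℝ → E 3, (∀ y ∈ X, ∀ s ≤ 0, w y s = f s) ∧ Tendsto f atBot (𝓝 0)) := by
  refine ⟨fun α γ h0 h1 hγ _ xs x t Q hB _ hH X w q hL =>
    hL.isPlanar hR hab hT hv h0 h1 hγ hB hH, ?_⟩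
  intro α γ h0 h1 hγ hγ1 hcl V W hS hd1 hd2 γ' hγ' hγγ xs x t Q hB hN
  obtain ⟨F, B, C, hE⟩ := hS.exists_error h0.le h1.le hd1 hd2 hT
  obtain ⟨M, hU⟩ := hE.exists_uniformEstimates hR hab h0 h1 hγ hT hv hcl hB hN
  exact hU.exists_isLocalLimit hR hab hT hv h0 h1 hγ' hγγ hγ1.le hB hN
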